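/- **Setting.** Let $f$ be continuous on $\{0\le y\le x\le 1\}$, $g$ continuous on $[0,1]$, and $0<\underline D\le\overline D$ known. The plant, with unknown delay $D\in[\underline D,\overline D]$, is $$u_t=u_x+g(x)u(0,t)+\int_0^x f(x,y)u(y,t)\,dy,\quad u(1,t)=v(0,t),\qquad D v_t=v_x,\quad v(1,t)=U(t),\qquad x\in(0,1),\ t>0.$$ **Kernels.** Suppose that functions $k,l$ (continuous on $0\le y\le x\le1$, differentiable inside) and $\gamma(x,y,d),\eta(x,y,d)$ ($x,y\in[0,1]$, $d>0$) solve the kernel equations $$k_x+k_y=\int_y^x f(s,y)k(x,s)\,ds-f(x,y),\quad k(x,0)=\int_0^x k(x,y)g(y)\,dy-g(x),$$ $$l_x+l_y=-\int_y^x f(x,s)l(s,y)\,ds-f(x,y),\quad l(x,0)=-g(x),$$ $$\gamma_x=-d\gamma_y+d\int_y^1 f(s,y)\gamma(x,s,d)\,ds,\quad \gamma(x,0,d)=\int_0^1 g(y)\gamma(x,y,d)\,dy,\quad \gamma(0,y,d)=k(1,y),$$ $$\eta_x+d\eta_y=0,\quad \eta(x,0,d)=0,\quad \eta(0,y,d)=l(1,y),$$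 where $\gamma$ is locally Lipschitz, and $C^1$ off the characteristic $y=dx$, $\eta$ is continuous, and differentiable in $(x,y)$ off that line, and the last two differential equations hold off it. (Continuity of $\gamma$ forces $g(1)=0$.) Put $q(x,d)=\gamma(x,1,d)$, $p(x,d)=\eta(x,1,d)$, $$M_1=\gamma(x,1,d),\qquad M_2=\gamma(x,1,d)l(1,y)-\gamma_y(x,y,d)+\int_y^1\Big(-\gamma_y(x,\xi,d)l(\xi,y)+\gamma(x,\xi,d)f(\xi,y)+\int_\xi^1\gamma(x,s,d)f(s,\xi)l(\xi,y)\,ds\Big)d\xi,$$ $$M_3=q(x-y,d)+d\,q_d(x-y,d)+d\int_y^x \big(q+d\,q_d\big)(x-\xi,d)\,p(\xi-y,d)\,d\xi,$$ $$M_4=\gamma_d(x,y,d)+\int_y^1\gamma_d(x,\xi,d)l(\xi,y)\,d\xi+\int_0^x \big(q+d\,q_d\big)(x-\xi,d)\,\eta(\xi,y,d)\,d\xi,$$ and let $\overline M_i$ bound $|M_i|$ for $d\in[\underline D,\overline D]$, for $x,y\in[0,1]$ ($y\le x$ for $i=3$) at which the derivatives exist. Put $L=\max\{\overline M_1+\overline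 M_2,\,2\overline M_3+\overline M_4\}$. **Closed loop.** With the estimate $\hat D(t)$, $\hat D(0)\in[\underline D,\overline D]$, the control is $$U(t)=\int_0^1\gamma(1,y,\hat D(t))u(y,t)\,dy+\hat D(t)\int_0^1 q(1-y,\hat D(t))v(y,t)\,dy .$$ Put $w(x,t)=u(x,t)-\int_0^xk(x,y)u(y,t)\,dy$, $z(x,t)=v(x,t)-\int_0^1\gamma(x,y,\hat D)u(y,t)\,dy-\hat D\int_0^xq(x-y,\hat D)v(y,t)\,dy$, $P_1(x,t)=z(0,t)M_1(x,\hat D)+\int_0^1w(y,t)M_2(x,y,\hat D)\,dy$. For $b_1>2\overline D$ let $N(t)=\frac12\int_0^1(1+x)w^2dx+\frac{b_1}2\int_0^1(1+x)z^2dx$ and $$\dot{\hat D}=\theta\,\mathrm{Proj}_{[\underline D,\overline D]}\{\tau\},\qquad \tau(t)=\frac{-b_1\int_0^1(1+x)z(x,t)P_1(x,t)\,dx}{1+N(t)},\qquad 0<\theta<\theta^*=\frac{\min\{\underline D,b_1-2\overline D\}\min\{1,b_1\}}{2b_1^2L^2}$$ ($\theta^*=\infty$ if $L=0$), where $\mathrm{Proj}\{\tau\}=0$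 if $\hat D=\underline D$ and $\tau<0$, or if $\hat D=\overline D$ and $\tau>0$, and $\mathrm{Proj}\{\tau\}=\tau$ otherwise. Solutions are global, with $u,v$ continuous on $[0,1]\times[0,\infty)$, satisfying the differential equations along characteristics and the update law in integrated form. **Theorem.** There are constants $R,\rho>0$, independent of $D\in[\underline D,\overline D]$ and of the initial data, such that for every such solution $$\Psi(t)=\int_0^1u(x,t)^2dx+\int_0^1v(x,t)^2dx+(D-\hat D(t))^2$$ satisfies $\Psi(t)\le R\,(e^{\rho\Psi(0)}-1)$ for all $t\ge0$; moreover $\lim_{t\to\infty}\max_{x\in[0,1]}|u(x,t)|=0$ and $\lim_{t\to\infty}\max_{x\in[0,1]}|v(x,t)|=0$. -/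

import Mathlib

open Set Filter Topology MeasureTheory

namespace DelayPIDE

/-- The triangle `0 ≤ y ≤ x ≤ 1`. -/
def triangle : Set (ℝ × ℝ) := {p | 0 ≤ p.2 ∧ p.2 ≤ p.1 ∧ p.1 ≤ 1}

/-- The points `(x, y, d)` with `x, y ∈ [0, 1]` and `d > 0`. -/
def slab : Set (ℝ × ℝ × ℝ) := {p | p.1 ∈ Icc 0 1 ∧ p.2.1 ∈ Icc 0 1 ∧ 0 < p.2.2}

/-- The backstepping kernels `k, γ` and the inverse kernels `l, η` of the plant with coefficients
`f, g`; the last argument `d` of `γ` and `η` is the value of the delay (or of its estimate).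
The kernels `γ, η` carry the data at `x = 0` and the data at `y = 0` along the characteristic
`y = d x` issuing from the corner, and need not be differentiable across that line. -/
structure Kernels (f : ℝ → ℝ → ℝ) (g : ℝ → ℝ) where
  k : ℝ → ℝ → ℝ
  l : ℝ → ℝ → ℝ
  γ : ℝ → ℝ → ℝ → ℝ
  η : ℝ → ℝ → ℝ → ℝ
  k_cont : ContinuousOn (fun p : ℝ × ℝ => k p.1 p.2) triangle
  k_diff : ∀ x y, 0 < y → y < x → x < 1 →
    DifferentiableAt ℝ (fun p : ℝ × ℝ => k p.1 p.2) (x, y)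
  k_pde : ∀ x y, 0 < y → y < x → x < 1 →
    deriv (fun s => k s y) x = -deriv (fun s => k x s) y + (∫ s in y..x, f s y * k x s) - f x y
  k_bc : ∀ x ∈ Icc (0 : ℝ) 1, k x 0 = (∫ y in (0 : ℝ)..x, k x y * g y) - g x
  l_cont : ContinuousOn (fun p : ℝ × ℝ => l p.1 p.2) triangle
  l_diff : ∀ x y, 0 < y → y < x → x < 1 →
    DifferentiableAt ℝ (fun p : ℝ × ℝ => l p.1 p.2) (x, y)
  l_pde : ∀ x y, 0 < y → y < x → x < 1 →
    deriv (fun s => l s y) x + deriv (fun s => l x s) y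
      = -(∫ s in y..x, f x s * l s y) - f x y
  l_bc : ∀ x ∈ Icc (0 : ℝ) 1, l x 0 = -g x
  γ_lip : LocallyLipschitzOn slab (fun p : ℝ × ℝ × ℝ => γ p.1 p.2.1 p.2.2)
  γ_diff : ContDiffOn ℝ 1 (fun p : ℝ × ℝ × ℝ => γ p.1 p.2.1 p.2.2)
    (slab ∩ {p | p.2.1 ≠ p.2.2 * p.1})
  γ_pde : ∀ d > 0, ∀ x ∈ Ioo (0 : ℝ) 1, ∀ y ∈ Ioo (0 : ℝ) 1, y ≠ d * x →
    deriv (fun s => γ s y d) x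
      = -d * deriv (fun s => γ x s d) y + d * ∫ s in y..1, f s y * γ x s d
  γ_bc : ∀ d > 0, ∀ x ∈ Icc (0 : ℝ) 1, γ x 0 d = ∫ y in (0 : ℝ)..1, g y * γ x y d
  γ_init : ∀ d > 0, ∀ y ∈ Icc (0 : ℝ) 1, γ 0 y d = k 1 y
  η_cont : ContinuousOn (fun p : ℝ × ℝ × ℝ => η p.1 p.2.1 p.2.2) slab
  η_diff : ∀ d > 0, ∀ x ∈ Ioo (0 : ℝ) 1, ∀ y ∈ Ioo (0 : ℝ) 1, y ≠ d * x →
    DifferentiableAt ℝ (fun p : ℝ × ℝ => η p.1 p.2 d) (x, y)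
  η_pde : ∀ d > 0, ∀ x ∈ Ioo (0 : ℝ) 1, ∀ y ∈ Ioo (0 : ℝ) 1, y ≠ d * x →
    deriv (fun s => η s y d) x + d * deriv (fun s => η x s d) y = 0
  η_bc : ∀ d > 0, ∀ x ∈ Icc (0 : ℝ) 1, η x 0 d = 0
  η_init : ∀ d > 0, ∀ y ∈ Icc (0 : ℝ) 1, η 0 y d = l 1 y

namespace Kernels

variable {f : ℝ → ℝ → ℝ} {g : ℝ → ℝ} (K : Kernels f g)

/-- The kernel `q(x, d) = γ(x, 1, d)`. -/
def q (x d : ℝ) : ℝ := K.γ x 1 d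

/-- The kernel `p(x, d) = η(x, 1, d)`. -/
def p (x d : ℝ) : ℝ := K.η x 1 d

/-- The partial derivative of `γ` in `y`. -/
noncomputable def γy (x y d : ℝ) : ℝ := deriv (fun s => K.γ x s d) y

/-- The partial derivative of `γ` in `d`. -/
noncomputable def γd (x y d : ℝ) : ℝ := deriv (fun s => K.γ x y s) d

/-- The partial derivative of `q` in `d`. -/
noncomputable def qd (x d : ℝ) : ℝ := deriv (fun s => K.q x s) d

/-- The transformed plant state `w`, from the profile `φ = u(·, t)`. -/
noncomputable def w (φ : ℝ → ℝ) (x : ℝ) : ℝ := φ x - ∫ y in (0 : ℝ)..x, K.k x y * φ y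

/-- The transformed actuator state `z`, from the delay estimate `d = D̂(t)` and the profiles
`φ = u(·, t)`, `ψ = v(·, t)`. -/
noncomputable def z (d : ℝ) (φ ψ : ℝ → ℝ) (x : ℝ) : ℝ :=
  ψ x - (∫ y in (0 : ℝ)..1, K.γ x y d * φ y) - d * ∫ y in (0 : ℝ)..x, K.q (x - y) d * ψ y

/-- The certainty-equivalence control value. -/
noncomputable def control (d : ℝ) (φ ψ : ℝ → ℝ) : ℝ :=
  (∫ y in (0 : ℝ)..1, K.γ 1 y d * φ y) + d * ∫ y in (0 : ℝ)..1, K.q (1 - y) d * ψ y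

noncomputable def M₁ (x d : ℝ) : ℝ := K.γ x 1 d

noncomputable def M₂ (x y d : ℝ) : ℝ :=
  K.γ x 1 d * K.l 1 y - K.γy x y d
    + ∫ ξ in y..1, (-K.γy x ξ d * K.l ξ y + K.γ x ξ d * f ξ y
        + ∫ s in ξ..1, K.γ x s d * f s ξ * K.l ξ y)

noncomputable def M₃ (x y d : ℝ) : ℝ :=
  K.q (x - y) d + d * K.qd (x - y) d
    + d * (∫ ξ in y..x, K.q (x - ξ) d * K.p (ξ - y) d)
    + d ^ 2 * ∫ ξ in y..x, K.qd (x - ξ) d * K.p (ξ - y) d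

noncomputable def M₄ (x y d : ℝ) : ℝ :=
  K.γd x y d + (∫ ξ in y..1, K.γd x ξ d * K.l ξ y)
    + (∫ ξ in (0 : ℝ)..x, K.q (x - ξ) d * K.η ξ y d)
    + d * ∫ ξ in (0 : ℝ)..x, K.qd (x - ξ) d * K.η ξ y d

/-- The numbers `B₁, …, B₄` bound `|M₁|, …, |M₄|` over all delay estimates in `[Dlo, Dhi]`.
Points at which a derivative of `γ` or `q` need not exist are left out. -/
structure Bounds (Dlo Dhi B₁ B₂ B₃ B₄ : ℝ) : Prop where
  b₁ : ∀ d ∈ Icc Dlo Dhi, ∀ x ∈ Icc (0 : ℝ) 1, |K.M₁ x d| ≤ B₁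
  b₂ : ∀ d ∈ Icc Dlo Dhi, ∀ x ∈ Ioo (0 : ℝ) 1, ∀ y ∈ Ioo (0 : ℝ) 1, y ≠ d * x →
    |K.M₂ x y d| ≤ B₂
  b₃ : ∀ d ∈ Icc Dlo Dhi, ∀ x ∈ Ioo (0 : ℝ) 1, ∀ y ∈ Ioo (0 : ℝ) x, d * (x - y) ≠ 1 →
    |K.M₃ x y d| ≤ B₃
  b₄ : ∀ d ∈ Icc Dlo Dhi, ∀ x ∈ Ioo (0 : ℝ) 1, ∀ y ∈ Ioo (0 : ℝ) 1, y ≠ d * x →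
    |K.M₄ x y d| ≤ B₄

/-- The function `P₁`. -/
noncomputable def P₁ (d : ℝ) (φ ψ : ℝ → ℝ) (x : ℝ) : ℝ :=
  K.z d φ ψ 0 * K.M₁ x d + ∫ y in (0 : ℝ)..1, K.w φ y * K.M₂ x y d

/-- The weighted energy `N` of the transformed state. -/
noncomputable def energy (b₁ d : ℝ) (φ ψ : ℝ → ℝ) : ℝ :=
  1 / 2 * (∫ x in (0 : ℝ)..1, (1 + x) * K.w φ x ^ 2)
    + b₁ / 2 * ∫ x in (0 : ℝ)..1, (1 + x) * K.z d φ ψ x ^ 2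

/-- The (normalized) update direction `τ`. -/
noncomputable def τ (b₁ d : ℝ) (φ ψ : ℝ → ℝ) : ℝ :=
  -b₁ * (∫ x in (0 : ℝ)..1, (1 + x) * K.z d φ ψ x * K.P₁ d φ ψ x)
    / (1 + K.energy b₁ d φ ψ)

end Kernels

open Classical in
/-- The projection operator, at the current estimate `d`. On `[Dlo, Dhi]` the conditions
`d ≤ Dlo` and `Dhi ≤ d` say `d = Dlo` and `d = Dhi`. -/
noncomputable def proj (Dlo Dhi d τ : ℝ) : ℝ :=
  if d ≤ Dlo ∧ τ < 0 then 0 else if Dhi ≤ d ∧ 0 < τ then 0 else τ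

/-- `(u, v, Dhat)` is a global solution of the closed loop with true delay `D`. The states are
continuous; `u_t - u_x` and `D v_t - v_x` are derivatives along the characteristics (they are the
usual expressions where `u`, `v` are differentiable), and the update law, whose right-hand side
jumps when the projection becomes active, is satisfied in integrated form. -/
structure IsClosedLoopSolution (f : ℝ → ℝ → ℝ) (g : ℝ → ℝ) (K : Kernels f g)
    (Dlo Dhi b₁ θ D : ℝ) (u v : ℝ → ℝ → ℝ) (Dhat : ℝ → ℝ) : Prop where
  u_cont : ContinuousOn (fun p : ℝ × ℝ => u p.1 p.2) (Icc 0 1 ×ˢ Ici 0)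
  v_cont : ContinuousOn (fun p : ℝ × ℝ => v p.1 p.2) (Icc 0 1 ×ˢ Ici 0)
  Dhat_cont : ContinuousOn Dhat (Ici 0)
  u_pde : ∀ x ∈ Ioo (0 : ℝ) 1, ∀ t > 0,
    HasDerivAt (fun h => u (x - h) (t + h))
      (g x * u 0 t + ∫ y in (0 : ℝ)..x, f x y * u y t) 0
  u_bc : ∀ t ≥ 0, u 1 t = v 0 t
  v_pde : ∀ x ∈ Ioo (0 : ℝ) 1, ∀ t > 0, HasDerivAt (fun h => v (x - h) (t + D * h)) 0 0
  v_bc : ∀ t ≥ 0, v 1 t = K.control (Dhat t) (fun y => u y t) (fun y => v y t)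
  Dhat_init : Dhat 0 ∈ Icc Dlo Dhi
  Dhat_int : ∀ t ≥ 0, IntervalIntegrable
    (fun s => proj Dlo Dhi (Dhat s) (K.τ b₁ (Dhat s) (fun y => u y s) (fun y => v y s)))
    volume 0 t
  Dhat_law : ∀ t ≥ 0, Dhat t = Dhat 0 + ∫ s in (0 : ℝ)..t,
    θ * proj Dlo Dhi (Dhat s) (K.τ b₁ (Dhat s) (fun y => u y s) (fun y => v y s))

/-- The quantity `Ψ(t)`. -/
noncomputable def Psi (D : ℝ) (u v : ℝ → ℝ → ℝ) (Dhat : ℝ → ℝ) (t : ℝ) : ℝ :=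
  (∫ x in (0 : ℝ)..1, u x t ^ 2) + (∫ x in (0 : ℝ)..1, v x t ^ 2) + (D - Dhat t) ^ 2

end DelayPIDE

/-!
The backstepping transformation `(u, v) ↦ (w, z)` turns the closed loop into the target system
`w_t = w_x`, `w(1, t) = z(0, t)`, `D z_t = z_x - (D - D̂) P₁ - D D̂' P₂`, `z(1, t) = 0`, in which
the delay mismatch and the adaptation appear as perturbations bounded by the state
(`IsClosedLoopSolution.isTargetSolution`). Stability of the target system comes from the Lyapunov
function `D log (1 + N) + (D - D̂)² / (2 θ)`. In its derivative the mismatch `D - D̂` is cancelled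
by the update law, the projection contributes a term of the right sign, and the remaining term,
caused by `D̂'`, is a product of two perturbations with the small factor `θ`; by the gain condition
it is dominated by the dissipation (`adaptation_error_le`,
`IsTargetSolution.exists_hasDerivWithinAt_lyapunov`).

Hence `N ≤ exp (V(0) / D) - 1` and `z(0, ·)²`, `‖w‖²`, `‖z‖²` are integrable in time. Since `z` is
an integral of `z(0, ·)` and `‖w‖` over the transit time `D`, and `w` is a delayed copy of
`z(0, ·)`, both tend to zero uniformly in space (`IsTargetSolution.eventually_abs_le`). The inverse
transformation carries the estimates back to `(u, v)`.

That `l` and `η` are the kernels of the inverse transformation is not part of the hypotheses. The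
defects of the two reciprocity relations are transported along characteristics and vanish at the
inflow boundary: for `k, l` the defect is constant along the flow (`Kernels.l_eq_k_add`), for
`γ, η` it solves a linear integro-differential equation with zero data
(`Kernels.γDefect_eq_zero`).

All equations are used along characteristics, `h ↦ (x - h, t + c h)`, with right derivatives in
`h`, because the solutions are only assumed to be differentiable in these directions; the tool for
differentiating integrals over `x` is `hasDerivWithinAt_integral_transport`. The right-hand side of
the update law is discontinuous, but `D̂` has the expected right derivative at every time
(`hasDerivWithinAt_of_projected_law`), so that no almost-everywhere calculus in `t` is needed.
-/

namespace DelayPIDE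

/-! ### Parameter integrals and one-sided derivatives -/

/-- Continuity of a parameter integral with variable end points; only continuity of the integrand
over the domain of integration is needed. -/
theorem continuousOn_paramIntegral {X : Type*} [TopologicalSpace X] {S : Set X}
    {F : X → ℝ → ℝ} {a b : X → ℝ} (ha : ContinuousOn a S) (hb : ContinuousOn b S)
    (hab : ∀ p ∈ S, a p ≤ b p)
    (hF : ContinuousOn (fun q : X × ℝ => F q.1 q.2) {q | q.1 ∈ S ∧ q.2 ∈ Icc (a q.1) (b q.1)}) :
    ContinuousOn (fun p => ∫ y in a p..b p, F p y) S := by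
  have key : ContinuousOn (fun p => (b p - a p) *
      ∫ r in (0 : ℝ)..1, F p (a p + (b p - a p) * max 0 (min 1 r))) S := by
    refine (hb.sub ha).mul ?_
    rw [continuousOn_iff_continuous_domRestrict]
    refine intervalIntegral.continuous_parametric_intervalIntegral_of_continuous'
      (f := fun (p : S) r => F p (a p + (b p - a p) * max 0 (min 1 r))) ?_ 0 1
    rw [continuousOn_iff_continuous_domRestrict] at ha hb
    have ha' : Continuous fun q : S × ℝ => a q.1 := ha.comp continuous_fst
    have hb' : Continuous fun q : S × ℝ => b q.1 := hb.comp continuous_fst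
    refine hF.comp_continuous (f := fun q : S × ℝ =>
      ((q.1 : X), a q.1 + (b q.1 - a q.1) * max 0 (min 1 q.2))) ?_ ?_
    · exact (continuous_subtype_val.comp continuous_fst).prodMk (ha'.add ((hb'.sub ha').mul
        (continuous_const.max (continuous_const.min continuous_snd))))
    · rintro ⟨p, r⟩
      have h1 := hab p p.2
      have h2 : 0 ≤ max 0 (min 1 r) := le_max_left _ _
      have h3 : max 0 (min 1 r) ≤ 1 := max_le zero_le_one (min_le_left _ _)
      refine ⟨p.2, ?_, ?_⟩ <;> dsimp only <;> nlinarith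
  refine key.congr fun p _ => ?_
  have h1 := intervalIntegral.smul_integral_comp_add_mul (F p) (b p - a p) (a p) (a := 0) (b := 1)
  simp only [mul_zero, add_zero, mul_one, add_sub_cancel, smul_eq_mul] at h1
  rw [← h1]
  congr 1
  refine intervalIntegral.integral_congr fun r hr => ?_
  rw [uIcc_of_le zero_le_one] at hr
  simp [hr.1, hr.2]

/-- Differentiation under the integral sign, for right derivatives. -/
theorem hasDerivWithinAt_integral {Φ : ℝ → ℝ → ℝ} {D : ℝ → ℝ} {a b C δ : ℝ} (hab : a ≤ b)
    (hδ : 0 < δ) (hint : ∀ h ∈ Icc 0 δ, IntervalIntegrable (Φ h) volume a b)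
    (hlip : ∀ h ∈ Ioc 0 δ, ∀ y ∈ Ioo a b, |Φ h y - Φ 0 y| ≤ C * h)
    (hder : ∀ᵐ y, y ∈ Ioo a b → HasDerivWithinAt (fun h => Φ h y) (D y) (Ici 0) 0) :
    IntervalIntegrable D volume a b ∧
      HasDerivWithinAt (fun h => ∫ y in a..b, Φ h y) (∫ y in a..b, D y) (Ici 0) 0 := by
  have hmem : ∀ᶠ h in 𝓝[>] (0 : ℝ), h ∈ Ioc 0 δ := Ioc_mem_nhdsGT hδ
  have hae : ∀ᵐ y, y ∈ uIoc a b → y ∈ Ioo a b := by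
    have : ∀ᵐ y : ℝ, y ≠ b := by simp [ae_iff, measure_singleton]
    filter_upwards [this] with y hy hy'
    rw [uIoc_of_le hab] at hy'
    exact ⟨hy'.1, lt_of_le_of_ne hy'.2 hy⟩
  have hmeas : ∀ᶠ h in 𝓝[>] (0 : ℝ),
      AEStronglyMeasurable (fun y => slope (fun h => Φ h y) 0 h) (volume.restrict (uIoc a b)) := by
    filter_upwards [hmem] with h hh
    simp only [slope_def_field, sub_zero]
    exact (intervalIntegrable_iff.1 (((hint h ⟨hh.1.le, hh.2⟩).sub
      (hint 0 ⟨le_rfl, hδ.le⟩)).div_const h)).aestronglyMeasurable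
  have hbound : ∀ᶠ h in 𝓝[>] (0 : ℝ), ∀ᵐ y, y ∈ uIoc a b →
      ‖slope (fun h => Φ h y) 0 h‖ ≤ C := by
    filter_upwards [hmem] with h hh
    filter_upwards [hae] with y hy hy'
    have := hlip h hh y (hy hy')
    rw [slope_def_field, sub_zero, Real.norm_eq_abs, abs_div, abs_of_pos hh.1, div_le_iff₀ hh.1]
    exact this
  have hlim : ∀ᵐ y, y ∈ uIoc a b →
      Tendsto (fun h => slope (fun h => Φ h y) 0 h) (𝓝[>] 0) (𝓝 (D y)) := by
    filter_upwards [hae, hder] with y hy hd hy'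
    exact (hasDerivWithinAt_iff_tendsto_slope' (by simp)).1
      ((hd (hy hy')).mono Ioi_subset_Ici_self)
  constructor
  · rw [intervalIntegrable_iff]
    have hD : AEStronglyMeasurable D (volume.restrict (uIoc a b)) := by
      obtain ⟨s, hs⟩ := exists_seq_tendsto (𝓝[>] (0 : ℝ))
      obtain ⟨n0, hn0⟩ := eventually_atTop.1 (hs.eventually hmeas)
      refine aestronglyMeasurable_of_tendsto_ae atTop
        (f := fun n y => slope (fun h => Φ h y) 0 (s (n + n0)))
        (fun n => hn0 _ (Nat.le_add_left _ _)) ?_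
      rw [ae_restrict_iff' measurableSet_uIoc]
      filter_upwards [hlim] with y hy hy'
      exact ((hy hy').comp hs).comp (tendsto_add_atTop_nat n0)
    have : IsFiniteMeasure (volume.restrict (uIoc a b)) := by
      rw [uIoc_of_le hab]; infer_instance
    refine Integrable.of_bound hD C ?_
    rw [ae_restrict_iff' measurableSet_uIoc]
    have hb' : ∀ᵐ y, ∀ h ∈ Ioc 0 δ, y ∈ uIoc a b → ‖slope (fun h => Φ h y) 0 h‖ ≤ C := by
      filter_upwards [hae] with y hy h hh hy'
      have := hlip h hh y (hy hy')
      rw [slope_def_field, sub_zero, Real.norm_eq_abs, abs_div, abs_of_pos hh.1, div_le_iff₀ hh.1]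
      exact this
    filter_upwards [hlim, hb'] with y hy hyb hy'
    refine le_of_tendsto (hy hy').norm ?_
    filter_upwards [hmem] with h hh
    exact hyb h hh hy'
  · refine HasDerivWithinAt.Ici_of_Ioi ?_
    rw [hasDerivWithinAt_iff_tendsto_slope' (by simp)]
    have := intervalIntegral.tendsto_integral_filter_of_dominated_convergence (fun _ => C)
      hmeas hbound intervalIntegrable_const hlim
    refine this.congr' ?_
    filter_upwards [hmem] with h hh
    simp only [slope_def_field]
    rw [intervalIntegral.integral_div, intervalIntegral.integral_sub (hint h ⟨hh.1.le, hh.2⟩)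
      (hint 0 ⟨le_rfl, hδ.le⟩)]

/-- Differentiation of an integral whose left end point moves to the right with speed `c`. -/
theorem hasDerivWithinAt_integral_moving_left {Φ : ℝ → ℝ → ℝ} {D : ℝ → ℝ} {a b c C δ : ℝ}
    (hab : a < b) (hc : 0 ≤ c) (hδ : 0 < δ) (hδb : a + c * δ ≤ b) (hC : 0 ≤ C)
    (h0 : ContinuousOn (Φ 0) (Icc a b))
    (hint : ∀ h ∈ Icc 0 δ, IntervalIntegrable (Φ h) volume (a + c * h) b)
    (hlip : ∀ h ∈ Ioc 0 δ, ∀ y ∈ Ioo (a + c * h) b, |Φ h y - Φ 0 y| ≤ C * h)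
    (hder : ∀ᵐ y, y ∈ Ioo a b → HasDerivWithinAt (fun h => Φ h y) (D y) (Ici 0) 0) :
    IntervalIntegrable D volume a b ∧
      HasDerivWithinAt (fun h => ∫ y in (a + c * h)..b, Φ h y)
        (-(c * Φ 0 a) + ∫ y in a..b, D y) (Ici 0) 0 := by
  classical
  set Ψ : ℝ → ℝ → ℝ := fun h y => if a + c * h < y then Φ h y else Φ 0 y with hΨ
  have hle : ∀ h ∈ Icc 0 δ, a ≤ a + c * h ∧ a + c * h ≤ b := fun h hh =>
    ⟨by nlinarith [mul_nonneg hc hh.1], by nlinarith [mul_le_mul_of_nonneg_left hh.2 hc]⟩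
  have hi0 : ∀ x ∈ Icc a b, ∀ y ∈ Icc a b, IntervalIntegrable (Φ 0) volume x y := fun x hx y hy =>
    (h0.mono (uIcc_subset_Icc hx hy)).intervalIntegrable
  have hΨ1 : ∀ h ∈ Icc 0 δ, EqOn (Φ h) (Ψ h) (uIoc (a + c * h) b) := fun h hh y hy => by
    rw [uIoc_of_le (hle h hh).2] at hy
    simp [hΨ, hy.1]
  have hΨ2 : ∀ h ∈ Icc 0 δ, EqOn (Φ 0) (Ψ h) (uIoc a (a + c * h)) := fun h hh y hy => by
    rw [uIoc_of_le (hle h hh).1] at hy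
    simp [hΨ, not_lt.2 hy.2]
  have hI1 : ∀ h ∈ Icc 0 δ, IntervalIntegrable (Ψ h) volume (a + c * h) b := fun h hh =>
    (hint h hh).congr (hΨ1 h hh)
  have hI2 : ∀ h ∈ Icc 0 δ, IntervalIntegrable (Ψ h) volume a (a + c * h) := fun h hh =>
    (hi0 a ⟨le_rfl, hab.le⟩ (a + c * h) (hle h hh)).congr (hΨ2 h hh)
  have hΨ0 : Ψ 0 = Φ 0 := by ext y; simp [hΨ]
  obtain ⟨hD, hder'⟩ := hasDerivWithinAt_integral (Φ := Ψ) (D := D) (C := C) hab.le hδ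
    (fun h hh => (hI2 h hh).trans (hI1 h hh))
    (fun h hh y hy => by
      rw [hΨ0]
      by_cases hy' : a + c * h < y
      · simpa [hΨ, hy'] using hlip h hh y ⟨hy', hy.2⟩
      · simpa [hΨ, hy'] using mul_nonneg hC hh.1.le)
    (by
      filter_upwards [hder] with y hy hy'
      refine (hy hy').congr_of_eventuallyEq ?_ (by simp [hΨ])
      have : Tendsto (fun h : ℝ => a + c * h) (𝓝[Ici 0] 0) (𝓝 (a + c * 0)) :=
        Continuous.tendsto' (by fun_prop) _ _ rfl |>.mono_left nhdsWithin_le_nhds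
      rw [mul_zero, add_zero] at this
      filter_upwards [this.eventually_lt_const hy'.1] with h hh
      simp [hΨ, hh])
  refine ⟨hD, ?_⟩
  have hfix : HasDerivWithinAt (fun h => ∫ y in a..(a + c * h), Φ 0 y) (c * Φ 0 a) (Ici 0) 0 := by
    have h1 : HasDerivWithinAt (fun u => ∫ y in a..u, Φ 0 y) (Φ 0 a) (Ici a) a := by
      have hca : ContinuousWithinAt (Φ 0) (Icc a b) a := h0 a ⟨le_rfl, hab.le⟩
      have hca' : ContinuousWithinAt (Φ 0) (Ici a) a := hca.mono_of_mem_nhdsWithin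
        (Icc_mem_nhdsGE hab)
      refine intervalIntegral.integral_hasDerivWithinAt_right (t := Ioi a) (by simp) ?_
        (hca'.mono Ioi_subset_Ici_self)
      exact ⟨Ioc a b, Ioc_mem_nhdsGT hab,
        (h0.mono Ioc_subset_Icc_self).aestronglyMeasurable measurableSet_Ioc⟩
    have h2 : HasDerivWithinAt (fun h : ℝ => a + c * h) c (Ici 0) 0 := by
      simpa using! ((hasDerivAt_id (0 : ℝ)).const_mul c).const_add a |>.hasDerivWithinAt
    have h3 := HasDerivWithinAt.scomp (t' := Ici a) (x := (0 : ℝ))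
      (g₁ := fun u => ∫ y in a..u, Φ 0 y) (by simpa using h1) h2
      (fun h hh => by
        have : 0 ≤ c * h := mul_nonneg hc hh
        simpa using this)
    simpa [Function.comp_def] using h3
  have := hder'.sub hfix
  rw [neg_add_eq_sub]
  refine this.congr_of_eventuallyEq ?_ ?_
  · filter_upwards [Icc_mem_nhdsGE hδ] with h hh
    simp only [Pi.sub_apply]
    rw [← intervalIntegral.integral_add_adjacent_intervals (hI2 h hh) (hI1 h hh),
      intervalIntegral.integral_congr_ae (f := Φ h) (g := Ψ h)
        (Eventually.of_forall fun y hy => hΨ1 h hh hy),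
      intervalIntegral.integral_congr_ae (f := Φ 0) (g := Ψ h) (a := a)
        (Eventually.of_forall fun y hy => hΨ2 h hh hy)]
    ring
  · simp [hΨ0]

/-- Derivative at `h = 0` of the integral over the shrinking interval `[b - c h, b]`. -/
theorem hasDerivWithinAt_integral_shrinking {Φ : ℝ → ℝ → ℝ} {a b c δ : ℝ} (hc : 0 ≤ c)
    (hδ : 0 < δ) (hδb : a + c * δ ≤ b)
    (hcont : ContinuousOn (fun q : ℝ × ℝ => Φ q.1 q.2) (Icc 0 δ ×ˢ Icc a b)) :
    HasDerivWithinAt (fun h => ∫ y in (b - c * h)..b, Φ h y) (c * Φ 0 b) (Ici 0) 0 := by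
  have hG : ContinuousOn (fun h => ∫ r in (0 : ℝ)..1, Φ h (b - c * h * r)) (Icc 0 δ) := by
    refine continuousOn_paramIntegral (F := fun h r => Φ h (b - c * h * r)) continuousOn_const
      continuousOn_const (fun _ _ => zero_le_one) ?_
    refine hcont.comp (f := fun q : ℝ × ℝ => (q.1, b - c * q.1 * q.2)) (by fun_prop) ?_
    rintro ⟨h, r⟩ ⟨hh, hr⟩
    dsimp only at hh hr ⊢
    have h1 : 0 ≤ c * h := mul_nonneg hc hh.1
    have h2 : c * h ≤ c * δ := mul_le_mul_of_nonneg_left hh.2 hc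
    refine ⟨hh, ?_, ?_⟩ <;> dsimp only <;> nlinarith [hr.1, hr.2]
  have hG0 : ContinuousWithinAt (fun h => ∫ r in (0 : ℝ)..1, Φ h (b - c * h * r)) (Ici 0) 0 :=
    (hG 0 ⟨le_rfl, hδ.le⟩).mono_of_mem_nhdsWithin (Icc_mem_nhdsGE hδ)
  refine HasDerivWithinAt.Ici_of_Ioi ?_
  rw [hasDerivWithinAt_iff_tendsto_slope' (by simp)]
  have h1 : Tendsto (fun h => c * ∫ r in (0 : ℝ)..1, Φ h (b - c * h * r)) (𝓝[>] 0)
      (𝓝 (c * Φ 0 b)) := by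
    have := (hG0.mono Ioi_subset_Ici_self).tendsto.const_mul c
    simpa using this
  refine h1.congr' ?_
  filter_upwards [self_mem_nhdsWithin] with h (hh : 0 < h)
  have h2 := intervalIntegral.smul_integral_comp_sub_mul (Φ h) (c * h) b (a := 0) (b := 1)
  simp only [mul_zero, mul_one, smul_eq_mul, sub_zero] at h2
  rw [slope_def_field]
  simp only [mul_zero, sub_zero, intervalIntegral.integral_same]
  rw [← h2]
  field_simp

/-- Transport formula: derivative of the integral over `[a, b]` of a density moving to the left
with speed `c`, in terms of its derivative `D` along the motion. -/
theorem hasDerivWithinAt_integral_transport {Φ : ℝ → ℝ → ℝ} {D : ℝ → ℝ} {a b c C δ : ℝ}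
    (hab : a < b) (hc : 0 ≤ c) (hδ : 0 < δ) (hδb : a + c * δ ≤ b) (hC : 0 ≤ C)
    (hcont : ContinuousOn (fun q : ℝ × ℝ => Φ q.1 q.2) (Icc 0 δ ×ˢ Icc a b))
    (hlip : ∀ h ∈ Ioc 0 δ, ∀ y ∈ Ioo (a + c * h) b, |Φ h (y - c * h) - Φ 0 y| ≤ C * h)
    (hder : ∀ᵐ y, y ∈ Ioo a b → HasDerivWithinAt (fun h => Φ h (y - c * h)) (D y) (Ici 0) 0) :
    IntervalIntegrable D volume a b ∧
      HasDerivWithinAt (fun h => ∫ y in a..b, Φ h y)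
        (c * (Φ 0 b - Φ 0 a) + ∫ y in a..b, D y) (Ici 0) 0 := by
  have hle : ∀ h ∈ Icc 0 δ, 0 ≤ c * h ∧ a + c * h ≤ b := fun h hh =>
    ⟨mul_nonneg hc hh.1, by nlinarith [mul_le_mul_of_nonneg_left hh.2 hc]⟩
  have hsec : ∀ h ∈ Icc 0 δ, ContinuousOn (Φ h) (Icc a b) := fun h hh =>
    hcont.comp (f := fun y => (h, y)) (by fun_prop) fun y hy => ⟨hh, hy⟩
  have hi : ∀ h ∈ Icc 0 δ, ∀ x ∈ Icc a b, ∀ y ∈ Icc a b, IntervalIntegrable (Φ h) volume x y :=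
    fun h hh x hx y hy => ((hsec h hh).mono (uIcc_subset_Icc hx hy)).intervalIntegrable
  obtain ⟨hD, h1⟩ := hasDerivWithinAt_integral_moving_left (Φ := fun h y => Φ h (y - c * h))
    (D := D) (C := C) hab hc hδ hδb hC (by simpa using hsec 0 ⟨le_rfl, hδ.le⟩)
    (fun h hh => by
      refine ContinuousOn.intervalIntegrable ?_
      rw [uIcc_of_le (hle h hh).2]
      refine (hsec h hh).comp (by fun_prop) fun y hy => ?_
      exact ⟨by linarith [hy.1], by linarith [hy.2, (hle h hh).1]⟩)
    (fun h hh y hy => by simpa using hlip h hh y hy) hder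
  have h2 := hasDerivWithinAt_integral_shrinking hc hδ hδb hcont
  refine ⟨hD, ?_⟩
  have h3 := h1.add h2
  simp only [mul_zero, sub_zero] at h3
  have e : -(c * Φ 0 a) + (∫ y in a..b, D y) + c * Φ 0 b
      = c * (Φ 0 b - Φ 0 a) + ∫ y in a..b, D y := by ring
  rw [e] at h3
  refine h3.congr_of_eventuallyEq ?_ (by simp)
  filter_upwards [Icc_mem_nhdsGE hδ] with h hh
  simp only [Pi.add_apply]
  rw [intervalIntegral.integral_comp_sub_right (Φ h) (c * h), add_sub_cancel_right,
    intervalIntegral.integral_add_adjacent_intervals]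
  · exact hi h hh _ ⟨le_rfl, hab.le⟩ _ ⟨by linarith [(hle h hh).2], by linarith [(hle h hh).1]⟩
  · exact hi h hh _ ⟨by linarith [(hle h hh).2], by linarith [(hle h hh).1]⟩ _ ⟨hab.le, le_rfl⟩

/-- Mean value inequality with a right derivative that is only known on the open interval. -/
theorem abs_sub_le_of_right_deriv {φ φ' B B' : ℝ → ℝ} {a b : ℝ} (hab : a ≤ b)
    (hφ : ContinuousOn φ (Icc a b))
    (hφ' : ∀ x ∈ Ioo a b, HasDerivWithinAt φ (φ' x) (Ici x) x)
    (hB : ContinuousOn B (Icc a b))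
    (hB' : ∀ x ∈ Ioo a b, HasDerivWithinAt B (B' x) (Ici x) x)
    (hle : ∀ x ∈ Ioo a b, |φ' x| ≤ B' x) : |φ b - φ a| ≤ B b - B a := by
  rcases hab.eq_or_lt with rfl | hab
  · simp
  have h1 : ∀ ε ∈ Ioo a b, |φ b - φ ε| ≤ B b - B ε := by
    intro ε hε
    have hs : Icc ε b ⊆ Icc a b := Icc_subset_Icc_left hε.1.le
    have ht : Ico ε b ⊆ Ioo a b := fun x hx => ⟨hε.1.trans_le hx.1, hx.2⟩
    refine image_norm_le_of_norm_deriv_right_le_deriv_boundary' (f := fun x => φ x - φ ε)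
      (f' := φ') (B := fun x => B x - B ε) (B' := B') ((hφ.mono hs).sub continuousOn_const)
      (fun x hx => (hφ' x (ht hx)).sub_const _) (by simp)
      ((hB.mono hs).sub continuousOn_const) (fun x hx => (hB' x (ht hx)).sub_const _)
      (fun x hx => hle x (ht hx)) ⟨hε.2.le, le_rfl⟩
  have hlim : ∀ f : ℝ → ℝ, ContinuousOn f (Icc a b) → Tendsto f (𝓝[>] a) (𝓝 (f a)) :=
    fun f hf => ((hf a ⟨le_rfl, hab.le⟩).mono_of_mem_nhdsWithin (Icc_mem_nhdsGT hab))
  refine le_of_tendsto_of_tendsto (((hlim φ hφ).const_sub (φ b)).abs)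
    ((hlim B hB).const_sub (B b)) ?_
  filter_upwards [Ioo_mem_nhdsGT hab] with ε hε using h1 ε hε

theorem abs_sub_le_mul_of_right_deriv {φ φ' : ℝ → ℝ} {a b C : ℝ} (hab : a ≤ b)
    (hφ : ContinuousOn φ (Icc a b))
    (hφ' : ∀ x ∈ Ioo a b, HasDerivWithinAt φ (φ' x) (Ici x) x)
    (hle : ∀ x ∈ Ioo a b, |φ' x| ≤ C) : |φ b - φ a| ≤ C * (b - a) := by
  have := abs_sub_le_of_right_deriv (B := fun x => C * x) (B' := fun _ => C) hab hφ hφ'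
    (by fun_prop) (fun x _ => by simpa using! ((hasDerivWithinAt_id x (Ici x)).const_mul C)) hle
  linarith

/-- A derivative on `(0, δ)` with a limit at `0` gives the right derivative at `0`. -/
theorem hasDerivWithinAt_Ici_of_interior {φ ψ : ℝ → ℝ} {δ : ℝ} (hδ : 0 < δ)
    (hφ : ContinuousOn φ (Icc 0 δ)) (hψ : ContinuousOn ψ (Icc 0 δ))
    (hd : ∀ h ∈ Ioo 0 δ, HasDerivAt φ (ψ h) h) : HasDerivWithinAt φ (ψ 0) (Ici 0) 0 := by
  refine hasDerivWithinAt_Ici_of_tendsto_deriv (s := Ioo 0 δ)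
    (fun h hh => (hd h hh).differentiableAt.differentiableWithinAt)
    ((hφ 0 ⟨le_rfl, hδ.le⟩).mono Ioo_subset_Icc_self) (Ioo_mem_nhdsGT hδ) ?_
  have : Tendsto ψ (𝓝[>] 0) (𝓝 (ψ 0)) :=
    (hψ 0 ⟨le_rfl, hδ.le⟩).mono_of_mem_nhdsWithin (Icc_mem_nhdsGT hδ)
  refine this.congr' ?_
  filter_upwards [Ioo_mem_nhdsGT hδ] with h hh using (hd h hh).deriv.symm

/-- Moving the base point of a one-sided derivative. -/
theorem hasDerivWithinAt_Ici_shift {φ : ℝ → ℝ} {c h : ℝ}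
    (hd : HasDerivWithinAt (fun s => φ (h + s)) c (Ici 0) 0) :
    HasDerivWithinAt φ c (Ici h) h := by
  have h2 : HasDerivWithinAt (fun s : ℝ => s - h) 1 (Ici h) h :=
    ((hasDerivAt_id h).sub_const h).hasDerivWithinAt
  have h3 := HasDerivWithinAt.scomp (t' := Ici 0) (x := h)
    (g₁ := fun s => φ (h + s)) (h := fun s => s - h) (by simpa using hd) h2
    (fun s hs => by simpa using hs)
  simpa [Function.comp_def] using h3

/-- A Volterra inequality without inhomogeneity has only the zero solution. -/
theorem eq_zero_of_abs_le_integral {φ : ℝ → ℝ} {a b B : ℝ} (hφ : ContinuousOn φ (Icc a b))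
    (h : ∀ x ∈ Icc a b, |φ x| ≤ B * ∫ y in a..x, |φ y|) : ∀ x ∈ Icc a b, φ x = 0 := by
  intro x hx
  have hab : a ≤ b := hx.1.trans hx.2
  have hint : ∀ y ∈ Icc a b, IntervalIntegrable (fun y => |φ y|) volume a y := fun y hy =>
    (hφ.abs.mono (uIcc_subset_Icc ⟨le_rfl, hab⟩ hy)).intervalIntegrable
  have hc : ContinuousOn (fun x => ∫ y in a..x, |φ y|) (Icc a b) := by
    have := intervalIntegral.continuousOn_primitive_interval (μ := volume)
      (f := fun y => |φ y|) (a := a) (b := b)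
      (by rw [uIcc_of_le hab]; exact hφ.abs.integrableOn_Icc)
    rwa [uIcc_of_le hab] at this
  have hd : ∀ y ∈ Ico a b, HasDerivWithinAt (fun x => ∫ y in a..x, |φ y|) |φ y| (Ici y) y := by
    intro y hy
    have hnear : Icc a b ∈ 𝓝[>] y :=
      mem_of_superset (Ioc_mem_nhdsGT hy.2) fun z hz => ⟨hy.1.trans hz.1.le, hz.2⟩
    refine intervalIntegral.integral_hasDerivWithinAt_right (t := Ioi y)
      (hint y ⟨hy.1, hy.2.le⟩) ?_ ?_
    · exact ⟨Icc a b, hnear, hφ.abs.aestronglyMeasurable measurableSet_Icc⟩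
    · exact (hφ.abs y ⟨hy.1, hy.2.le⟩).mono_of_mem_nhdsWithin hnear
  have hg := norm_le_gronwallBound_of_norm_deriv_right_le (δ := 0) (K := B) (ε := 0) hc hd
    (by simp) (fun y hy => by
      have h0 : 0 ≤ ∫ z in a..y, |φ z| :=
        intervalIntegral.integral_nonneg hy.1 fun _ _ => abs_nonneg _
      rw [Real.norm_eq_abs, abs_abs, Real.norm_eq_abs, abs_of_nonneg h0, add_zero]
      exact h y ⟨hy.1, hy.2.le⟩) x hx
  rw [gronwallBound_ε0_δ0] at hg
  have h0 : ∫ y in a..x, |φ y| = 0 := norm_le_zero_iff.1 hg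
  have := h x hx
  rw [h0, mul_zero] at this
  exact abs_nonpos_iff.1 this

/-- A product `m(s) G(s, r)` is integrable on the plane, `m` being integrable and `G` continuous
on a compact set outside of which the product is cut off. -/
theorem integrable_indicator_mul {m : ℝ → ℝ} {G : ℝ → ℝ → ℝ} {a b c d : ℝ} {T : Set (ℝ × ℝ)}
    (hT : IsCompact T) (hm : IntegrableOn m (Ioc a b))
    (hG : ContinuousOn (fun q : ℝ × ℝ => G q.1 q.2) T) :
    Integrable (T.indicator fun q : ℝ × ℝ => m q.1 * G q.1 q.2)
      ((volume.restrict (Ioc a b)).prod (volume.restrict (Ioc c d))) := by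
  obtain ⟨C, hC⟩ := hT.exists_bound_of_continuousOn hG
  have hm' : Integrable (fun q : ℝ × ℝ => m q.1)
      ((volume.restrict (Ioc a b)).prod (volume.restrict (Ioc c d))) := Integrable.comp_fst hm _
  have hG' : AEStronglyMeasurable (T.indicator fun q : ℝ × ℝ => G q.1 q.2)
      ((volume.restrict (Ioc a b)).prod (volume.restrict (Ioc c d))) :=
    (aestronglyMeasurable_indicator_iff hT.measurableSet).2
      (hG.aestronglyMeasurable hT.measurableSet)
  have := hm'.mul_bdd (c := max C 0) hG' (Eventually.of_forall fun q => by
    by_cases hq : q ∈ T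
    · simpa [hq] using Or.inl (hC q hq)
    · simp [hq])
  refine this.congr (Eventually.of_forall fun q => ?_)
  by_cases hq : q ∈ T <;> simp [hq]

/-- Fubini's theorem on the triangle `a ≤ r ≤ s ≤ b`. -/
theorem integral_triangle_swap {m : ℝ → ℝ} {G : ℝ → ℝ → ℝ} {a b : ℝ} (hab : a ≤ b)
    (hm : IntervalIntegrable m volume a b)
    (hG : ContinuousOn (fun q : ℝ × ℝ => G q.1 q.2) {q | a ≤ q.2 ∧ q.2 ≤ q.1 ∧ q.1 ≤ b}) :
    IntervalIntegrable (fun r => ∫ s in r..b, m s * G s r) volume a b ∧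
      ∫ s in a..b, m s * ∫ r in a..s, G s r = ∫ r in a..b, ∫ s in r..b, m s * G s r := by
  set T : Set (ℝ × ℝ) := {q | a ≤ q.2 ∧ q.2 ≤ q.1 ∧ q.1 ≤ b} with hTdef
  have hT : IsCompact T := by
    refine (isCompact_Icc (a := (a, a)) (b := (b, b))).of_isClosed_subset ?_ ?_
    · exact (isClosed_le continuous_const continuous_snd).inter
        ((isClosed_le continuous_snd continuous_fst).inter
          (isClosed_le continuous_fst continuous_const))
    · rintro ⟨s, r⟩ ⟨h1, h2, h3⟩
      exact ⟨⟨h1.trans h2, h1⟩, ⟨h3, h2.trans h3⟩⟩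
  rw [intervalIntegrable_iff_integrableOn_Ioc_of_le hab] at hm ⊢
  have hI := integrable_indicator_mul (c := a) (d := b) hT hm hG
  have e1 : ∀ s ∈ Ioc a b, (∫ r in Ioc a b, T.indicator (fun q : ℝ × ℝ => m q.1 * G q.1 q.2) (s, r))
      = m s * ∫ r in a..s, G s r := by
    intro s hs
    rw [intervalIntegral.integral_of_le hs.1.le, ← integral_const_mul,
      ← Set.inter_eq_self_of_subset_right (Ioc_subset_Ioc_right hs.2 : Ioc a s ⊆ Ioc a b),
      ← setIntegral_indicator measurableSet_Ioc]
    refine setIntegral_congr_fun measurableSet_Ioc fun r hr => ?_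
    by_cases hrs : r ≤ s
    · have h1 : (s, r) ∈ T := ⟨hr.1.le, hrs, hs.2⟩
      have h2 : r ∈ Ioc a s := ⟨hr.1, hrs⟩
      simp [h1, h2]
    · have h1 : (s, r) ∉ T := fun h => hrs h.2.1
      have h2 : r ∉ Ioc a s := fun h => hrs h.2
      simp [h1, h2]
  have e2 : ∀ r ∈ Ioc a b, (∫ s in Ioc a b, T.indicator (fun q : ℝ × ℝ => m q.1 * G q.1 q.2) (s, r))
      = ∫ s in r..b, m s * G s r := by
    intro r hr
    have hsub : Icc r b ⊆ Ioc a b := fun s hs => ⟨hr.1.trans_le hs.1, hs.2⟩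
    rw [intervalIntegral.integral_of_le hr.2, ← integral_Icc_eq_integral_Ioc (x := r),
      ← Set.inter_eq_self_of_subset_right hsub,
      ← setIntegral_indicator measurableSet_Icc]
    refine setIntegral_congr_fun measurableSet_Ioc fun s hs => ?_
    by_cases hrs : r ≤ s
    · have h1 : (s, r) ∈ T := ⟨hr.1.le, hrs, hs.2⟩
      have h2 : s ∈ Icc r b := ⟨hrs, hs.2⟩
      simp [h1, h2]
    · have h1 : (s, r) ∉ T := fun h => hrs h.2.1
      have h2 : s ∉ Icc r b := fun h => hrs h.1
      simp [h1, h2]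
  constructor
  · have := hI.integral_prod_right
    refine Integrable.congr this ?_
    filter_upwards [ae_restrict_mem measurableSet_Ioc] with r hr using e2 r hr
  · rw [intervalIntegral.integral_of_le hab, intervalIntegral.integral_of_le hab,
      ← setIntegral_congr_fun measurableSet_Ioc e1, ← setIntegral_congr_fun measurableSet_Ioc e2]
    exact integral_integral_swap hI

/-- Fubini's theorem on a rectangle. -/
theorem integral_rectangle_swap {m : ℝ → ℝ} {G : ℝ → ℝ → ℝ} {a b c d : ℝ} (hab : a ≤ b)
    (hcd : c ≤ d) (hm : IntervalIntegrable m volume a b)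
    (hG : ContinuousOn (fun q : ℝ × ℝ => G q.1 q.2) (Icc a b ×ˢ Icc c d)) :
    IntervalIntegrable (fun r => ∫ s in a..b, m s * G s r) volume c d ∧
      ∫ s in a..b, m s * ∫ r in c..d, G s r = ∫ r in c..d, ∫ s in a..b, m s * G s r := by
  rw [intervalIntegrable_iff_integrableOn_Ioc_of_le hab] at hm
  rw [intervalIntegrable_iff_integrableOn_Ioc_of_le hcd]
  have hI := integrable_indicator_mul (c := c) (d := d) (isCompact_Icc.prod isCompact_Icc) hm hG
  have hmem : ∀ s ∈ Ioc a b, ∀ r ∈ Ioc c d, (s, r) ∈ Icc a b ×ˢ Icc c d := fun s hs r hr =>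
    ⟨Ioc_subset_Icc_self hs, Ioc_subset_Icc_self hr⟩
  have e1 : ∀ s ∈ Ioc a b, (∫ r in Ioc c d,
      (Icc a b ×ˢ Icc c d).indicator (fun q : ℝ × ℝ => m q.1 * G q.1 q.2) (s, r))
      = m s * ∫ r in c..d, G s r := by
    intro s hs
    rw [intervalIntegral.integral_of_le hcd, ← integral_const_mul]
    refine setIntegral_congr_fun measurableSet_Ioc fun r hr => ?_
    simp only [indicator_of_mem (hmem s hs r hr)]
  have e2 : ∀ r ∈ Ioc c d, (∫ s in Ioc a b,
      (Icc a b ×ˢ Icc c d).indicator (fun q : ℝ × ℝ => m q.1 * G q.1 q.2) (s, r))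
      = ∫ s in a..b, m s * G s r := by
    intro r hr
    rw [intervalIntegral.integral_of_le hab]
    refine setIntegral_congr_fun measurableSet_Ioc fun s hs => ?_
    simp only [indicator_of_mem (hmem s hs r hr)]
  constructor
  · refine Integrable.congr hI.integral_prod_right ?_
    filter_upwards [ae_restrict_mem measurableSet_Ioc] with r hr using e2 r hr
  · rw [intervalIntegral.integral_of_le hab, intervalIntegral.integral_of_le hcd,
      ← setIntegral_congr_fun measurableSet_Ioc e1, ← setIntegral_congr_fun measurableSet_Ioc e2]
    exact integral_integral_swap hI

/-! ### Transport of the kernels on the triangle -/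

theorem hasDerivWithinAt_comp_pair {Γ : ℝ → ℝ → ℝ} {X Y : ℝ → ℝ} {α β t : ℝ} {s : Set ℝ}
    (hΓ : DifferentiableAt ℝ (fun p : ℝ × ℝ => Γ p.1 p.2) (X t, Y t))
    (hX : HasDerivWithinAt X α s t) (hY : HasDerivWithinAt Y β s t) :
    HasDerivWithinAt (fun h => Γ (X h) (Y h))
      (α * deriv (fun r => Γ r (Y t)) (X t) + β * deriv (fun r => Γ (X t) r) (Y t)) s t := by
  set A := fderiv ℝ (fun p : ℝ × ℝ => Γ p.1 p.2) (X t, Y t) with hA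
  have hΓ' := hΓ.hasFDerivAt
  have h1 : deriv (fun r => Γ r (Y t)) (X t) = A (1, 0) := by
    have : HasDerivAt (fun r : ℝ => (r, Y t)) ((1 : ℝ), (0 : ℝ)) (X t) :=
      (hasDerivAt_id _).prodMk (hasDerivAt_const _ _)
    exact (hΓ'.comp_hasDerivAt (X t) this).deriv
  have h2 : deriv (fun r => Γ (X t) r) (Y t) = A (0, 1) := by
    have : HasDerivAt (fun r : ℝ => (X t, r)) ((0 : ℝ), (1 : ℝ)) (Y t) :=
      (hasDerivAt_const _ _).prodMk (hasDerivAt_id _)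
    exact (hΓ'.comp_hasDerivAt (Y t) this).deriv
  have h3 := hΓ'.comp_hasDerivWithinAt t (hX.prodMk hY)
  have e : ((α, β) : ℝ × ℝ) = α • (1, 0) + β • (0, 1) := by simp
  rw [← hA, e, map_add, map_smul, map_smul, ← h1, ← h2] at h3
  exact h3

theorem _root_.ContinuousOn.comp_triangle {κ : ℝ → ℝ → ℝ}
    (hκ : ContinuousOn (fun p : ℝ × ℝ => κ p.1 p.2) triangle) {X : Type*} [TopologicalSpace X]
    {S : Set X} {a b : X → ℝ} (ha : ContinuousOn a S) (hb : ContinuousOn b S)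
    (hab : ∀ p ∈ S, 0 ≤ b p ∧ b p ≤ a p ∧ a p ≤ 1) :
    ContinuousOn (fun p => κ (a p) (b p)) S :=
  hκ.comp (ha.prodMk hb) hab

theorem isCompact_triangle : IsCompact triangle := by
  refine (isCompact_Icc (a := ((0 : ℝ), (0 : ℝ))) (b := (1, 1))).of_isClosed_subset ?_ ?_
  · exact (isClosed_le continuous_const continuous_snd).inter
      ((isClosed_le continuous_snd continuous_fst).inter
        (isClosed_le continuous_fst continuous_const))
  · rintro ⟨s, r⟩ ⟨h1, h2, h3⟩
    exact ⟨⟨h1.trans h2, h1⟩, ⟨h3, h2.trans h3⟩⟩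

theorem exists_bound_of_isCompact {X : Type*} [TopologicalSpace X] {S : Set X} (hS : IsCompact S)
    {F : X → ℝ} (hF : ContinuousOn F S) : ∃ C, 0 ≤ C ∧ ∀ p ∈ S, |F p| ≤ C := by
  obtain ⟨C, hC⟩ := hS.exists_bound_of_continuousOn hF
  exact ⟨max C 0, le_max_right _ _, fun p hp => (hC p hp).trans (le_max_left _ _)⟩

/-- A kernel on the triangle with `κ_x + κ_y = F`, followed along `h ↦ (x - h, y - h)`. -/
theorem triangle_transport {κ F : ℝ → ℝ → ℝ}
    (hκ : ContinuousOn (fun p : ℝ × ℝ => κ p.1 p.2) triangle)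
    (hF : ContinuousOn (fun p : ℝ × ℝ => F p.1 p.2) triangle)
    (hdiff : ∀ x y, 0 < y → y < x → x < 1 →
      DifferentiableAt ℝ (fun p : ℝ × ℝ => κ p.1 p.2) (x, y))
    (hpde : ∀ x y, 0 < y → y < x → x < 1 →
      deriv (fun s => κ s y) x + deriv (fun s => κ x s) y = F x y) :
    (∀ x y, 0 < y → y < x → x ≤ 1 →
      HasDerivWithinAt (fun h => κ (x - h) (y - h)) (-F x y) (Ici 0) 0) ∧
    ∃ C, 0 ≤ C ∧ ∀ x y h, 0 ≤ h → h ≤ y → y < x → x ≤ 1 →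
      |κ (x - h) (y - h) - κ x y| ≤ C * h := by
  have hd : ∀ x y h, 0 < h → h < y → y < x → x ≤ 1 →
      HasDerivAt (fun h => κ (x - h) (y - h)) (-F (x - h) (y - h)) h := by
    intro x y h h0 hy hyx hx
    have hX : ∀ a : ℝ, HasDerivWithinAt (fun h : ℝ => a - h) (-1) univ h := fun a =>
      ((hasDerivAt_id h).const_sub a).hasDerivWithinAt
    have := hasDerivWithinAt_comp_pair (Γ := κ) (X := fun h => x - h) (Y := fun h => y - h)
      (hdiff (x - h) (y - h) (by linarith) (by linarith) (by linarith)) (hX x) (hX y)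
    rw [hasDerivWithinAt_univ] at this
    refine this.congr_deriv ?_
    rw [← hpde (x - h) (y - h) (by linarith) (by linarith) (by linarith)]
    ring
  have hc : ∀ {G : ℝ → ℝ → ℝ}, ContinuousOn (fun p : ℝ × ℝ => G p.1 p.2) triangle →
      ∀ x y, y < x → x ≤ 1 → ∀ h ≤ y, ContinuousOn (fun h => G (x - h) (y - h)) (Icc 0 h) :=
    fun hG x y hyx hx h hy => hG.comp_triangle (by fun_prop) (by fun_prop) fun r hr =>
      ⟨by linarith [hr.2], by linarith, by linarith [hr.1]⟩
  refine ⟨fun x y hy hyx hx => ?_, ?_⟩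
  · have := hasDerivWithinAt_Ici_of_interior (ψ := fun h => -F (x - h) (y - h)) hy
      (hc hκ x y hyx hx y le_rfl) (hc hF x y hyx hx y le_rfl).neg
      (fun h hh => hd x y h hh.1 hh.2 hyx hx)
    simpa using this
  · obtain ⟨C, hC0, hC⟩ := exists_bound_of_isCompact isCompact_triangle hF
    refine ⟨C, hC0, fun x y h h0 hy hyx hx => ?_⟩
    have := abs_sub_le_mul_of_right_deriv (C := C) h0 (hc hκ x y hyx hx h hy)
      (fun r hr => (hd x y r hr.1 (hr.2.trans_le hy) hyx hx).hasDerivWithinAt)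
      (fun r hr => by
        rw [abs_neg]
        exact hC (x - r, y - r) ⟨by dsimp only; linarith [hr.2], by dsimp only; linarith,
          by dsimp only; linarith [hr.1]⟩)
    simpa using this

namespace Kernels

variable {f : ℝ → ℝ → ℝ} {g : ℝ → ℝ} (K : Kernels f g)

/-- The derivative `k_x + k_y` of `k` along its characteristics. -/
noncomputable def kRate (x y : ℝ) : ℝ := (∫ s in y..x, f s y * K.k x s) - f x y

/-- The derivative `l_x + l_y` of `l` along its characteristics. -/
noncomputable def lRate (x y : ℝ) : ℝ := -(∫ s in y..x, f x s * K.l s y) - f x y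

theorem continuousOn_kRate (hf : ContinuousOn (fun p : ℝ × ℝ => f p.1 p.2) triangle) :
    ContinuousOn (fun p : ℝ × ℝ => K.kRate p.1 p.2) triangle := by
  refine (continuousOn_paramIntegral (F := fun (p : ℝ × ℝ) s => f s p.2 * K.k p.1 s)
    continuousOn_snd continuousOn_fst (fun p hp => hp.2.1) ?_).sub hf
  refine (hf.comp_triangle (by fun_prop) (by fun_prop) ?_).mul
    (K.k_cont.comp_triangle (by fun_prop) (by fun_prop) ?_)
  all_goals
    rintro ⟨⟨x, y⟩, s⟩ ⟨⟨h1, h2, h3⟩, h4, h5⟩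
    dsimp only at *
    exact ⟨by linarith, by linarith, by linarith⟩

theorem continuousOn_lRate (hf : ContinuousOn (fun p : ℝ × ℝ => f p.1 p.2) triangle) :
    ContinuousOn (fun p : ℝ × ℝ => K.lRate p.1 p.2) triangle := by
  refine (continuousOn_paramIntegral (F := fun (p : ℝ × ℝ) s => f p.1 s * K.l s p.2)
    continuousOn_snd continuousOn_fst (fun p hp => hp.2.1) ?_).neg.sub hf
  refine (hf.comp_triangle (by fun_prop) (by fun_prop) ?_).mul
    (K.l_cont.comp_triangle (by fun_prop) (by fun_prop) ?_)
  all_goals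
    rintro ⟨⟨x, y⟩, s⟩ ⟨⟨h1, h2, h3⟩, h4, h5⟩
    dsimp only at *
    exact ⟨by linarith, by linarith, by linarith⟩

theorem k_transport (hf : ContinuousOn (fun p : ℝ × ℝ => f p.1 p.2) triangle) :
    (∀ x y, 0 < y → y < x → x ≤ 1 →
      HasDerivWithinAt (fun h => K.k (x - h) (y - h)) (-K.kRate x y) (Ici 0) 0) ∧
    ∃ C, 0 ≤ C ∧ ∀ x y h, 0 ≤ h → h ≤ y → y < x → x ≤ 1 →
      |K.k (x - h) (y - h) - K.k x y| ≤ C * h :=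
  triangle_transport K.k_cont (K.continuousOn_kRate hf) K.k_diff fun x y h1 h2 h3 => by
    rw [K.k_pde x y h1 h2 h3, kRate]; ring

theorem l_transport (hf : ContinuousOn (fun p : ℝ × ℝ => f p.1 p.2) triangle) :
    (∀ x y, 0 < y → y < x → x ≤ 1 →
      HasDerivWithinAt (fun h => K.l (x - h) (y - h)) (-K.lRate x y) (Ici 0) 0) ∧
    ∃ C, 0 ≤ C ∧ ∀ x y h, 0 ≤ h → h ≤ y → y < x → x ≤ 1 →
      |K.l (x - h) (y - h) - K.l x y| ≤ C * h :=
  triangle_transport K.l_cont (K.continuousOn_lRate hf) K.l_diff fun x y h1 h2 h3 => by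
    rw [K.l_pde x y h1 h2 h3, lRate]

/-! ### The kernels `k` and `l` are resolvents of each other -/

theorem continuousOn_resolvent_defect : ContinuousOn (fun p : ℝ × ℝ =>
    K.l p.1 p.2 - K.k p.1 p.2 - ∫ s in p.2..p.1, K.k p.1 s * K.l s p.2) triangle := by
  refine (K.l_cont.sub K.k_cont).sub (continuousOn_paramIntegral
    (F := fun (p : ℝ × ℝ) s => K.k p.1 s * K.l s p.2)
    continuousOn_snd continuousOn_fst (fun p hp => hp.2.1) ?_)
  refine (K.k_cont.comp_triangle (by fun_prop) (by fun_prop) ?_).mul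
    (K.l_cont.comp_triangle (by fun_prop) (by fun_prop) ?_)
  all_goals
    rintro ⟨⟨x, y⟩, s⟩ ⟨⟨h1, h2, h3⟩, h4, h5⟩
    dsimp only at *
    exact ⟨by linarith, by linarith, by linarith⟩

/-- The defect of the resolvent equation does not change along `h ↦ (x - h, y - h)`. -/
theorem hasDerivWithinAt_resolvent_defect
    (hf : ContinuousOn (fun p : ℝ × ℝ => f p.1 p.2) triangle) {x y : ℝ} (hy : 0 < y)
    (hyx : y < x) (hx : x ≤ 1) :
    HasDerivWithinAt (fun h => K.l (x - h) (y - h) - K.k (x - h) (y - h)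
      - ∫ s in (y - h)..(x - h), K.k (x - h) s * K.l s (y - h)) 0 (Ici 0) 0 := by
  obtain ⟨hkd, Ck, hCk, hkl⟩ := K.k_transport hf
  obtain ⟨hld, Cl, hCl, hll⟩ := K.l_transport hf
  obtain ⟨Bk, hBk, hk⟩ := exists_bound_of_isCompact isCompact_triangle K.k_cont
  obtain ⟨Bl, hBl, hl⟩ := exists_bound_of_isCompact isCompact_triangle K.l_cont
  have hcont : ∀ h ∈ Icc 0 y, IntervalIntegrable
      (fun s => K.k (x - h) (s - h) * K.l (s - h) (y - h)) volume y x := by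
    intro h hh
    refine ContinuousOn.intervalIntegrable ?_
    rw [uIcc_of_le hyx.le]
    refine (K.k_cont.comp_triangle (by fun_prop) (by fun_prop) ?_).mul
      (K.l_cont.comp_triangle (by fun_prop) (by fun_prop) ?_)
    all_goals
      rintro s ⟨h1, h2⟩
      exact ⟨by linarith [hh.2], by linarith, by linarith [hh.1]⟩
  have hmain := hasDerivWithinAt_integral
    (Φ := fun h s => K.k (x - h) (s - h) * K.l (s - h) (y - h))
    (D := fun s => -(K.kRate x s) * K.l s y + K.k x s * -(K.lRate s y))
    (C := Ck * Bl + Bk * Cl) hyx.le hy hcont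
    (fun h hh s hs => by
      have e1 := hkl x s h hh.1.le (hh.2.trans hs.1.le) hs.2 hx
      have e2 := hll s y h hh.1.le hh.2 hs.1 (hs.2.le.trans hx)
      have e3 := hl (s - h, y - h) ⟨by dsimp only; linarith [hh.2], by dsimp only; linarith [hs.1],
        by dsimp only; linarith [hh.1, hs.2]⟩
      have e4 := hk (x, s) ⟨by dsimp only; linarith [hs.1], by dsimp only; linarith [hs.2], hx⟩
      dsimp only at e3 e4 ⊢
      simp only [sub_zero]
      calc |K.k (x - h) (s - h) * K.l (s - h) (y - h) - K.k x s * K.l s y|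
          = |(K.k (x - h) (s - h) - K.k x s) * K.l (s - h) (y - h)
            + K.k x s * (K.l (s - h) (y - h) - K.l s y)| := by ring_nf
        _ ≤ |K.k (x - h) (s - h) - K.k x s| * |K.l (s - h) (y - h)|
            + |K.k x s| * |K.l (s - h) (y - h) - K.l s y| := by
            rw [← abs_mul, ← abs_mul]; exact abs_add_le _ _
        _ ≤ (Ck * h) * Bl + Bk * (Cl * h) := by
            have := hh.1.le
            gcongr
        _ = (Ck * Bl + Bk * Cl) * h := by ring)
    (Eventually.of_forall fun s hs => by
      have e1 := hkd x s (hy.trans hs.1) hs.2 hx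
      have e2 := hld s y hy hs.1 (hs.2.le.trans hx)
      simpa using! e1.fun_mul e2)
  have hD : (∫ s in y..x, (-(K.kRate x s) * K.l s y + K.k x s * -(K.lRate s y)))
      = -K.lRate x y - -K.kRate x y := by
    have c1 : ContinuousOn (fun s => K.k x s) (Icc y x) :=
      K.k_cont.comp_triangle (by fun_prop) (by fun_prop)
        fun s hs => ⟨by linarith [hs.1], hs.2, hx⟩
    have c2 : ContinuousOn (fun s => K.l s y) (Icc y x) :=
      K.l_cont.comp_triangle (by fun_prop) (by fun_prop)
        fun s hs => ⟨by linarith, hs.1, by linarith [hs.2]⟩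
    have c3 : ContinuousOn (fun s => f x s) (Icc y x) :=
      hf.comp_triangle (by fun_prop) (by fun_prop)
        fun s hs => ⟨by linarith [hs.1], hs.2, hx⟩
    have c4 : ContinuousOn (fun s => f s y) (Icc y x) :=
      hf.comp_triangle (by fun_prop) (by fun_prop)
        fun s hs => ⟨by linarith, hs.1, by linarith [hs.2]⟩
    have c5 : ContinuousOn (fun s => K.kRate x s) (Icc y x) :=
      (K.continuousOn_kRate hf).comp_triangle (by fun_prop) (by fun_prop)
        fun s hs => ⟨by linarith [hs.1], hs.2, hx⟩
    have c6 : ContinuousOn (fun s => K.lRate s y) (Icc y x) :=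
      (K.continuousOn_lRate hf).comp_triangle (by fun_prop) (by fun_prop)
        fun s hs => ⟨by linarith, hs.1, by linarith [hs.2]⟩
    have hI : ∀ {φ : ℝ → ℝ}, ContinuousOn φ (Icc y x) → IntervalIntegrable φ volume y x :=
      fun h => by
        refine ContinuousOn.intervalIntegrable ?_
        rwa [uIcc_of_le hyx.le]
    obtain ⟨hsi, hsw⟩ := integral_triangle_swap (m := fun r => K.k x r)
      (G := fun r s => f r s * K.l s y) hyx.le (hI c1) (by
        refine (hf.comp_triangle (by fun_prop) (by fun_prop) ?_).mul
          (K.l_cont.comp_triangle (by fun_prop) (by fun_prop) ?_)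
        all_goals
          rintro ⟨r, s⟩ ⟨h1, h2, h3⟩
          dsimp only at *
          exact ⟨by linarith, by linarith, by linarith⟩)
    have e1 : ∀ s, -(K.kRate x s) * K.l s y + K.k x s * -(K.lRate s y)
        = (K.k x s * ∫ r in y..s, f s r * K.l r y)
          - (∫ r in s..x, K.k x r * (f r s * K.l s y))
          + (f x s * K.l s y + f s y * K.k x s) := by
      intro s
      have e : ∫ r in s..x, K.k x r * (f r s * K.l s y)
          = (∫ r in s..x, f r s * K.k x r) * K.l s y := by
        rw [← intervalIntegral.integral_mul_const]
        congr 1; ext r; ring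
      rw [e, kRate, lRate]; ring
    have i1 : IntervalIntegrable (fun s => K.k x s * ∫ r in y..s, f s r * K.l r y)
        volume y x := by
      refine hI (c1.mul ?_)
      refine continuousOn_paramIntegral (F := fun s r => f s r * K.l r y) continuousOn_const
        continuousOn_id (fun s hs => hs.1) ?_
      refine (hf.comp_triangle (by fun_prop) (by fun_prop) ?_).mul
        (K.l_cont.comp_triangle (by fun_prop) (by fun_prop) ?_)
      all_goals
        rintro ⟨r, s⟩ ⟨⟨h1, h2⟩, h3, h4⟩
        dsimp only [id] at *
        exact ⟨by linarith, by linarith, by linarith⟩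
    simp_rw [e1]
    rw [intervalIntegral.integral_add (i1.sub hsi) ((hI (c3.fun_mul c2)).add (hI (c4.fun_mul c1))),
      intervalIntegral.integral_sub i1 hsi, hsw, sub_self, zero_add,
      intervalIntegral.integral_add (hI (c3.fun_mul c2)) (hI (c4.fun_mul c1)), kRate, lRate]
    ring
  have h1 := ((hld x y hy hyx hx).sub (hkd x y hy hyx hx)).sub hmain.2
  rw [hD, sub_self] at h1
  refine h1.congr_of_eventuallyEq ?_ ?_
  · filter_upwards with h
    simp only [Pi.sub_apply]
    rw [← intervalIntegral.integral_comp_sub_right (fun s => K.k (x - h) s * K.l s (y - h)) h]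
  · simp

/-- The resolvent equation for `k` and `l`: the defect is constant along characteristics and
vanishes at `y = 0`, because of the boundary conditions for `k` and `l`. -/
theorem l_eq_k_add (hf : ContinuousOn (fun p : ℝ × ℝ => f p.1 p.2) triangle) {x y : ℝ}
    (hy : 0 ≤ y) (hyx : y ≤ x) (hx : x ≤ 1) :
    K.l x y = K.k x y + ∫ s in y..x, K.k x s * K.l s y := by
  set e : ℝ → ℝ → ℝ := fun x y =>
    K.l x y - K.k x y - ∫ s in y..x, K.k x s * K.l s y with he
  have hec : ContinuousOn (fun p : ℝ × ℝ => e p.1 p.2) triangle := K.continuousOn_resolvent_defect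
  have hg0 : K.l 0 0 = -g 0 := K.l_bc 0 ⟨le_rfl, zero_le_one⟩
  have he0 : ∀ x ∈ Icc (0 : ℝ) 1, e x 0 = 0 := by
    intro x hx
    have : ∫ s in (0 : ℝ)..x, K.k x s * K.l s 0 = -∫ s in (0 : ℝ)..x, K.k x s * g s := by
      rw [← intervalIntegral.integral_neg]
      refine intervalIntegral.integral_congr fun s hs => ?_
      rw [uIcc_of_le hx.1] at hs
      simp [K.l_bc s ⟨hs.1, hs.2.trans hx.2⟩]
    simp only [he]
    rw [this, K.l_bc x hx, K.k_bc x hx]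
    ring
  have he1 : ∀ x y, 0 < y → y < x → x ≤ 1 → e x y = 0 := by
    intro x y hy hyx hx
    have := constant_of_has_deriv_right_zero (f := fun h => e (x - h) (y - h)) (a := 0) (b := y)
      (hec.comp_triangle (by fun_prop) (by fun_prop) fun h hh =>
        ⟨by linarith [hh.2], by linarith, by linarith [hh.1]⟩)
      (fun h hh => by
        refine hasDerivWithinAt_Ici_shift (φ := fun h => e (x - h) (y - h)) ?_
        have := K.hasDerivWithinAt_resolvent_defect hf (x := x - h) (y := y - h)
          (by linarith [hh.2]) (by linarith) (by linarith [hh.1])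
        simp only [he, ← sub_sub _ h]
        exact this) y ⟨hy.le, le_rfl⟩
    simp only [sub_self, sub_zero] at this
    rw [← this]
    exact he0 _ ⟨by linarith, by linarith⟩
  have he2 : e x y = 0 := by
    rcases hy.eq_or_lt with rfl | hy
    · exact he0 x ⟨hyx, hx⟩
    rcases hyx.eq_or_lt with rfl | hyx
    · -- the diagonal is reached from `y < x` by continuity
      have hc : ContinuousOn (fun s => e y s) (Icc 0 y) :=
        hec.comp_triangle (by fun_prop) (by fun_prop) fun s hs => ⟨hs.1, hs.2, hx⟩
      have ht : Tendsto (fun s => e y s) (𝓝[<] y) (𝓝 (e y y)) :=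
        (hc y ⟨hy.le, le_rfl⟩).mono_of_mem_nhdsWithin (Icc_mem_nhdsLT hy)
      refine tendsto_nhds_unique ht (tendsto_const_nhds.congr' ?_)
      filter_upwards [Ioo_mem_nhdsLT hy] with s hs using (he1 y s hs.1 hs.2 hx).symm
    · exact he1 x y hy hyx hx
  simp only [he] at he2
  linarith

/-- The Volterra operator with kernel `l` inverts the one with kernel `k`, on every interval
`[a, 1]`. -/
theorem volterra_inverse (hf : ContinuousOn (fun p : ℝ × ℝ => f p.1 p.2) triangle) {a : ℝ}
    (ha : 0 ≤ a) {φ ω : ℝ → ℝ} (hφ : ContinuousOn φ (Icc a 1))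
    (hω : ∀ x ∈ Icc a 1, ω x = φ x - ∫ y in a..x, K.k x y * φ y) {x : ℝ} (hx : x ∈ Icc a 1) :
    φ x = ω x + ∫ y in a..x, K.l x y * ω y := by
  have ckx : ∀ x ∈ Icc a 1, ContinuousOn (fun y => K.k x y) (Icc a x) := fun x hx =>
    K.k_cont.comp_triangle (by fun_prop) (by fun_prop)
      fun y hy => ⟨ha.trans hy.1, hy.2, hx.2⟩
  have clx : ∀ x ∈ Icc a 1, ContinuousOn (fun y => K.l x y) (Icc a x) := fun x hx =>
    K.l_cont.comp_triangle (by fun_prop) (by fun_prop)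
      fun y hy => ⟨ha.trans hy.1, hy.2, hx.2⟩
  have cvol : ∀ {κ : ℝ → ℝ → ℝ} {ψ : ℝ → ℝ},
      ContinuousOn (fun p : ℝ × ℝ => κ p.1 p.2) triangle → ContinuousOn ψ (Icc a 1) →
      ContinuousOn (fun x => ∫ y in a..x, κ x y * ψ y) (Icc a 1) := by
    intro κ ψ hκ hψ
    refine continuousOn_paramIntegral (F := fun x y => κ x y * ψ y) continuousOn_const
      continuousOn_id (fun x hx => hx.1) ?_
    refine (hκ.comp_triangle (by fun_prop) (by fun_prop) ?_).mul
      (hψ.comp continuousOn_snd ?_)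
    · rintro ⟨x, y⟩ ⟨⟨h1, h2⟩, h3, h4⟩
      exact ⟨ha.trans h3, h4, h2⟩
    · rintro ⟨x, y⟩ ⟨⟨h1, h2⟩, h3, h4⟩
      exact ⟨h3, le_trans h4 h2⟩
  have hωc : ContinuousOn ω (Icc a 1) := (hφ.sub (cvol K.k_cont hφ)).congr hω
  set χ : ℝ → ℝ := fun x => ω x + ∫ y in a..x, K.l x y * ω y with hχ
  have hχc : ContinuousOn χ (Icc a 1) := hωc.add (cvol K.l_cont hωc)
  have hI : ∀ {ψ : ℝ → ℝ} {x : ℝ}, a ≤ x → ContinuousOn ψ (Icc a x) →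
      IntervalIntegrable ψ volume a x := fun h h' => by
    refine ContinuousOn.intervalIntegrable ?_
    rwa [uIcc_of_le h]
  have hmono : ∀ x ∈ Icc a 1, Icc a x ⊆ Icc a 1 := fun x hx => Icc_subset_Icc_right hx.2
  -- the candidate `χ` solves the same Volterra equation as `φ`
  have hχk : ∀ x ∈ Icc a 1, ω x = χ x - ∫ y in a..x, K.k x y * χ y := by
    intro x hx
    obtain ⟨hsi, hsw⟩ := integral_triangle_swap (m := fun y => K.k x y)
      (G := fun y r => K.l y r * ω r) hx.1 (hI hx.1 (ckx x hx)) (by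
        refine (K.l_cont.comp_triangle (by fun_prop) (by fun_prop) ?_).mul
          (hωc.comp continuousOn_snd ?_)
        · rintro ⟨r, s⟩ ⟨h1, h2, h3⟩
          exact ⟨ha.trans h1, h2, h3.trans hx.2⟩
        · rintro ⟨r, s⟩ ⟨h1, h2, h3⟩
          exact ⟨h1, h2.trans (h3.trans hx.2)⟩)
    have hωx := hωc.mono (hmono x hx)
    have e1 : ∫ y in a..x, K.k x y * χ y
        = (∫ y in a..x, K.k x y * ω y) + ∫ r in a..x, ∫ s in r..x, K.k x s * (K.l s r * ω r) := by
      rw [← hsw, ← intervalIntegral.integral_add (hI hx.1 ((ckx x hx).fun_mul hωx))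
        (hI hx.1 ((ckx x hx).fun_mul ((cvol K.l_cont hωc).mono (hmono x hx))))]
      refine intervalIntegral.integral_congr fun y _ => ?_
      simp only [hχ]; ring
    have e2 : ∫ y in a..x, K.l x y * ω y
        = (∫ y in a..x, K.k x y * ω y) + ∫ r in a..x, ∫ s in r..x, K.k x s * (K.l s r * ω r) := by
      rw [← intervalIntegral.integral_add (hI hx.1 ((ckx x hx).fun_mul hωx)) hsi]
      refine intervalIntegral.integral_congr fun y hy => ?_
      rw [uIcc_of_le hx.1] at hy
      rw [K.l_eq_k_add hf (ha.trans hy.1) hy.2 hx.2, add_mul,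
        ← intervalIntegral.integral_mul_const]
      simp only [mul_assoc]
    rw [e1, hχ]
    simp only
    rw [e2]; ring
  obtain ⟨B, hB, hk⟩ := exists_bound_of_isCompact isCompact_triangle K.k_cont
  have h0 := eq_zero_of_abs_le_integral (φ := fun x => φ x - χ x) (B := B) (hφ.sub hχc)
    (fun x hx => by
      have hφx := hφ.mono (hmono x hx)
      have hχx := hχc.mono (hmono x hx)
      have e : φ x - χ x = ∫ y in a..x, K.k x y * (φ y - χ y) := by
        have := hω x hx
        rw [hχk x hx] at this
        simp only [mul_sub]
        rw [intervalIntegral.integral_sub (hI hx.1 ((ckx x hx).fun_mul hφx))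
          (hI hx.1 ((ckx x hx).fun_mul hχx))]
        linarith
      rw [e, ← intervalIntegral.integral_const_mul]
      refine intervalIntegral.norm_integral_le_of_norm_le (f := fun y => K.k x y * (φ y - χ y))
        hx.1 ?_
        (hI hx.1 (continuousOn_const.mul (hφx.sub hχx).abs))
      filter_upwards with y hy
      rw [Real.norm_eq_abs, abs_mul]
      exact mul_le_mul_of_nonneg_right (hk (x, y) ⟨ha.trans hy.1.le, hy.2, hx.2⟩) (abs_nonneg _))
    x hx
  simp only [hχ] at h0
  linarith

/-- The resolvent equation with the two kernels in the other order. -/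
theorem l_eq_k_add' (hf : ContinuousOn (fun p : ℝ × ℝ => f p.1 p.2) triangle) {x y : ℝ}
    (hy : 0 ≤ y) (hyx : y ≤ x) (hx : x ≤ 1) :
    K.l x y = K.k x y + ∫ s in y..x, K.l x s * K.k s y :=
  K.volterra_inverse hf hy (φ := fun x => K.l x y) (ω := fun x => K.k x y)
    (K.l_cont.comp_triangle (by fun_prop) (by fun_prop) fun s hs => ⟨hy, hs.1, hs.2⟩)
    (fun s hs => by rw [K.l_eq_k_add hf hy hs.1 hs.2]; ring) ⟨hyx, hx⟩

/-! ### The actuator kernels for a fixed delay -/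

theorem continuousOn_γ_comp {X : Type*} [TopologicalSpace X] {S : Set X} {a b c : X → ℝ}
    (ha : ContinuousOn a S) (hb : ContinuousOn b S) (hc : ContinuousOn c S)
    (hab : ∀ p ∈ S, a p ∈ Icc (0 : ℝ) 1 ∧ b p ∈ Icc (0 : ℝ) 1 ∧ 0 < c p) :
    ContinuousOn (fun p => K.γ (a p) (b p) (c p)) S :=
  K.γ_lip.continuousOn.comp (ha.prodMk (hb.prodMk hc)) hab

theorem continuousOn_η_comp {X : Type*} [TopologicalSpace X] {S : Set X} {a b c : X → ℝ}
    (ha : ContinuousOn a S) (hb : ContinuousOn b S) (hc : ContinuousOn c S)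
    (hab : ∀ p ∈ S, a p ∈ Icc (0 : ℝ) 1 ∧ b p ∈ Icc (0 : ℝ) 1 ∧ 0 < c p) :
    ContinuousOn (fun p => K.η (a p) (b p) (c p)) S :=
  K.η_cont.comp (ha.prodMk (hb.prodMk hc)) hab

theorem exists_lipschitz_γ {a b : ℝ} (ha : 0 < a) : ∃ C, 0 ≤ C ∧
    ∀ x ∈ Icc (0 : ℝ) 1, ∀ y ∈ Icc (0 : ℝ) 1, ∀ d ∈ Icc a b,
    ∀ x' ∈ Icc (0 : ℝ) 1, ∀ y' ∈ Icc (0 : ℝ) 1, ∀ d' ∈ Icc a b,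
      |K.γ x y d - K.γ x' y' d'| ≤ C * (|x - x'| + |y - y'| + |d - d'|) := by
  set S : Set (ℝ × ℝ × ℝ) := Icc 0 1 ×ˢ (Icc 0 1 ×ˢ Icc a b) with hS
  have hSc : IsCompact S := isCompact_Icc.prod (isCompact_Icc.prod isCompact_Icc)
  have hSs : S ⊆ slab := fun p hp => ⟨hp.1, hp.2.1, ha.trans_le hp.2.2.1⟩
  obtain ⟨C, hC⟩ := (K.γ_lip.mono hSs).exists_lipschitzOnWith_of_compact hSc
  refine ⟨C, C.2, fun x hx y hy d hd x' hx' y' hy' d' hd' => ?_⟩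
  have h1 := hC.dist_le_mul (x, y, d) ⟨hx, hy, hd⟩ (x', y', d') ⟨hx', hy', hd'⟩
  rw [Real.dist_eq] at h1
  refine h1.trans (mul_le_mul_of_nonneg_left ?_ C.2)
  simp only [Prod.dist_eq, Real.dist_eq]
  have := abs_nonneg (x - x')
  have := abs_nonneg (y - y')
  have := abs_nonneg (d - d')
  refine max_le (by linarith) (max_le (by linarith) (by linarith))

theorem contDiffAt_γ {x y d : ℝ} (hx : x ∈ Ioo (0 : ℝ) 1) (hy : y ∈ Ioo (0 : ℝ) 1) (hd : 0 < d)
    (hxy : y ≠ d * x) :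
    ContDiffAt ℝ 1 (fun p : ℝ × ℝ × ℝ => K.γ p.1 p.2.1 p.2.2) (x, y, d) := by
  refine K.γ_diff.contDiffAt ?_
  have h1 : Ioo (0 : ℝ) 1 ×ˢ (Ioo (0 : ℝ) 1 ×ˢ Ioi (0 : ℝ)) ∈ 𝓝 (x, y, d) :=
    prod_mem_nhds (Ioo_mem_nhds hx.1 hx.2)
      (prod_mem_nhds (Ioo_mem_nhds hy.1 hy.2) (Ioi_mem_nhds hd))
  have h2 : {p : ℝ × ℝ × ℝ | p.2.1 ≠ p.2.2 * p.1} ∈ 𝓝 (x, y, d) :=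
    (isOpen_ne_fun (by fun_prop) (by fun_prop)).mem_nhds hxy
  filter_upwards [h1, h2] with p hp hp'
  exact ⟨⟨Ioo_subset_Icc_self hp.1, Ioo_subset_Icc_self hp.2.1, hp.2.2⟩, hp'⟩

theorem hasDerivAt_γ_characteristic {x y d : ℝ} (hx : x ∈ Ioo (0 : ℝ) 1)
    (hy : y ∈ Ioo (0 : ℝ) 1) (hd : 0 < d) (hxy : y ≠ d * x) :
    HasDerivAt (fun h => K.γ (x - h) (y - d * h) d)
      (-(d * ∫ s in y..1, f s y * K.γ x s d)) 0 := by
  have h1 : DifferentiableAt ℝ (fun p : ℝ × ℝ => K.γ p.1 p.2 d) (x, y) :=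
    ((K.contDiffAt_γ hx hy hd hxy).differentiableAt (by norm_num)).comp (x, y)
      (f := fun p : ℝ × ℝ => (p.1, p.2, d)) (by fun_prop)
  have h2 := hasDerivWithinAt_comp_pair (Γ := fun x y => K.γ x y d) (X := fun h => x - h)
    (Y := fun h => y - d * h) (α := -1) (β := -d) (s := univ) (t := 0) (by simpa using h1)
    (((hasDerivAt_id (0 : ℝ)).const_sub x).hasDerivWithinAt)
    (by simpa using! ((hasDerivAt_id (0 : ℝ)).const_mul d).const_sub y)
  rw [hasDerivWithinAt_univ] at h2
  refine h2.congr_deriv ?_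
  simp only [mul_zero, sub_zero]
  rw [K.γ_pde d hd x hx y hy hxy]
  ring

theorem hasDerivAt_η_characteristic {x y d : ℝ} (hx : x ∈ Ioo (0 : ℝ) 1)
    (hy : y ∈ Ioo (0 : ℝ) 1) (hd : 0 < d) (hxy : y ≠ d * x) :
    HasDerivAt (fun h => K.η (x - h) (y - d * h) d) 0 0 := by
  have h2 := hasDerivWithinAt_comp_pair (Γ := fun x y => K.η x y d) (X := fun h => x - h)
    (Y := fun h => y - d * h) (α := -1) (β := -d) (s := univ) (t := 0)
    (by simpa using K.η_diff d hd x hx y hy hxy)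
    (((hasDerivAt_id (0 : ℝ)).const_sub x).hasDerivWithinAt)
    (by simpa using! ((hasDerivAt_id (0 : ℝ)).const_mul d).const_sub y)
  rw [hasDerivWithinAt_univ] at h2
  refine h2.congr_deriv ?_
  simp only [mul_zero, sub_zero]
  linear_combination -(K.η_pde d hd x hx y hy hxy)

theorem η_characteristic {x y d h : ℝ} (hx : x ≤ 1) (hy : y ≤ 1) (hd : 0 < d) (hxy : y ≠ d * x)
    (h0 : 0 ≤ h) (hhx : h ≤ x) (hhy : d * h ≤ y) : K.η (x - h) (y - d * h) d = K.η x y d := by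
  have hdh : ∀ r ∈ Icc 0 h, 0 ≤ d * r ∧ d * r ≤ y := fun r hr =>
    ⟨mul_nonneg hd.le hr.1, (mul_le_mul_of_nonneg_left hr.2 hd.le).trans hhy⟩
  have := abs_sub_le_mul_of_right_deriv (φ := fun h => K.η (x - h) (y - d * h) d)
    (φ' := fun _ => 0) (C := 0) h0
    (K.continuousOn_η_comp (by fun_prop) (by fun_prop) (by fun_prop) fun r hr =>
      ⟨⟨by linarith [hr.2], by linarith [hr.1]⟩, ⟨by linarith [(hdh r hr).2],
        by linarith [(hdh r hr).1]⟩, hd⟩)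
    (fun r hr => by
      have hr1 : 0 < d * r := mul_pos hd hr.1
      have hr2 : d * r < d * h := mul_lt_mul_of_pos_left hr.2 hd
      refine hasDerivWithinAt_Ici_shift ?_
      have := K.hasDerivAt_η_characteristic (x := x - r) (y := y - d * r) (d := d)
        ⟨by linarith [hr.2], by linarith [hr.1]⟩ ⟨by linarith, by linarith⟩ hd
        (fun h => hxy (by linarith))
      refine this.hasDerivWithinAt.congr_of_eventuallyEq ?_ ?_
      · filter_upwards with s
        ring_nf
      · simp)
    (fun r _ => by simp)
  simp only [sub_zero, mul_zero, zero_mul] at this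
  linarith [abs_nonpos_iff.1 this]

/-! ### The kernels `γ` and `η` are related by the inverse transformation -/

/-- The defect in the identity that expresses `γ` through the inverse kernels. -/
noncomputable def γDefect (d x y : ℝ) : ℝ :=
  K.γ x y d - K.η x y d + (∫ s in y..1, K.η x s d * K.k s y)
    + d * ∫ ξ in (0 : ℝ)..x, K.p (x - ξ) d * K.γ ξ y d

theorem continuousOn_γDefect {d : ℝ} (hd : 0 < d) :
    ContinuousOn (fun p : ℝ × ℝ => K.γDefect d p.1 p.2) (Icc 0 1 ×ˢ Icc 0 1) := by
  have h1 := K.continuousOn_γ_comp (S := Icc (0 : ℝ) 1 ×ˢ Icc (0 : ℝ) 1) (a := Prod.fst)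
    (b := Prod.snd) (c := fun _ => d) (by fun_prop) (by fun_prop) (by fun_prop)
    fun p hp => ⟨hp.1, hp.2, hd⟩
  have h2 := K.continuousOn_η_comp (S := Icc (0 : ℝ) 1 ×ˢ Icc (0 : ℝ) 1) (a := Prod.fst)
    (b := Prod.snd) (c := fun _ => d) (by fun_prop) (by fun_prop) (by fun_prop)
    fun p hp => ⟨hp.1, hp.2, hd⟩
  refine ((h1.sub h2).add (continuousOn_paramIntegral
    (F := fun (p : ℝ × ℝ) s => K.η p.1 s d * K.k s p.2)
    continuousOn_snd continuousOn_const (fun p hp => hp.2.2) ?_)).add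
    (continuousOn_const.mul (continuousOn_paramIntegral
    (F := fun (p : ℝ × ℝ) ξ => K.p (p.1 - ξ) d * K.γ ξ p.2 d)
    continuousOn_const continuousOn_fst (fun p hp => hp.1.1) ?_))
  · refine (K.continuousOn_η_comp (by fun_prop) (by fun_prop) (by fun_prop) ?_).mul
      (K.k_cont.comp_triangle (by fun_prop) (by fun_prop) ?_)
    · rintro ⟨⟨x, y⟩, s⟩ ⟨⟨h1, h2⟩, h3, h4⟩
      exact ⟨h1, ⟨h2.1.trans h3, h4⟩, hd⟩
    · rintro ⟨⟨x, y⟩, s⟩ ⟨⟨h1, h2⟩, h3, h4⟩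
      exact ⟨h2.1, h3, h4⟩
  · refine (K.continuousOn_η_comp (by fun_prop) (by fun_prop) (by fun_prop) ?_).mul
      (K.continuousOn_γ_comp (by fun_prop) (by fun_prop) (by fun_prop) ?_)
    · rintro ⟨⟨x, y⟩, s⟩ ⟨⟨h1, h2⟩, h3, h4⟩
      dsimp only at *
      exact ⟨⟨by linarith, by linarith [h1.2]⟩, ⟨zero_le_one, le_rfl⟩, hd⟩
    · rintro ⟨⟨x, y⟩, s⟩ ⟨⟨h1, h2⟩, h3, h4⟩
      dsimp only at *
      exact ⟨⟨h3, by linarith [h1.2]⟩, h2, hd⟩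

/-- Integral of the defect against a weight `a` on `[y, 1]`; used for `a = f(·, y)` and, with
`y = 0`, for `a = g`. -/
theorem integral_mul_γDefect {d : ℝ} (hd : 0 < d) {a : ℝ → ℝ} {x y : ℝ}
    (hx : x ∈ Icc (0 : ℝ) 1) (hy : y ∈ Icc (0 : ℝ) 1) (ha : ContinuousOn a (Icc y 1)) :
    ∫ s in y..1, a s * K.γDefect d x s
      = (∫ s in y..1, a s * K.γ x s d)
        + (∫ s in y..1, K.η x s d * ((∫ r in y..s, a r * K.k s r) - a s))
        + d * ∫ ξ in (0 : ℝ)..x, K.p (x - ξ) d * ∫ s in y..1, a s * K.γ ξ s d := by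
  have hI : ∀ {φ : ℝ → ℝ}, ContinuousOn φ (Icc y 1) → IntervalIntegrable φ volume y 1 :=
    fun h => by
      refine ContinuousOn.intervalIntegrable ?_
      rwa [uIcc_of_le hy.2]
  have hs01 : ∀ s ∈ Icc y 1, s ∈ Icc (0 : ℝ) 1 := fun s hs => ⟨hy.1.trans hs.1, hs.2⟩
  have cη : ContinuousOn (fun s => K.η x s d) (Icc y 1) :=
    K.continuousOn_η_comp (by fun_prop) (by fun_prop) (by fun_prop)
      fun s hs => ⟨hx, hs01 s hs, hd⟩
  have cγ : ContinuousOn (fun s => K.γ x s d) (Icc y 1) :=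
    K.continuousOn_γ_comp (by fun_prop) (by fun_prop) (by fun_prop)
      fun s hs => ⟨hx, hs01 s hs, hd⟩
  have cp : ContinuousOn (fun ξ => K.p (x - ξ) d) (Icc 0 x) :=
    K.continuousOn_η_comp (by fun_prop) (by fun_prop) (by fun_prop)
      fun s hs => ⟨⟨by linarith [hs.2], by linarith [hs.1, hx.2]⟩, ⟨zero_le_one, le_rfl⟩, hd⟩
  obtain ⟨t1, t2⟩ := integral_triangle_swap (m := fun s => K.η x s d)
    (G := fun s r => a r * K.k s r) hy.2 (hI cη) (by
      refine (ha.comp continuousOn_snd ?_).mul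
        (K.k_cont.comp_triangle (by fun_prop) (by fun_prop) ?_)
      · rintro ⟨s, r⟩ ⟨h1, h2, h3⟩
        exact ⟨h1, h2.trans h3⟩
      · rintro ⟨s, r⟩ ⟨h1, h2, h3⟩
        exact ⟨hy.1.trans h1, h2, h3⟩)
  obtain ⟨r1, r2⟩ := integral_rectangle_swap (m := fun ξ => K.p (x - ξ) d)
    (G := fun ξ s => a s * K.γ ξ s d) hx.1 hy.2
    (by
      refine ContinuousOn.intervalIntegrable ?_
      rwa [uIcc_of_le hx.1])
    (by
      refine (ha.comp continuousOn_snd fun p hp => hp.2).mul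
        (K.continuousOn_γ_comp (by fun_prop) (by fun_prop) (by fun_prop) ?_)
      rintro ⟨ξ, s⟩ ⟨h1, h2⟩
      exact ⟨⟨h1.1, h1.2.trans hx.2⟩, hs01 s h2, hd⟩)
  have ck : ContinuousOn (fun s => ∫ r in y..s, a r * K.k s r) (Icc y 1) := by
    refine continuousOn_paramIntegral (F := fun s r => a r * K.k s r) continuousOn_const
      continuousOn_id (fun s hs => hs.1) ?_
    refine (ha.comp continuousOn_snd ?_).mul
        (K.k_cont.comp_triangle (by fun_prop) (by fun_prop) ?_)
    · rintro ⟨s, r⟩ ⟨h1, h2, h3⟩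
      exact ⟨h2, le_trans h3 h1.2⟩
    · rintro ⟨s, r⟩ ⟨h1, h2, h3⟩
      exact ⟨hy.1.trans h2, h3, h1.2⟩
  have e1 : ∫ s in y..1, K.η x s d * ((∫ r in y..s, a r * K.k s r) - a s)
      = (∫ r in y..1, ∫ s in r..1, K.η x s d * (a r * K.k s r))
        - ∫ s in y..1, K.η x s d * a s := by
    rw [← t2, ← intervalIntegral.integral_sub (hI (cη.fun_mul ck)) (hI (cη.fun_mul ha))]
    simp only [mul_sub]
  have e2 : ∀ s, a s * K.γDefect d x s = a s * K.γ x s d - K.η x s d * a s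
      + (∫ r in s..1, K.η x r d * (a s * K.k r s))
      + d * ∫ ξ in (0 : ℝ)..x, K.p (x - ξ) d * (a s * K.γ ξ s d) := by
    intro s
    have e3 : ∫ r in s..1, K.η x r d * (a s * K.k r s)
        = a s * ∫ r in s..1, K.η x r d * K.k r s := by
      rw [← intervalIntegral.integral_const_mul]
      congr 1; ext r; ring
    have e4 : ∫ ξ in (0 : ℝ)..x, K.p (x - ξ) d * (a s * K.γ ξ s d)
        = a s * ∫ ξ in (0 : ℝ)..x, K.p (x - ξ) d * K.γ ξ s d := by
      rw [← intervalIntegral.integral_const_mul]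
      congr 1; ext r; ring
    rw [e3, e4, γDefect]; ring
  simp_rw [e2]
  rw [intervalIntegral.integral_add (((hI (ha.fun_mul cγ)).sub (hI (cη.fun_mul ha))).add t1)
      (r1.const_mul d),
    intervalIntegral.integral_add ((hI (ha.fun_mul cγ)).sub (hI (cη.fun_mul ha))) t1,
    intervalIntegral.integral_sub (hI (ha.fun_mul cγ)) (hI (cη.fun_mul ha)),
    intervalIntegral.integral_const_mul, e1, ← r2]
  ring

theorem γDefect_bottom (hg : ContinuousOn g (Icc 0 1)) {d : ℝ} (hd : 0 < d) {x : ℝ}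
    (hx : x ∈ Icc (0 : ℝ) 1) :
    K.γDefect d x 0 = ∫ s in (0 : ℝ)..1, g s * K.γDefect d x s := by
  rw [K.integral_mul_γDefect hd hx ⟨le_rfl, zero_le_one⟩ hg, γDefect, K.γ_bc d hd x hx,
    K.η_bc d hd x hx, sub_zero]
  congr 2
  · refine intervalIntegral.integral_congr fun s hs => ?_
    rw [uIcc_of_le zero_le_one] at hs
    simp only [K.k_bc s hs, mul_comm (g _)]
  · refine intervalIntegral.integral_congr fun ξ hξ => ?_
    rw [uIcc_of_le hx.1] at hξ
    simp only [K.γ_bc d hd ξ ⟨hξ.1, hξ.2.trans hx.2⟩]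

theorem γDefect_left (hf : ContinuousOn (fun p : ℝ × ℝ => f p.1 p.2) triangle) {d : ℝ}
    (hd : 0 < d) {y : ℝ} (hy : y ∈ Icc (0 : ℝ) 1) : K.γDefect d 0 y = 0 := by
  have e : ∫ s in y..1, K.η 0 s d * K.k s y = ∫ s in y..1, K.l 1 s * K.k s y := by
    refine intervalIntegral.integral_congr fun s hs => ?_
    rw [uIcc_of_le hy.2] at hs
    simp only [K.η_init d hd s ⟨hy.1.trans hs.1, hs.2⟩]
  rw [γDefect, K.γ_init d hd y hy, K.η_init d hd y hy, e,
    K.l_eq_k_add' hf hy.1 hy.2 le_rfl]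
  simp

end Kernels

theorem hasDerivWithinAt_Ici_scale {φ : ℝ → ℝ} {c d : ℝ} (hd : 0 ≤ d)
    (h : HasDerivWithinAt φ c (Ici 0) 0) :
    HasDerivWithinAt (fun s => φ (d * s)) (d * c) (Ici 0) 0 := by
  have h2 : HasDerivWithinAt (fun s : ℝ => d * s) d (Ici 0) 0 := by
    simpa using! ((hasDerivAt_id (0 : ℝ)).const_mul d).hasDerivWithinAt
  have h3 := HasDerivWithinAt.scomp (t' := Ici 0) (x := (0 : ℝ))
    (g₁ := φ) (h := fun s => d * s) (by simpa using h) h2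
    (fun s hs => mul_nonneg hd hs)
  simpa [Function.comp_def] using h3

theorem ae_ne (c : ℝ) : ∀ᵐ y : ℝ, y ≠ c := by simp [ae_iff, measure_singleton]

/-- A bound that holds on an interval off one point holds at that point as well. -/
theorem le_of_forall_ne {φ : ℝ → ℝ} {C c x : ℝ} (hφ : ContinuousOn φ (Icc 0 1))
    (h : ∀ x ∈ Icc (0 : ℝ) 1, x ≠ c → φ x ≤ C) (hx : x ∈ Icc (0 : ℝ) 1) : φ x ≤ C := by
  by_cases hxc : x ≠ c
  · exact h x hx hxc
  push Not at hxc
  subst hxc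
  rcases hx.2.lt_or_eq with h1 | h1
  · have ht : Tendsto φ (𝓝[>] x) (𝓝 (φ x)) := (hφ x hx).mono_of_mem_nhdsWithin
      (mem_of_superset (Ioc_mem_nhdsGT h1) fun z hz => ⟨hx.1.trans hz.1.le, hz.2⟩)
    refine le_of_tendsto ht ?_
    filter_upwards [Ioc_mem_nhdsGT h1] with z hz
    exact h z ⟨hx.1.trans hz.1.le, hz.2⟩ hz.1.ne'
  · have h0 : 0 < x := by linarith
    have ht : Tendsto φ (𝓝[<] x) (𝓝 (φ x)) := (hφ x hx).mono_of_mem_nhdsWithin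
      (mem_of_superset (Ico_mem_nhdsLT h0) fun z hz => ⟨hz.1, hz.2.le.trans hx.2⟩)
    refine le_of_tendsto ht ?_
    filter_upwards [Ico_mem_nhdsLT h0] with z hz
    exact h z ⟨hz.1, hz.2.le.trans hx.2⟩ hz.2.ne

namespace Kernels

variable {f : ℝ → ℝ → ℝ} {g : ℝ → ℝ} (K : Kernels f g)

/-- The defect satisfies the same equation along the characteristics as `γ`. -/
theorem hasDerivWithinAt_γDefect (hf : ContinuousOn (fun p : ℝ × ℝ => f p.1 p.2) triangle)
    {d : ℝ} (hd : 0 < d) {x y : ℝ} (hx : x ∈ Ioo (0 : ℝ) 1) (hy : y ∈ Ioo (0 : ℝ) 1)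
    (hxy : y ≠ d * x) :
    HasDerivWithinAt (fun h => K.γDefect d (x - h) (y - d * h))
      (-(d * ∫ s in y..1, f s y * K.γDefect d x s)) (Ici 0) 0 := by
  obtain ⟨hkd, Ck, hCk, hkl⟩ := K.k_transport hf
  obtain ⟨Cγ, hCγ, hγl⟩ := K.exists_lipschitz_γ (a := d) (b := d) hd
  have hηc : ContinuousOn (fun p : ℝ × ℝ => K.η p.1 p.2 d) (Icc 0 1 ×ˢ Icc 0 1) :=
    K.continuousOn_η_comp (by fun_prop) (by fun_prop) (by fun_prop) fun p hp => ⟨hp.1, hp.2, hd⟩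
  obtain ⟨Bη, hBη, hη⟩ := exists_bound_of_isCompact (isCompact_Icc.prod isCompact_Icc) hηc
  obtain ⟨δ, hδ, hδx, hδy, hδ1⟩ : ∃ δ > 0, δ ≤ x ∧ d * δ ≤ y ∧ y + d * δ ≤ 1 := by
    refine ⟨min x (min (y / d) ((1 - y) / d)), ?_, min_le_left _ _, ?_, ?_⟩
    · have := hx.1
      have := div_pos hy.1 hd
      have := div_pos (sub_pos.2 hy.2) hd
      simp only [gt_iff_lt, lt_min_iff]
      tauto
    · have := (min_le_right x _).trans (min_le_left (y / d) ((1 - y) / d))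
      rw [le_div_iff₀ hd] at this
      linarith
    · have := (min_le_right x _).trans (min_le_right (y / d) ((1 - y) / d))
      rw [le_div_iff₀ hd] at this
      linarith
  have hdh : ∀ h ∈ Icc 0 δ, 0 ≤ d * h ∧ d * h ≤ d * δ := fun h hh =>
    ⟨mul_nonneg hd.le hh.1, mul_le_mul_of_nonneg_left hh.2 hd.le⟩
  -- the part of `∫ η k` that stays inside
  have hin := hasDerivWithinAt_integral (Φ := fun h s => K.η x s d * K.k (s - d * h) (y - d * h))
    (D := fun s => K.η x s d * (d * -K.kRate s y)) (C := Bη * (Ck * d)) hy.2.le hδ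
    (fun h hh => by
      refine ContinuousOn.intervalIntegrable ?_
      rw [uIcc_of_le hy.2.le]
      have := hdh h hh
      refine (K.continuousOn_η_comp (by fun_prop) (by fun_prop) (by fun_prop) ?_).mul
        (K.k_cont.comp_triangle (by fun_prop) (by fun_prop) ?_)
      · exact fun s hs => ⟨Ioo_subset_Icc_self hx, ⟨hy.1.le.trans hs.1, hs.2⟩, hd⟩
      · exact fun s hs => ⟨by linarith, by linarith [hs.1], by linarith [hs.2]⟩)
    (fun h hh s hs => by
      have h1 := hdh h ⟨hh.1.le, hh.2⟩
      have e1 := hkl s y (d * h) h1.1 (by linarith) hs.1 hs.2.le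
      have e2 := hη (x, s) ⟨Ioo_subset_Icc_self hx, ⟨hy.1.le.trans hs.1.le, hs.2.le⟩⟩
      simp only [mul_zero, sub_zero]
      rw [← mul_sub, abs_mul]
      calc _ ≤ Bη * (Ck * (d * h)) := by gcongr
        _ = _ := by ring)
    (Eventually.of_forall fun s hs =>
      (hasDerivWithinAt_Ici_scale hd.le (hkd s y hy.1 hs.1 hs.2.le)).const_mul (K.η x s d))
  -- the part of `∫ η k` that leaves through the upper end
  have hout := hasDerivWithinAt_integral_shrinking
    (Φ := fun h s => K.η (x - h) s d * K.k s (y - d * h))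
    (a := y) (b := 1) hd.le hδ hδ1 (by
      refine (K.continuousOn_η_comp (by fun_prop) (by fun_prop) (by fun_prop) ?_).mul
        (K.k_cont.comp_triangle (by fun_prop) (by fun_prop) ?_)
      · rintro ⟨h, s⟩ ⟨h1, h2⟩
        exact ⟨⟨by linarith [h1.2], by linarith [h1.1, hx.2]⟩, ⟨hy.1.le.trans h2.1, h2.2⟩, hd⟩
      · rintro ⟨h, s⟩ ⟨h1, h2⟩
        have := hdh h h1
        exact ⟨by linarith, by linarith [h2.1], h2.2⟩)
  -- the convolution with `p`
  have hconv := hasDerivWithinAt_integral_moving_left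
    (Φ := fun h ξ => K.p (x - ξ) d * K.γ (ξ - h) (y - d * h) d)
    (D := fun ξ => K.p (x - ξ) d * -(d * ∫ s in y..1, f s y * K.γ ξ s d))
    (a := 0) (b := x) (c := 1) (C := Bη * (Cγ * (1 + d))) hx.1 zero_le_one hδ (by linarith)
    (by positivity)
    (by
      refine (K.continuousOn_η_comp (by fun_prop) (by fun_prop) (by fun_prop) ?_).mul
        (K.continuousOn_γ_comp (by fun_prop) (by fun_prop) (by fun_prop) ?_)
      · exact fun ξ hξ => ⟨⟨by linarith [hξ.2], by linarith [hξ.1, hx.2]⟩,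
          ⟨zero_le_one, le_rfl⟩, hd⟩
      · exact fun ξ hξ => ⟨⟨by linarith [hξ.1], by linarith [hξ.2, hx.2]⟩,
          ⟨by linarith [hy.1], by linarith [hy.2]⟩, hd⟩)
    (fun h hh => by
      have h1 := hdh h hh
      refine ContinuousOn.intervalIntegrable ?_
      rw [uIcc_of_le (by linarith [hh.2])]
      refine (K.continuousOn_η_comp (by fun_prop) (by fun_prop) (by fun_prop) ?_).mul
        (K.continuousOn_γ_comp (by fun_prop) (by fun_prop) (by fun_prop) ?_)
      · exact fun ξ hξ => ⟨⟨by linarith [hξ.2], by linarith [hξ.1, hx.2, hh.1]⟩,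
          ⟨zero_le_one, le_rfl⟩, hd⟩
      · exact fun ξ hξ => ⟨⟨by linarith [hξ.1], by linarith [hξ.2, hx.2, hh.1]⟩,
          ⟨by linarith [hy.1], by linarith [hy.2]⟩, hd⟩)
    (fun h hh ξ hξ => by
      have h1 := hdh h ⟨hh.1.le, hh.2⟩
      have e1 := hη (x - ξ, 1) ⟨⟨by linarith [hξ.2], by linarith [hξ.1, hh.1, hx.2]⟩,
        ⟨zero_le_one, le_rfl⟩⟩
      have e2 := hγl (ξ - h) ⟨by linarith [hξ.1], by linarith [hξ.2, hx.2, hh.1]⟩ (y - d * h)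
        ⟨by linarith, by linarith [hy.2]⟩ d ⟨le_rfl, le_rfl⟩ ξ
        ⟨by linarith [hξ.1, hh.1], by linarith [hξ.2, hx.2, hh.1]⟩ y ⟨hy.1.le, hy.2.le⟩ d
        ⟨le_rfl, le_rfl⟩
      have e3 : |ξ - h - ξ| + |y - d * h - y| + |d - d| = (1 + d) * h := by
        have a1 : ξ - h - ξ = -h := by ring
        have a2 : y - d * h - y = -(d * h) := by ring
        rw [a1, a2, abs_neg, abs_neg, abs_of_pos hh.1, abs_of_nonneg h1.1]
        simp; ring
      rw [e3] at e2
      simp only [mul_zero, sub_zero]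
      rw [← mul_sub, abs_mul]
      calc _ ≤ Bη * (Cγ * ((1 + d) * h)) := by gcongr; exact e1
        _ = _ := by ring)
    (by
      filter_upwards [ae_ne (y / d)] with ξ hξ hξ'
      refine HasDerivWithinAt.const_mul _
        (K.hasDerivAt_γ_characteristic ⟨hξ'.1, hξ'.2.trans hx.2⟩ hy hd ?_).hasDerivWithinAt
      intro h
      apply hξ
      rw [h]; field_simp)
  have hγd := (K.hasDerivAt_γ_characteristic hx hy hd hxy).hasDerivWithinAt (s := Ici 0)
  have hsum := ((hγd.sub_const (K.η x y d)).fun_add (hin.2.fun_add hout)).fun_add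
    (hconv.2.const_mul d)
  have hval : -(d * ∫ s in y..1, f s y * K.γ x s d)
      + ((∫ s in y..1, K.η x s d * (d * -K.kRate s y)) + d * (K.η (x - 0) 1 d * K.k 1 (y - d * 0)))
      + d * (-(1 * (K.p (x - 0) d * K.γ (0 - 0) (y - d * 0) d))
        + ∫ ξ in (0 : ℝ)..x, K.p (x - ξ) d * -(d * ∫ s in y..1, f s y * K.γ ξ s d))
      = -(d * ∫ s in y..1, f s y * K.γDefect d x s) := by
    rw [K.integral_mul_γDefect hd (Ioo_subset_Icc_self hx) (Ioo_subset_Icc_self hy)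
      (hf.comp_triangle (by fun_prop) (by fun_prop) fun s hs => ⟨hy.1.le, hs.1, hs.2⟩)]
    have e1 : ∫ s in y..1, K.η x s d * (d * -K.kRate s y) = -d *
        ∫ s in y..1, K.η x s d * ((∫ r in y..s, f r y * K.k s r) - f s y) := by
      rw [← intervalIntegral.integral_const_mul]
      refine intervalIntegral.integral_congr fun s _ => ?_
      simp only [kRate]; ring
    have e2 : ∫ ξ in (0 : ℝ)..x, K.p (x - ξ) d * -(d * ∫ s in y..1, f s y * K.γ ξ s d)
        = -d * ∫ ξ in (0 : ℝ)..x, K.p (x - ξ) d * ∫ s in y..1, f s y * K.γ ξ s d := by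
      rw [← intervalIntegral.integral_const_mul]
      refine intervalIntegral.integral_congr fun s _ => ?_
      ring
    rw [e1, e2]
    simp only [mul_zero, sub_zero]
    rw [K.γ_init d hd y (Ioo_subset_Icc_self hy), p]
    ring
  rw [hval] at hsum
  refine hsum.congr_of_eventuallyEq ?_ ?_
  · filter_upwards [Icc_mem_nhdsGE hδ] with h hh
    have h1 := hdh h hh
    rw [γDefect, K.η_characteristic hx.2.le hy.2.le hd hxy hh.1 (hh.2.trans hδx) (by linarith)]
    congr 1
    · congr 1
      have hc : ∀ a b, y - d * h ≤ a → a ≤ b → b ≤ 1 → IntervalIntegrable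
          (fun s => K.η (x - h) s d * K.k s (y - d * h)) volume a b := fun a b h2 h3 h4 => by
        refine ContinuousOn.intervalIntegrable ?_
        rw [uIcc_of_le h3]
        refine (K.continuousOn_η_comp (by fun_prop) (by fun_prop) (by fun_prop) ?_).mul
          (K.k_cont.comp_triangle (by fun_prop) (by fun_prop) ?_)
        · exact fun s hs => ⟨⟨by linarith [hh.2], by linarith [hh.1, hx.2]⟩,
            ⟨by linarith [hs.1], by linarith [hs.2]⟩, hd⟩
        · exact fun s hs => ⟨by linarith, by linarith [hs.1], by linarith [hs.2]⟩
      rw [← intervalIntegral.integral_add_adjacent_intervals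
        (hc (y - d * h) (1 - d * h) le_rfl (by linarith [hy.2]) (by linarith))
        (hc (1 - d * h) 1 (by linarith [hy.2]) (by linarith) le_rfl),
        ← intervalIntegral.integral_comp_sub_right
          (fun s => K.η (x - h) s d * K.k s (y - d * h)) (d * h)]
      congr 1
      refine intervalIntegral.integral_congr_ae ?_
      filter_upwards [ae_ne (d * x)] with s hs hs'
      rw [uIoc_of_le hy.2.le] at hs'
      rw [K.η_characteristic hx.2.le hs'.2 hd hs hh.1 (hh.2.trans hδx) (by linarith [hs'.1])]
    · congr 1
      have := intervalIntegral.integral_comp_sub_right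
        (fun ξ => K.p (x - h - ξ) d * K.γ ξ (y - d * h) d) h (a := h) (b := x)
      rw [sub_self] at this
      rw [← this, zero_add, one_mul]
      refine intervalIntegral.integral_congr fun ξ _ => ?_
      congr 2
      ring
  · simp [γDefect]

theorem integral_exp_neg_le {μ c y : ℝ} (hμ : 0 < μ) :
    ∫ s in y..1, Real.exp (-(μ * (s - c))) ≤ Real.exp (-(μ * (y - c))) / μ := by
  have hd : ∀ s : ℝ, HasDerivAt (fun s => -(Real.exp (-(μ * (s - c))) / μ))
      (Real.exp (-(μ * (s - c)))) s := by
    intro s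
    have h1 : HasDerivAt (fun s : ℝ => -(μ * (s - c))) (-μ) s := by
      simpa using! ((((hasDerivAt_id s).sub_const c).const_mul μ).neg)
    refine ((h1.exp.div_const μ).neg).congr_deriv ?_
    field_simp
  rw [intervalIntegral.integral_eq_sub_of_hasDerivAt (fun s _ => hd s)
    (Continuous.intervalIntegrable (by fun_prop) _ _)]
  have : 0 < Real.exp (-(μ * (1 - c))) / μ := by positivity
  linarith

/-- The homogeneous transport problem for the defect has only the zero solution: the map it
defines is a contraction for the maximum norm with weight `exp (μ (y - d x))`, `μ` large. -/
theorem γDefect_eq_zero (hf : ContinuousOn (fun p : ℝ × ℝ => f p.1 p.2) triangle)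
    (hg : ContinuousOn g (Icc 0 1)) {d : ℝ} (hd : 0 < d) {x y : ℝ} (hx : x ∈ Icc (0 : ℝ) 1)
    (hy : y ∈ Icc (0 : ℝ) 1) : K.γDefect d x y = 0 := by
  obtain ⟨Cf, hCf, hfb⟩ := exists_bound_of_isCompact isCompact_triangle hf
  obtain ⟨Cg, hCg, hgb⟩ := exists_bound_of_isCompact isCompact_Icc hg
  have hEc := K.continuousOn_γDefect hd
  set μ : ℝ := 2 * (Cg + d * Cf) + 1 with hμdef
  have hμ : 0 < μ := by positivity
  set W : ℝ → ℝ → ℝ := fun x y => Real.exp (-(μ * (y - d * x))) with hW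
  have hWpos : ∀ x y, 0 < W x y := fun x y => Real.exp_pos _
  have hQc : ContinuousOn (fun p : ℝ × ℝ => |K.γDefect d p.1 p.2| / W p.1 p.2)
      (Icc 0 1 ×ˢ Icc 0 1) :=
    hEc.abs.div (by fun_prop) fun p _ => (hWpos _ _).ne'
  obtain ⟨⟨x₀, y₀⟩, hm, hmax⟩ := (isCompact_Icc.prod isCompact_Icc).exists_isMaxOn
    ⟨(0, 0), ⟨by simp, by simp⟩⟩ hQc
  set M := |K.γDefect d x₀ y₀| / W x₀ y₀ with hM
  have hM0 : 0 ≤ M := div_nonneg (abs_nonneg _) (hWpos _ _).le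
  have hle : ∀ x ∈ Icc (0 : ℝ) 1, ∀ y ∈ Icc (0 : ℝ) 1, |K.γDefect d x y| ≤ M * W x y :=
    fun x hx y hy => (div_le_iff₀ (hWpos x y)).1 (hmax (show (x, y) ∈ _ from ⟨hx, hy⟩))
  have hint : ∀ (a : ℝ → ℝ) (A : ℝ), 0 ≤ A → ∀ x ∈ Icc (0 : ℝ) 1, ∀ y ∈ Icc (0 : ℝ) 1,
      (∀ s ∈ Icc y 1, |a s| ≤ A) →
      |∫ s in y..1, a s * K.γDefect d x s| ≤ A * M / μ * W x y := by
    intro a A hA x hx y hy ha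
    have h1 := intervalIntegral.norm_integral_le_of_norm_le (μ := volume)
      (f := fun s => a s * K.γDefect d x s) (g := fun s => A * M * W x s) hy.2
      (Eventually.of_forall fun s hs => by
        rw [Real.norm_eq_abs, abs_mul, mul_assoc]
        exact mul_le_mul (ha s ⟨hs.1.le, hs.2⟩) (hle x hx s ⟨hy.1.trans hs.1.le, hs.2⟩)
          (abs_nonneg _) hA)
      (Continuous.intervalIntegrable (by fun_prop) _ _)
    rw [intervalIntegral.integral_const_mul] at h1
    refine h1.trans ?_
    calc _ ≤ A * M * (W x y / μ) :=
          mul_le_mul_of_nonneg_left (integral_exp_neg_le hμ) (mul_nonneg hA hM0)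
      _ = _ := by ring
  have hhalf : ∀ x ∈ Icc (0 : ℝ) 1, ∀ y ∈ Icc (0 : ℝ) 1, x ≠ y / d →
      |K.γDefect d x y| / W x y ≤ M / 2 := by
    intro x hx y hy hxy
    have hxy' : y ≠ d * x := fun h => hxy (by rw [h]; field_simp)
    rw [div_le_iff₀ (hWpos x y)]
    set T := min x (y / d) with hT
    have hT0 : 0 ≤ T := le_min hx.1 (div_nonneg hy.1 hd.le)
    have hTx : T ≤ x := min_le_left _ _
    have hTy : d * T ≤ y := by
      have := min_le_right x (y / d)
      rw [le_div_iff₀ hd] at this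
      linarith
    have hdr : ∀ r ∈ Icc 0 T, 0 ≤ d * r ∧ d * r ≤ y := fun r hr =>
      ⟨mul_nonneg hd.le hr.1, (mul_le_mul_of_nonneg_left hr.2 hd.le).trans hTy⟩
    have hWr : ∀ r, W (x - r) (y - d * r) = W x y := fun r => by
      simp only [hW]; congr 1; ring
    have hmem : ∀ r ∈ Icc 0 T, x - r ∈ Icc (0 : ℝ) 1 ∧ y - d * r ∈ Icc (0 : ℝ) 1 := fun r hr =>
      ⟨⟨by linarith [hr.2], by linarith [hr.1, hx.2]⟩, ⟨by linarith [(hdr r hr).2],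
        by linarith [(hdr r hr).1, hy.2]⟩⟩
    have hpath := abs_sub_le_mul_of_right_deriv
      (φ := fun h => K.γDefect d (x - h) (y - d * h))
      (φ' := fun h => -(d * ∫ s in (y - d * h)..1, f s (y - d * h) * K.γDefect d (x - h) s))
      (C := d * (Cf * M / μ * W x y)) hT0
      (hEc.comp (f := fun h => (x - h, y - d * h)) (by fun_prop) fun r hr => hmem r hr)
      (fun r hr => by
        have hr1 : 0 < d * r := mul_pos hd hr.1
        have hr2 : d * r < d * T := mul_lt_mul_of_pos_left hr.2 hd
        refine hasDerivWithinAt_Ici_shift ?_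
        have := K.hasDerivWithinAt_γDefect hf hd (x := x - r) (y := y - d * r)
          ⟨by linarith [hr.2], by linarith [hr.1, hx.2]⟩ ⟨by linarith, by linarith [hy.2]⟩
          (fun h => hxy' (by linarith))
        refine this.congr_of_eventuallyEq ?_ ?_
        · filter_upwards with s
          ring_nf
        · simp)
      (fun r hr => by
        have hm := hmem r ⟨hr.1.le, hr.2.le⟩
        rw [abs_neg, abs_mul, abs_of_pos hd]
        refine mul_le_mul_of_nonneg_left ?_ hd.le
        rw [← hWr r]
        exact hint _ Cf hCf _ hm.1 _ hm.2 fun s hs => hfb (s, y - d * r) ⟨hm.2.1, hs.1, hs.2⟩)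
    simp only [sub_zero, mul_zero] at hpath
    have hend : |K.γDefect d (x - T) (y - d * T)| ≤ Cg * M / μ * W x y := by
      have hm := hmem T ⟨hT0, le_rfl⟩
      rcases le_total x (y / d) with h | h
      · have h1 : T = x := min_eq_left h
        rw [h1, sub_self]
        rw [h1] at hm
        rw [K.γDefect_left hf hd hm.2, abs_zero]
        have := hWpos x y
        positivity
      · have h1 : y - d * T = 0 := by
          have : T = y / d := min_eq_right h
          rw [this]; field_simp; ring
        rw [← hWr T, h1, K.γDefect_bottom hg hd hm.1]
        exact hint g Cg hCg _ hm.1 0 ⟨le_rfl, zero_le_one⟩ hgb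
    have hT1 : T ≤ 1 := hTx.trans hx.2
    have h3 : |K.γDefect d x y| ≤ Cg * M / μ * W x y + d * (Cf * M / μ * W x y) := by
      have h4 : d * (Cf * M / μ * W x y) * T ≤ d * (Cf * M / μ * W x y) := by
        have : 0 ≤ d * (Cf * M / μ * W x y) := by
          have := hWpos x y
          positivity
        nlinarith
      have h5 := abs_sub_abs_le_abs_sub (K.γDefect d x y) (K.γDefect d (x - T) (y - d * T))
      rw [abs_sub_comm] at h5
      linarith
    refine h3.trans ?_
    have e : Cg * M / μ * W x y + d * (Cf * M / μ * W x y)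
        = ((Cg + d * Cf) / μ) * (M * W x y) := by ring
    have h6 : (Cg + d * Cf) / μ ≤ 1 / 2 := by
      rw [div_le_div_iff₀ hμ two_pos]; linarith
    have h7 : 0 ≤ M * W x y := mul_nonneg hM0 (hWpos x y).le
    rw [e]
    nlinarith
  have h1 : M ≤ M / 2 := le_of_forall_ne (φ := fun x => |K.γDefect d x y₀| / W x y₀)
    (hQc.comp (f := fun x => (x, y₀)) (by fun_prop) fun x hx => ⟨hx, hm.2⟩)
    (fun x hx => hhalf x hx y₀ hm.2) hm.1
  have h2 : M = 0 := by linarith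
  have := hle x hx y hy
  rw [h2, zero_mul] at this
  exact abs_nonpos_iff.1 this

/-! ### The inverse transformation -/

theorem continuousOn_w {φ : ℝ → ℝ} (hφ : ContinuousOn φ (Icc 0 1)) :
    ContinuousOn (K.w φ) (Icc 0 1) := by
  refine hφ.sub (continuousOn_paramIntegral (F := fun x y => K.k x y * φ y) continuousOn_const
    continuousOn_id (fun x hx => hx.1) ?_)
  refine (K.k_cont.comp_triangle (by fun_prop) (by fun_prop) ?_).mul (hφ.comp continuousOn_snd ?_)
  · rintro ⟨x, y⟩ ⟨⟨h1, h2⟩, h3, h4⟩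
    exact ⟨h3, h4, h2⟩
  · rintro ⟨x, y⟩ ⟨⟨h1, h2⟩, h3, h4⟩
    exact ⟨h3, le_trans h4 h2⟩

theorem continuousOn_z {φ ψ : ℝ → ℝ} (hφ : ContinuousOn φ (Icc 0 1))
    (hψ : ContinuousOn ψ (Icc 0 1)) {d : ℝ} (hd : 0 < d) :
    ContinuousOn (K.z d φ ψ) (Icc 0 1) := by
  refine (hψ.sub (continuousOn_paramIntegral (F := fun x y => K.γ x y d * φ y) continuousOn_const
    continuousOn_const (fun x hx => zero_le_one) ?_)).sub (continuousOn_const.mul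
    (continuousOn_paramIntegral (F := fun x y => K.q (x - y) d * ψ y) continuousOn_const
    continuousOn_id (fun x hx => hx.1) ?_))
  · refine (K.continuousOn_γ_comp (by fun_prop) (by fun_prop) (by fun_prop) ?_).mul
      (hφ.comp continuousOn_snd ?_)
    · rintro ⟨x, y⟩ ⟨h1, h2⟩
      exact ⟨h1, h2, hd⟩
    · rintro ⟨x, y⟩ ⟨h1, h2⟩
      exact h2
  · refine (K.continuousOn_γ_comp (by fun_prop) (by fun_prop) (by fun_prop) ?_).mul
      (hψ.comp continuousOn_snd ?_)
    · rintro ⟨x, y⟩ ⟨⟨h1, h2⟩, h3, h4⟩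
      dsimp only [id] at *
      exact ⟨⟨by linarith, by linarith⟩, ⟨zero_le_one, le_rfl⟩, hd⟩
    · rintro ⟨x, y⟩ ⟨⟨h1, h2⟩, h3, h4⟩
      exact ⟨h3, le_trans h4 h2⟩

theorem eq_w_add (hf : ContinuousOn (fun p : ℝ × ℝ => f p.1 p.2) triangle) {φ : ℝ → ℝ}
    (hφ : ContinuousOn φ (Icc 0 1)) {x : ℝ} (hx : x ∈ Icc (0 : ℝ) 1) :
    φ x = K.w φ x + ∫ y in (0 : ℝ)..x, K.l x y * K.w φ y :=
  K.volterra_inverse hf le_rfl hφ (fun _ _ => rfl) hx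

/-- The identity that makes `η` and `p` the kernels of the inverse transformation. -/
theorem γ_eq_of_inverse (hf : ContinuousOn (fun p : ℝ × ℝ => f p.1 p.2) triangle)
    (hg : ContinuousOn g (Icc 0 1)) {d : ℝ} (hd : 0 < d) {x y : ℝ} (hx : x ∈ Icc (0 : ℝ) 1)
    (hy : y ∈ Icc (0 : ℝ) 1) :
    K.γ x y d = K.η x y d - (∫ s in y..1, K.η x s d * K.k s y)
      - d * ∫ ξ in (0 : ℝ)..x, K.p (x - ξ) d * K.γ ξ y d := by
  have := K.γDefect_eq_zero hf hg hd hx hy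
  rw [γDefect] at this
  linarith

theorem q_eq_of_inverse (hf : ContinuousOn (fun p : ℝ × ℝ => f p.1 p.2) triangle)
    (hg : ContinuousOn g (Icc 0 1)) {d : ℝ} (hd : 0 < d) {x r : ℝ} (hr : 0 ≤ r) (hrx : r ≤ x)
    (hx : x ≤ 1) :
    K.q (x - r) d = K.p (x - r) d - d * ∫ y in r..x, K.p (x - y) d * K.q (y - r) d := by
  have h1 := K.γ_eq_of_inverse hf hg hd (x := x - r) (y := 1) ⟨by linarith, by linarith⟩
    ⟨zero_le_one, le_rfl⟩
  have h2 := intervalIntegral.integral_comp_sub_right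
    (fun ξ => K.p (x - r - ξ) d * K.γ ξ 1 d) r (a := r) (b := x)
  rw [sub_self] at h2
  rw [intervalIntegral.integral_same, ← h2, sub_zero] at h1
  rw [q, h1, p]
  congr 2
  refine intervalIntegral.integral_congr fun y _ => ?_
  simp only [q]
  congr 2
  ring

/-- The inverse of the transformation of the actuator state. -/
theorem eq_z_add (hf : ContinuousOn (fun p : ℝ × ℝ => f p.1 p.2) triangle)
    (hg : ContinuousOn g (Icc 0 1)) {d : ℝ} (hd : 0 < d) {φ ψ : ℝ → ℝ}
    (hφ : ContinuousOn φ (Icc 0 1)) (hψ : ContinuousOn ψ (Icc 0 1)) {x : ℝ}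
    (hx : x ∈ Icc (0 : ℝ) 1) :
    ψ x = K.z d φ ψ x + (∫ y in (0 : ℝ)..1, K.η x y d * K.w φ y)
      + d * ∫ y in (0 : ℝ)..x, K.p (x - y) d * K.z d φ ψ y := by
  have hI1 : ∀ {φ : ℝ → ℝ}, ContinuousOn φ (Icc 0 1) → IntervalIntegrable φ volume 0 1 :=
    fun h => by
      refine ContinuousOn.intervalIntegrable ?_
      rwa [uIcc_of_le zero_le_one]
  have hIx : ∀ {φ : ℝ → ℝ}, ContinuousOn φ (Icc 0 x) → IntervalIntegrable φ volume 0 x :=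
    fun h => by
      refine ContinuousOn.intervalIntegrable ?_
      rwa [uIcc_of_le hx.1]
  have hsub : Icc 0 x ⊆ Icc (0 : ℝ) 1 := Icc_subset_Icc_right hx.2
  have cη : ContinuousOn (fun y => K.η x y d) (Icc 0 1) :=
    K.continuousOn_η_comp (by fun_prop) (by fun_prop) (by fun_prop) fun y hy => ⟨hx, hy, hd⟩
  have cp : ContinuousOn (fun y => K.p (x - y) d) (Icc 0 x) :=
    K.continuousOn_η_comp (by fun_prop) (by fun_prop) (by fun_prop) fun y hy =>
      ⟨⟨by linarith [hy.2], by linarith [hy.1, hx.2]⟩, ⟨zero_le_one, le_rfl⟩, hd⟩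
  have cq : ContinuousOn (fun y => K.q (x - y) d) (Icc 0 x) :=
    K.continuousOn_γ_comp (by fun_prop) (by fun_prop) (by fun_prop) fun y hy =>
      ⟨⟨by linarith [hy.2], by linarith [hy.1, hx.2]⟩, ⟨zero_le_one, le_rfl⟩, hd⟩
  have cγ : ContinuousOn (fun y => K.γ x y d) (Icc 0 1) :=
    K.continuousOn_γ_comp (by fun_prop) (by fun_prop) (by fun_prop) fun y hy => ⟨hx, hy, hd⟩
  have ckφ : ContinuousOn (fun x => ∫ y in (0 : ℝ)..x, K.k x y * φ y) (Icc 0 1) := by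
    have := hφ.sub (K.continuousOn_w hφ)
    refine this.congr fun x _ => ?_
    simp [w]
  obtain ⟨t1, t2⟩ := integral_triangle_swap (m := fun y => K.η x y d)
    (G := fun y r => K.k y r * φ r) zero_le_one (hI1 cη) (by
      refine (K.k_cont.comp_triangle (by fun_prop) (by fun_prop) fun p hp => hp).mul
        (hφ.comp continuousOn_snd ?_)
      rintro ⟨s, r⟩ ⟨h1, h2, h3⟩
      exact ⟨h1, h2.trans h3⟩)
  obtain ⟨r1, r2⟩ := integral_rectangle_swap (m := fun y => K.p (x - y) d)
    (G := fun y r => K.γ y r d * φ r) hx.1 zero_le_one (hIx cp) (by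
      refine (K.continuousOn_γ_comp (by fun_prop) (by fun_prop) (by fun_prop) ?_).mul
        (hφ.comp continuousOn_snd fun p hp => hp.2)
      rintro ⟨s, r⟩ ⟨h1, h2⟩
      exact ⟨hsub h1, h2, hd⟩)
  obtain ⟨s1, s2⟩ := integral_triangle_swap (m := fun y => K.p (x - y) d)
    (G := fun y r => K.q (y - r) d * ψ r) hx.1 (hIx cp) (by
      refine (K.continuousOn_γ_comp (by fun_prop) (by fun_prop) (by fun_prop) ?_).mul
        (hψ.comp continuousOn_snd ?_)
      · rintro ⟨s, r⟩ ⟨h1, h2, h3⟩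
        dsimp only at *
        exact ⟨⟨by linarith, by linarith [hx.2]⟩, ⟨zero_le_one, le_rfl⟩, hd⟩
      · rintro ⟨s, r⟩ ⟨h1, h2, h3⟩
        exact hsub ⟨h1, h2.trans h3⟩)
  have cγφ : ContinuousOn (fun y => ∫ r in (0 : ℝ)..1, K.γ y r d * φ r) (Icc 0 1) := by
    refine continuousOn_paramIntegral (F := fun y r => K.γ y r d * φ r) continuousOn_const
      continuousOn_const (fun x hx => zero_le_one) ?_
    refine (K.continuousOn_γ_comp (by fun_prop) (by fun_prop) (by fun_prop) ?_).mul
      (hφ.comp continuousOn_snd ?_)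
    · rintro ⟨x, y⟩ ⟨h1, h2⟩
      exact ⟨h1, h2, hd⟩
    · rintro ⟨x, y⟩ ⟨h1, h2⟩
      exact h2
  have cqψ : ContinuousOn (fun y => d * ∫ r in (0 : ℝ)..y, K.q (y - r) d * ψ r) (Icc 0 1) := by
    have := (hψ.sub cγφ).sub (K.continuousOn_z hφ hψ hd)
    refine this.congr fun x _ => ?_
    simp [z]
  have e1 : ∫ y in (0 : ℝ)..1, K.η x y d * K.w φ y
      = ∫ r in (0 : ℝ)..1, (K.η x r d * φ r - ∫ s in r..1, K.η x s d * (K.k s r * φ r)) := by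
    simp only [w, mul_sub]
    rw [intervalIntegral.integral_sub (hI1 (cη.fun_mul hφ)) (hI1 (cη.fun_mul ckφ)), t2,
      intervalIntegral.integral_sub (hI1 (cη.fun_mul hφ)) t1]
  have e2 : ∫ y in (0 : ℝ)..x, K.p (x - y) d * K.z d φ ψ y
      = (∫ y in (0 : ℝ)..x, K.p (x - y) d * ψ y)
        - (∫ r in (0 : ℝ)..1, ∫ s in (0 : ℝ)..x, K.p (x - s) d * (K.γ s r d * φ r))
        - d * ∫ r in (0 : ℝ)..x, ∫ s in r..x, K.p (x - s) d * (K.q (s - r) d * ψ r) := by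
    rw [← r2, ← s2, ← intervalIntegral.integral_const_mul]
    rw [← intervalIntegral.integral_sub (hIx (cp.fun_mul (hψ.mono hsub)))
        (hIx (cp.fun_mul (cγφ.mono hsub))), ← intervalIntegral.integral_sub
        ((hIx (cp.fun_mul (hψ.mono hsub))).sub (hIx (cp.fun_mul (cγφ.mono hsub))))
        (by
          have := hIx (cp.fun_mul (cqψ.mono hsub))
          refine this.congr fun y _ => ?_
          ring)]
    refine intervalIntegral.integral_congr fun y _ => ?_
    simp only [z]; ring
  have e3 : ∫ r in (0 : ℝ)..1, K.γ x r d * φ r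
      = (∫ r in (0 : ℝ)..1, (K.η x r d * φ r - ∫ s in r..1, K.η x s d * (K.k s r * φ r)))
        - d * ∫ r in (0 : ℝ)..1, ∫ s in (0 : ℝ)..x, K.p (x - s) d * (K.γ s r d * φ r) := by
    rw [← intervalIntegral.integral_const_mul, ← intervalIntegral.integral_sub
      ((hI1 (cη.fun_mul hφ)).sub t1) (r1.const_mul d)]
    refine intervalIntegral.integral_congr fun r hr => ?_
    rw [uIcc_of_le zero_le_one] at hr
    rw [K.γ_eq_of_inverse hf hg hd hx hr]
    simp only [← mul_assoc, intervalIntegral.integral_mul_const]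
    ring
  have e4 : ∫ r in (0 : ℝ)..x, K.q (x - r) d * ψ r
      = (∫ r in (0 : ℝ)..x, K.p (x - r) d * ψ r)
        - d * ∫ r in (0 : ℝ)..x, ∫ s in r..x, K.p (x - s) d * (K.q (s - r) d * ψ r) := by
    rw [← intervalIntegral.integral_const_mul, ← intervalIntegral.integral_sub
      (hIx (cp.fun_mul (hψ.mono hsub))) (s1.const_mul d)]
    refine intervalIntegral.integral_congr fun r hr => ?_
    rw [uIcc_of_le hx.1] at hr
    rw [K.q_eq_of_inverse hf hg hd hr.1 hr.2 hx.2]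
    simp only [← mul_assoc, intervalIntegral.integral_mul_const]
    ring
  rw [e1, e2, z, e3, e4]
  ring

/-! ### Derivatives of `γ` and the functions `P₁`, `P₂` -/

theorem abs_γy_le {C x y d : ℝ} (hC : 0 ≤ C)
    (hl : ∀ y ∈ Icc (0 : ℝ) 1, ∀ y' ∈ Icc (0 : ℝ) 1, |K.γ x y d - K.γ x y' d| ≤ C * |y - y'|)
    (hy : y ∈ Ioo (0 : ℝ) 1) : |K.γy x y d| ≤ C :=
  norm_deriv_le_of_lipschitzOn (f := fun s => K.γ x s d) (C := ⟨C, hC⟩) (Icc_mem_nhds hy.1 hy.2)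
    (LipschitzOnWith.of_dist_le_mul fun a ha b hb => by
      rw [Real.dist_eq, Real.dist_eq]
      exact hl a ha b hb)

theorem exists_abs_γy_le {a b : ℝ} (ha : 0 < a) : ∃ C, 0 ≤ C ∧ ∀ x ∈ Icc (0 : ℝ) 1,
    ∀ y ∈ Ioo (0 : ℝ) 1, ∀ d ∈ Icc a b, |K.γy x y d| ≤ C := by
  obtain ⟨C, hC, hl⟩ := K.exists_lipschitz_γ (a := a) (b := b) ha
  refine ⟨C, hC, fun x hx y hy d hd => K.abs_γy_le hC (fun y hy y' hy' => ?_) hy⟩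
  simpa using hl x hx y hy d hd x hx y' hy' d hd

theorem intervalIntegrable_γy {x d : ℝ} (hx : x ∈ Icc (0 : ℝ) 1) (hd : 0 < d) :
    IntervalIntegrable (fun y => K.γy x y d) volume 0 1 := by
  obtain ⟨C, hC, hb⟩ := K.exists_abs_γy_le (a := d) (b := d) hd
  rw [intervalIntegrable_iff_integrableOn_Ioo_of_le zero_le_one]
  have hm : Measurable (fun y => K.γy x y d) := measurable_deriv _
  refine Integrable.of_bound hm.aestronglyMeasurable C ?_
  filter_upwards [ae_restrict_mem measurableSet_Ioo] with y hy using hb x hx y hy d ⟨le_rfl, le_rfl⟩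

theorem differentiableAt_γ_delay {x y d : ℝ} (hx : x ∈ Icc (0 : ℝ) 1) (hy : y ∈ Icc (0 : ℝ) 1)
    (hd : 0 < d) (hxy : y ≠ d * x) : DifferentiableAt ℝ (fun s => K.γ x y s) d := by
  have h1 := (K.γ_diff.differentiableOn (by norm_num)) (x, y, d) ⟨⟨hx, hy, hd⟩, hxy⟩
  have h2 : DifferentiableWithinAt ℝ (fun s => K.γ x y s) {s | 0 < s ∧ y ≠ s * x} d :=
    h1.comp d (f := fun s : ℝ => (x, y, s)) (by fun_prop) fun s hs => ⟨⟨hx, hy, hs.1⟩, hs.2⟩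
  refine h2.differentiableAt (IsOpen.mem_nhds ?_ ⟨hd, hxy⟩)
  exact (isOpen_lt continuous_const continuous_id).inter
    (isOpen_ne_fun continuous_const (by fun_prop))

theorem intervalIntegrable_γd {x d : ℝ} (hx : x ∈ Icc (0 : ℝ) 1) (hd : 0 < d) :
    IntervalIntegrable (fun y => K.γd x y d) volume 0 1 := by
  obtain ⟨C, hC, hl⟩ := K.exists_lipschitz_γ (a := d) (b := d + 1) hd
  refine (hasDerivWithinAt_integral (Φ := fun h y => K.γ x y (d + h)) (C := C) zero_le_one one_pos
    (fun h hh => ?_) (fun h hh y hy => ?_) ?_).1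
  · refine ContinuousOn.intervalIntegrable ?_
    rw [uIcc_of_le zero_le_one]
    exact K.continuousOn_γ_comp (by fun_prop) (by fun_prop) (by fun_prop) fun y hy =>
      ⟨hx, hy, by linarith [hh.1]⟩
  · have hy' := Ioo_subset_Icc_self hy
    have := hl x hx y hy' (d + h) ⟨by linarith [hh.1], by linarith [hh.2]⟩ x hx y hy' d
      ⟨le_rfl, by linarith⟩
    simpa [abs_of_pos hh.1] using this
  · filter_upwards [ae_ne (d * x)] with y hy hy'
    have h1 := (K.differentiableAt_γ_delay hx (Ioo_subset_Icc_self hy') hd hy).hasDerivAt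
    have h2 : HasDerivAt (fun h => K.γ x y (d + h)) (K.γd x y d) 0 := by
      refine HasDerivAt.comp_const_add d 0 ?_
      rw [add_zero]
      exact h1
    exact h2.hasDerivWithinAt

theorem intervalIntegrable_qd {x d : ℝ} (hx : x ∈ Icc (0 : ℝ) 1) (hd : 0 < d) :
    IntervalIntegrable (fun y => K.qd (x - y) d) volume 0 x := by
  obtain ⟨C, hC, hl⟩ := K.exists_lipschitz_γ (a := d) (b := d + 1) hd
  have h1 : (1 : ℝ) ∈ Icc (0 : ℝ) 1 := ⟨zero_le_one, le_rfl⟩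
  refine (hasDerivWithinAt_integral (Φ := fun h y => K.q (x - y) (d + h)) (C := C) hx.1 one_pos
    (fun h hh => ?_) (fun h hh y hy => ?_) ?_).1
  · refine ContinuousOn.intervalIntegrable ?_
    rw [uIcc_of_le hx.1]
    exact K.continuousOn_γ_comp (by fun_prop) (by fun_prop) (by fun_prop) fun y hy =>
      ⟨⟨by linarith [hy.2], by linarith [hy.1, hx.2]⟩, h1, by linarith [hh.1]⟩
  · have hy' : x - y ∈ Icc (0 : ℝ) 1 := ⟨by linarith [hy.2], by linarith [hy.1, hx.2]⟩
    have := hl (x - y) hy' 1 h1 (d + h) ⟨by linarith [hh.1], by linarith [hh.2]⟩ (x - y) hy' 1 h1 d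
      ⟨le_rfl, by linarith⟩
    simpa [abs_of_pos hh.1, q] using this
  · filter_upwards [ae_ne (x - 1 / d)] with y hy hy'
    have hy'' : x - y ∈ Icc (0 : ℝ) 1 := ⟨by linarith [hy'.2], by linarith [hy'.1, hx.2]⟩
    have h1 := (K.differentiableAt_γ_delay hy'' h1 hd (fun h => hy (by
      have : x - y = 1 / d := by rw [h]; field_simp
      linarith))).hasDerivAt
    have h2 : HasDerivAt (fun h => K.q (x - y) (d + h)) (K.qd (x - y) d) 0 := by
      refine HasDerivAt.comp_const_add d 0 ?_
      rw [add_zero]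
      exact h1
    exact h2.hasDerivWithinAt

/-- The density of the functional `φ ↦ P₁` in the original plant state. -/
noncomputable def P₁Density (d x y : ℝ) : ℝ := -K.γy x y d + ∫ s in y..1, f s y * K.γ x s d

/-- `P₁` as a functional of the original plant state. -/
noncomputable def P₁Plant (d : ℝ) (φ : ℝ → ℝ) (x : ℝ) : ℝ :=
  K.q x d * φ 1 + ∫ y in (0 : ℝ)..1, K.P₁Density d x y * φ y

/-- The derivative of `-z` with respect to the delay estimate. -/
noncomputable def P₂ (d : ℝ) (φ ψ : ℝ → ℝ) (x : ℝ) : ℝ :=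
  (∫ y in (0 : ℝ)..1, K.γd x y d * φ y)
    + ∫ y in (0 : ℝ)..x, (K.q (x - y) d + d * K.qd (x - y) d) * ψ y

theorem continuousOn_integral_f_γ (hf : ContinuousOn (fun p : ℝ × ℝ => f p.1 p.2) triangle)
    {x d : ℝ} (hx : x ∈ Icc (0 : ℝ) 1) (hd : 0 < d) :
    ContinuousOn (fun y => ∫ s in y..1, f s y * K.γ x s d) (Icc 0 1) := by
  refine continuousOn_paramIntegral (F := fun y s => f s y * K.γ x s d) continuousOn_id
    continuousOn_const (fun y hy => hy.2) ?_
  refine (hf.comp_triangle (by fun_prop) (by fun_prop) ?_).mul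
    (K.continuousOn_γ_comp (by fun_prop) (by fun_prop) (by fun_prop) ?_)
  · rintro ⟨y, s⟩ ⟨h1, h2, h3⟩
    exact ⟨h1.1, h2, h3⟩
  · rintro ⟨y, s⟩ ⟨h1, h2, h3⟩
    exact ⟨hx, ⟨le_trans h1.1 h2, h3⟩, hd⟩

theorem intervalIntegrable_P₁Density
    (hf : ContinuousOn (fun p : ℝ × ℝ => f p.1 p.2) triangle) {x d : ℝ}
    (hx : x ∈ Icc (0 : ℝ) 1) (hd : 0 < d) :
    IntervalIntegrable (K.P₁Density d x) volume 0 1 := by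
  refine (K.intervalIntegrable_γy hx hd).neg.add (ContinuousOn.intervalIntegrable ?_)
  rw [uIcc_of_le zero_le_one]
  exact K.continuousOn_integral_f_γ hf hx hd

theorem z_zero_eq_w_one {d : ℝ} (hd : 0 < d) {φ ψ : ℝ → ℝ} (hbc : φ 1 = ψ 0) :
    K.z d φ ψ 0 = K.w φ 1 := by
  have : ∫ y in (0 : ℝ)..1, K.γ 0 y d * φ y = ∫ y in (0 : ℝ)..1, K.k 1 y * φ y := by
    refine intervalIntegral.integral_congr fun y hy => ?_
    rw [uIcc_of_le zero_le_one] at hy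
    simp only [K.γ_init d hd y hy]
  simp [z, w, this, hbc]

/-- `M₂` is the density of `P₁` after the plant state is expressed through `w`. -/
theorem M₂_eq (hf : ContinuousOn (fun p : ℝ × ℝ => f p.1 p.2) triangle) {x y d : ℝ}
    (hx : x ∈ Icc (0 : ℝ) 1) (hy : y ∈ Icc (0 : ℝ) 1) (hd : 0 < d) :
    K.M₂ x y d = K.q x d * K.l 1 y + K.P₁Density d x y
      + ∫ ξ in y..1, K.P₁Density d x ξ * K.l ξ y := by
  have hsub : Icc y 1 ⊆ Icc (0 : ℝ) 1 := Icc_subset_Icc_left hy.1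
  have cl : ContinuousOn (fun ξ => K.l ξ y) (Icc y 1) :=
    K.l_cont.comp_triangle (by fun_prop) (by fun_prop) fun ξ hξ => ⟨hy.1, hξ.1, hξ.2⟩
  have cf : ContinuousOn (fun ξ => f ξ y) (Icc y 1) :=
    hf.comp_triangle (by fun_prop) (by fun_prop) fun ξ hξ => ⟨hy.1, hξ.1, hξ.2⟩
  have cγ : ContinuousOn (fun ξ => K.γ x ξ d) (Icc y 1) :=
    K.continuousOn_γ_comp (by fun_prop) (by fun_prop) (by fun_prop)
      fun ξ hξ => ⟨hx, hsub hξ, hd⟩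
  have hI : ∀ {φ : ℝ → ℝ}, ContinuousOn φ (Icc y 1) → IntervalIntegrable φ volume y 1 :=
    fun h => by
      refine ContinuousOn.intervalIntegrable ?_
      rwa [uIcc_of_le hy.2]
  have i1 : IntervalIntegrable (fun ξ => -K.γy x ξ d * K.l ξ y) volume y 1 := by
    refine IntervalIntegrable.mul_continuousOn ?_ (by rwa [uIcc_of_le hy.2])
    refine ((K.intervalIntegrable_γy hx hd).neg).mono_set ?_
    rw [uIcc_of_le hy.2, uIcc_of_le zero_le_one]
    exact hsub
  have c2 : ContinuousOn (fun ξ => (∫ s in ξ..1, f s ξ * K.γ x s d) * K.l ξ y) (Icc y 1) :=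
    ((K.continuousOn_integral_f_γ hf hx hd).mono hsub).mul cl
  have e1 : ∀ ξ, ∫ s in ξ..1, K.γ x s d * f s ξ * K.l ξ y
      = (∫ s in ξ..1, f s ξ * K.γ x s d) * K.l ξ y := fun ξ => by
    rw [intervalIntegral.integral_mul_const]
    simp only [mul_comm]
  have e2 : ∫ ξ in y..1, (-K.γy x ξ d * K.l ξ y + K.γ x ξ d * f ξ y
      + ∫ s in ξ..1, K.γ x s d * f s ξ * K.l ξ y)
      = (∫ ξ in y..1, f ξ y * K.γ x ξ d) + ∫ ξ in y..1, K.P₁Density d x ξ * K.l ξ y := by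
    simp only [e1, P₁Density, add_mul]
    rw [intervalIntegral.integral_add (i1.add (hI (cγ.fun_mul cf))) (hI c2),
      intervalIntegral.integral_add i1 (hI (cγ.fun_mul cf)),
      intervalIntegral.integral_add i1 (hI c2)]
    simp only [mul_comm (K.γ _ _ _)]
    ring
  rw [M₂, e2, P₁Density, q]
  ring

/-- The perturbation `P₁`, which is defined through the transformed state, in the original state.
The boundary condition `u(1, t) = v(0, t)` enters through `z(0, t) = w(1, t)`. -/
theorem P₁_eq_P₁Plant (hf : ContinuousOn (fun p : ℝ × ℝ => f p.1 p.2) triangle) {d : ℝ}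
    (hd : 0 < d) {φ ψ : ℝ → ℝ} (hφ : ContinuousOn φ (Icc 0 1)) (hbc : φ 1 = ψ 0) {x : ℝ}
    (hx : x ∈ Icc (0 : ℝ) 1) : K.P₁ d φ ψ x = K.P₁Plant d φ x := by
  have hw := K.continuousOn_w hφ
  have hm := K.intervalIntegrable_P₁Density hf hx hd
  have h01 : uIcc (0 : ℝ) 1 = Icc 0 1 := uIcc_of_le zero_le_one
  have cl : ContinuousOn (fun y => K.l 1 y) (Icc 0 1) :=
    K.l_cont.comp_triangle (by fun_prop) (by fun_prop) fun ξ hξ => ⟨hξ.1, hξ.2, le_rfl⟩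
  have clw : ContinuousOn (fun x => ∫ y in (0 : ℝ)..x, K.l x y * K.w φ y) (Icc 0 1) := by
    refine (hφ.sub hw).congr fun x hx => ?_
    simp only [Pi.sub_apply]
    rw [K.eq_w_add hf hφ hx]; ring
  obtain ⟨t1, t2⟩ := integral_triangle_swap (m := K.P₁Density d x)
    (G := fun y r => K.l y r * K.w φ r) zero_le_one hm (by
      refine (K.l_cont.comp_triangle (by fun_prop) (by fun_prop) fun p hp => hp).mul
        (hw.comp continuousOn_snd ?_)
      rintro ⟨s, r⟩ ⟨h1, h2, h3⟩
      exact ⟨h1, h2.trans h3⟩)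
  have i1 : IntervalIntegrable (fun y => K.P₁Density d x y * K.w φ y) volume 0 1 :=
    hm.mul_continuousOn (by rwa [h01])
  have i2 : IntervalIntegrable (fun y => K.P₁Density d x y
      * ∫ r in (0 : ℝ)..y, K.l y r * K.w φ r) volume 0 1 :=
    hm.mul_continuousOn (by rwa [h01])
  have i3 : IntervalIntegrable (fun y => K.l 1 y * K.w φ y) volume 0 1 := by
    refine ContinuousOn.intervalIntegrable ?_
    rw [h01]; exact cl.mul hw
  have e1 : ∫ y in (0 : ℝ)..1, K.P₁Density d x y * φ y
      = (∫ y in (0 : ℝ)..1, K.P₁Density d x y * K.w φ y)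
        + ∫ r in (0 : ℝ)..1, ∫ s in r..1, K.P₁Density d x s * (K.l s r * K.w φ r) := by
    rw [← t2, ← intervalIntegral.integral_add i1 i2]
    refine intervalIntegral.integral_congr fun y hy => ?_
    rw [h01] at hy
    rw [K.eq_w_add hf hφ hy]; ring
  have e2 : ∫ y in (0 : ℝ)..1, K.w φ y * K.M₂ x y d
      = K.q x d * (∫ y in (0 : ℝ)..1, K.l 1 y * K.w φ y)
        + (∫ y in (0 : ℝ)..1, K.P₁Density d x y * K.w φ y)
        + ∫ r in (0 : ℝ)..1, ∫ s in r..1, K.P₁Density d x s * (K.l s r * K.w φ r) := by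
    rw [← intervalIntegral.integral_const_mul, ← intervalIntegral.integral_add (i3.const_mul _) i1,
      ← intervalIntegral.integral_add ((i3.const_mul _).add i1) t1]
    refine intervalIntegral.integral_congr fun y hy => ?_
    rw [h01] at hy
    rw [K.M₂_eq hf hx hy hd]
    simp only [← mul_assoc, intervalIntegral.integral_mul_const]
    ring
  rw [P₁, P₁Plant, e1, e2, K.z_zero_eq_w_one hd hbc,
    K.eq_w_add hf hφ (x := 1) ⟨zero_le_one, le_rfl⟩, M₁, q]
  ring

/-- The perturbation `P₂` in the transformed state, with the kernels `M₃` and `M₄`. -/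
theorem P₂_eq (hf : ContinuousOn (fun p : ℝ × ℝ => f p.1 p.2) triangle)
    (hg : ContinuousOn g (Icc 0 1)) {d : ℝ} (hd : 0 < d) {φ ψ : ℝ → ℝ}
    (hφ : ContinuousOn φ (Icc 0 1)) (hψ : ContinuousOn ψ (Icc 0 1)) {x : ℝ}
    (hx : x ∈ Icc (0 : ℝ) 1) :
    K.P₂ d φ ψ x = (∫ y in (0 : ℝ)..x, K.z d φ ψ y * K.M₃ x y d)
      + ∫ y in (0 : ℝ)..1, K.w φ y * K.M₄ x y d := by
  have hw := K.continuousOn_w hφ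
  have hz := K.continuousOn_z hφ hψ hd
  have h01 : uIcc (0 : ℝ) 1 = Icc 0 1 := uIcc_of_le zero_le_one
  have h0x : uIcc (0 : ℝ) x = Icc 0 x := uIcc_of_le hx.1
  have hsub : Icc 0 x ⊆ Icc (0 : ℝ) 1 := Icc_subset_Icc_right hx.2
  have hγd := K.intervalIntegrable_γd hx hd
  have hqd := K.intervalIntegrable_qd hx hd
  have h1m : (1 : ℝ) ∈ Icc (0 : ℝ) 1 := ⟨zero_le_one, le_rfl⟩
  have hq : IntervalIntegrable (fun y => K.q (x - y) d) volume 0 x := by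
    refine ContinuousOn.intervalIntegrable ?_
    rw [h0x]
    exact K.continuousOn_γ_comp (by fun_prop) (by fun_prop) (by fun_prop) fun y hy =>
      ⟨⟨by linarith [hy.2], by linarith [hy.1, hx.2]⟩, h1m, hd⟩
  set Q : ℝ → ℝ := fun y => K.q (x - y) d + d * K.qd (x - y) d with hQdef
  have hQ : IntervalIntegrable Q volume 0 x := hq.add (hqd.const_mul d)
  have cηc : ContinuousOn (fun p : ℝ × ℝ => K.η p.1 p.2 d * K.w φ p.2) (Icc 0 x ×ˢ Icc 0 1) :=
    (K.continuousOn_η_comp (by fun_prop) (by fun_prop) (by fun_prop) fun p hp =>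
      ⟨hsub hp.1, hp.2, hd⟩).mul (hw.comp continuousOn_snd fun p hp => hp.2)
  have cpc : ContinuousOn (fun p : ℝ × ℝ => K.p (p.1 - p.2) d * K.z d φ ψ p.2)
      {q | 0 ≤ q.2 ∧ q.2 ≤ q.1 ∧ q.1 ≤ x} := by
    refine (K.continuousOn_η_comp (by fun_prop) (by fun_prop) (by fun_prop) ?_).mul
      (hz.comp continuousOn_snd fun p hp => hsub ⟨hp.1, hp.2.1.trans hp.2.2⟩)
    rintro ⟨ξ, y⟩ ⟨h1, h2, h3⟩
    dsimp only at *
    exact ⟨⟨by linarith, by linarith [hx.2]⟩, h1m, hd⟩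
  have clw : ContinuousOn (fun x => ∫ y in (0 : ℝ)..x, K.l x y * K.w φ y) (Icc 0 1) := by
    refine (hφ.sub hw).congr fun x hx => ?_
    simp only [Pi.sub_apply]
    rw [K.eq_w_add hf hφ hx]; ring
  have cηw : ContinuousOn (fun ξ => ∫ y in (0 : ℝ)..1, K.η ξ y d * K.w φ y) (Icc 0 x) :=
    continuousOn_paramIntegral (F := fun ξ y => K.η ξ y d * K.w φ y) continuousOn_const
      continuousOn_const (fun _ _ => zero_le_one) cηc
  have cpz : ContinuousOn (fun ξ => ∫ y in (0 : ℝ)..ξ, K.p (ξ - y) d * K.z d φ ψ y) (Icc 0 x) :=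
    continuousOn_paramIntegral (F := fun ξ y => K.p (ξ - y) d * K.z d φ ψ y) continuousOn_const
      continuousOn_id (fun ξ hξ => hξ.1) (cpc.mono fun p hp => ⟨hp.2.1, hp.2.2, hp.1.2⟩)
  obtain ⟨a1, a2⟩ := integral_triangle_swap (m := fun ξ => K.γd x ξ d)
    (G := fun y r => K.l y r * K.w φ r) zero_le_one hγd (by
      refine (K.l_cont.comp_triangle (by fun_prop) (by fun_prop) fun p hp => hp).mul
        (hw.comp continuousOn_snd ?_)
      rintro ⟨s, r⟩ ⟨h1, h2, h3⟩
      exact ⟨h1, h2.trans h3⟩)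
  obtain ⟨r1, r2⟩ := integral_rectangle_swap (m := Q) (G := fun ξ y => K.η ξ y d * K.w φ y)
    hx.1 zero_le_one hQ cηc
  obtain ⟨s1, s2⟩ := integral_triangle_swap (m := Q)
    (G := fun ξ y => K.p (ξ - y) d * K.z d φ ψ y) hx.1 hQ cpc
  have i1 : IntervalIntegrable (fun y => K.γd x y d * K.w φ y) volume 0 1 :=
    hγd.mul_continuousOn (by rwa [h01])
  have i2 : IntervalIntegrable (fun y => Q y * K.z d φ ψ y) volume 0 x :=
    hQ.mul_continuousOn (by rw [h0x]; exact hz.mono hsub)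
  have e1 : ∫ y in (0 : ℝ)..1, K.γd x y d * φ y
      = (∫ y in (0 : ℝ)..1, K.γd x y d * K.w φ y)
        + ∫ r in (0 : ℝ)..1, ∫ s in r..1, K.γd x s d * (K.l s r * K.w φ r) := by
    rw [← a2, ← intervalIntegral.integral_add i1 (hγd.mul_continuousOn (by rwa [h01]))]
    refine intervalIntegral.integral_congr fun y hy => ?_
    rw [h01] at hy
    rw [K.eq_w_add hf hφ hy]; ring
  have e2 : ∫ y in (0 : ℝ)..x, Q y * ψ y = (∫ y in (0 : ℝ)..x, Q y * K.z d φ ψ y)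
      + (∫ r in (0 : ℝ)..1, ∫ s in (0 : ℝ)..x, Q s * (K.η s r d * K.w φ r))
      + d * ∫ r in (0 : ℝ)..x, ∫ s in r..x, Q s * (K.p (s - r) d * K.z d φ ψ r) := by
    rw [← r2, ← s2, ← intervalIntegral.integral_const_mul,
      ← intervalIntegral.integral_add i2 (hQ.mul_continuousOn (by rwa [h0x])),
      ← intervalIntegral.integral_add (i2.add (hQ.mul_continuousOn (by rwa [h0x])))
        ((hQ.mul_continuousOn (by rwa [h0x])).const_mul d)]
    refine intervalIntegral.integral_congr fun y hy => ?_
    rw [h0x] at hy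
    rw [K.eq_z_add hf hg hd hφ hψ (hsub hy)]; ring
  -- splitting `Q` in the kernels `M₃` and `M₄`
  have hQsplit : ∀ {a : ℝ} {θ : ℝ → ℝ}, a ∈ Icc 0 x → ContinuousOn θ (Icc a x) →
      ∫ ξ in a..x, Q ξ * θ ξ = (∫ ξ in a..x, K.q (x - ξ) d * θ ξ)
        + d * ∫ ξ in a..x, K.qd (x - ξ) d * θ ξ := by
    intro a θ ha hθ
    have hss : uIcc a x ⊆ uIcc 0 x := by
      rw [h0x, uIcc_of_le ha.2]; exact Icc_subset_Icc_left ha.1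
    rw [← intervalIntegral.integral_const_mul, ← intervalIntegral.integral_add
      ((hq.mono_set hss).mul_continuousOn (by rwa [uIcc_of_le ha.2]))
      (((hqd.mono_set hss).mul_continuousOn (by rwa [uIcc_of_le ha.2])).const_mul d)]
    refine intervalIntegral.integral_congr fun ξ _ => ?_
    simp only [hQdef]; ring
  have e3 : ∫ y in (0 : ℝ)..x, K.z d φ ψ y * K.M₃ x y d = (∫ y in (0 : ℝ)..x, Q y * K.z d φ ψ y)
      + d * ∫ r in (0 : ℝ)..x, ∫ s in r..x, Q s * (K.p (s - r) d * K.z d φ ψ r) := by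
    rw [← intervalIntegral.integral_const_mul, ← intervalIntegral.integral_add i2 (s1.const_mul d)]
    refine intervalIntegral.integral_congr fun y hy => ?_
    rw [h0x] at hy
    have := hQsplit (θ := fun s => K.p (s - y) d) hy
      (K.continuousOn_η_comp (by fun_prop) (by fun_prop) (by fun_prop) fun s hs =>
        ⟨⟨by linarith [hs.1], by linarith [hs.2, hx.2, hy.1]⟩, h1m, hd⟩)
    simp only [← mul_assoc, intervalIntegral.integral_mul_const]
    rw [this, M₃]
    simp only [hQdef]
    ring
  have e4 : ∫ y in (0 : ℝ)..1, K.w φ y * K.M₄ x y d = (∫ y in (0 : ℝ)..1, K.γd x y d * K.w φ y)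
      + (∫ r in (0 : ℝ)..1, ∫ s in r..1, K.γd x s d * (K.l s r * K.w φ r))
      + ∫ r in (0 : ℝ)..1, ∫ s in (0 : ℝ)..x, Q s * (K.η s r d * K.w φ r) := by
    rw [← intervalIntegral.integral_add i1 a1, ← intervalIntegral.integral_add (i1.add a1) r1]
    refine intervalIntegral.integral_congr fun y hy => ?_
    rw [h01] at hy
    have := hQsplit (θ := fun s => K.η s y d) ⟨le_rfl, hx.1⟩
      (K.continuousOn_η_comp (by fun_prop) (by fun_prop) (by fun_prop) fun s hs =>
        ⟨hsub hs, hy, hd⟩)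
    simp only [← mul_assoc, intervalIntegral.integral_mul_const]
    rw [this, M₄]
    ring
  rw [P₂, e1, e2, e3, e4]
  ring

end Kernels

/-! ### The closed loop along characteristics -/

/-- The derivative `u_t - u_x` of the plant state along its characteristics. -/
noncomputable def uRate (f : ℝ → ℝ → ℝ) (g : ℝ → ℝ) (u : ℝ → ℝ → ℝ)
    (x t : ℝ) : ℝ :=
  g x * u 0 t + ∫ y in (0 : ℝ)..x, f x y * u y t

namespace IsClosedLoopSolution

variable {f : ℝ → ℝ → ℝ} {g : ℝ → ℝ} {K : Kernels f g} {Dlo Dhi b₁ θ D : ℝ}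
  {u v : ℝ → ℝ → ℝ} {Dhat : ℝ → ℝ}

theorem u_comp (sol : IsClosedLoopSolution f g K Dlo Dhi b₁ θ D u v Dhat) {X : Type*}
    [TopologicalSpace X] {S : Set X} {a b : X → ℝ} (ha : ContinuousOn a S) (hb : ContinuousOn b S)
    (hab : ∀ p ∈ S, a p ∈ Icc (0 : ℝ) 1 ∧ 0 ≤ b p) : ContinuousOn (fun p => u (a p) (b p)) S :=
  sol.u_cont.comp (ha.prodMk hb) hab

theorem v_comp (sol : IsClosedLoopSolution f g K Dlo Dhi b₁ θ D u v Dhat) {X : Type*}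
    [TopologicalSpace X] {S : Set X} {a b : X → ℝ} (ha : ContinuousOn a S) (hb : ContinuousOn b S)
    (hab : ∀ p ∈ S, a p ∈ Icc (0 : ℝ) 1 ∧ 0 ≤ b p) : ContinuousOn (fun p => v (a p) (b p)) S :=
  sol.v_cont.comp (ha.prodMk hb) hab

theorem u_slice (sol : IsClosedLoopSolution f g K Dlo Dhi b₁ θ D u v Dhat) {t : ℝ} (ht : 0 ≤ t) :
    ContinuousOn (fun y => u y t) (Icc 0 1) :=
  sol.u_comp (by fun_prop) (by fun_prop) fun _ hy => ⟨hy, ht⟩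

theorem v_slice (sol : IsClosedLoopSolution f g K Dlo Dhi b₁ θ D u v Dhat) {t : ℝ} (ht : 0 ≤ t) :
    ContinuousOn (fun y => v y t) (Icc 0 1) :=
  sol.v_comp (by fun_prop) (by fun_prop) fun _ hy => ⟨hy, ht⟩

theorem continuousOn_uRate (sol : IsClosedLoopSolution f g K Dlo Dhi b₁ θ D u v Dhat)
    (hf : ContinuousOn (fun p : ℝ × ℝ => f p.1 p.2) triangle) (hg : ContinuousOn g (Icc 0 1)) :
    ContinuousOn (fun p : ℝ × ℝ => uRate f g u p.1 p.2) (Icc 0 1 ×ˢ Ici 0) := by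
  refine ((hg.comp continuousOn_fst fun p hp => hp.1).mul (sol.u_comp (by fun_prop) (by fun_prop)
    fun p hp => ⟨⟨le_rfl, zero_le_one⟩, hp.2⟩)).add (continuousOn_paramIntegral
    (F := fun (p : ℝ × ℝ) y => f p.1 y * u y p.2) continuousOn_const continuousOn_fst
    (fun p hp => hp.1.1) ?_)
  refine (hf.comp_triangle (by fun_prop) (by fun_prop) ?_).mul
    (sol.u_comp (by fun_prop) (by fun_prop) ?_)
  · rintro ⟨⟨x, t⟩, y⟩ ⟨⟨h1, h2⟩, h3, h4⟩
    exact ⟨h3, h4, h1.2⟩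
  · rintro ⟨⟨x, t⟩, y⟩ ⟨⟨h1, h2⟩, h3, h4⟩
    exact ⟨⟨h3, le_trans h4 h1.2⟩, h2⟩

theorem hasDerivAt_u_characteristic (sol : IsClosedLoopSolution f g K Dlo Dhi b₁ θ D u v Dhat)
    {x t h : ℝ} (hx : x ≤ 1) (ht : 0 ≤ t) (h0 : 0 < h) (hhx : h < x) :
    HasDerivAt (fun h => u (x - h) (t + h)) (uRate f g u (x - h) (t + h)) h := by
  have h1 := sol.u_pde (x - h) ⟨by linarith, by linarith⟩ (t + h) (by linarith)
  have h2 : HasDerivAt (fun s => u (x - h - s) (t + h + s)) (uRate f g u (x - h) (t + h))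
      (h - h) := by
    rw [sub_self]; exact h1
  have h3 := HasDerivAt.comp_sub_const h h h2
  refine h3.congr_of_eventuallyEq (Eventually.of_forall fun s => ?_)
  simp only
  ring_nf

theorem hasDerivWithinAt_u_characteristic
    (sol : IsClosedLoopSolution f g K Dlo Dhi b₁ θ D u v Dhat)
    (hf : ContinuousOn (fun p : ℝ × ℝ => f p.1 p.2) triangle) (hg : ContinuousOn g (Icc 0 1))
    {x t : ℝ} (hx0 : 0 < x) (hx : x ≤ 1) (ht : 0 ≤ t) :
    HasDerivWithinAt (fun h => u (x - h) (t + h)) (uRate f g u x t) (Ici 0) 0 := by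
  have hm : ∀ h ∈ Icc 0 x, (x - h, t + h) ∈ Icc (0 : ℝ) 1 ×ˢ Ici (0 : ℝ) := fun h hh =>
    ⟨⟨by dsimp only; linarith [hh.2], by dsimp only; linarith [hh.1]⟩,
      show 0 ≤ t + h by linarith [hh.1]⟩
  have := hasDerivWithinAt_Ici_of_interior (φ := fun h => u (x - h) (t + h))
    (ψ := fun h => uRate f g u (x - h) (t + h)) hx0
    (sol.u_cont.comp (f := fun h => (x - h, t + h)) (by fun_prop) hm)
    ((sol.continuousOn_uRate hf hg).comp (f := fun h => (x - h, t + h)) (by fun_prop) hm)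
    (fun h hh => sol.hasDerivAt_u_characteristic hx ht hh.1 hh.2)
  simpa using this

theorem exists_lipschitz_u (sol : IsClosedLoopSolution f g K Dlo Dhi b₁ θ D u v Dhat)
    (hf : ContinuousOn (fun p : ℝ × ℝ => f p.1 p.2) triangle) (hg : ContinuousOn g (Icc 0 1))
    (T : ℝ) : ∃ C, 0 ≤ C ∧ ∀ x t h, 0 ≤ h → h ≤ x → x ≤ 1 → 0 ≤ t → t + h ≤ T →
      |u (x - h) (t + h) - u x t| ≤ C * h := by
  obtain ⟨C, hC0, hC⟩ := exists_bound_of_isCompact (isCompact_Icc.prod (isCompact_Icc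
    (a := (0 : ℝ)) (b := T))) ((sol.continuousOn_uRate hf hg).mono
      (prod_mono_right Icc_subset_Ici_self))
  refine ⟨C, hC0, fun x t h h0 hhx hx ht hT => ?_⟩
  have := abs_sub_le_mul_of_right_deriv (φ := fun h => u (x - h) (t + h)) (C := C) h0
    (sol.u_comp (by fun_prop) (by fun_prop) fun r hr => ⟨⟨by linarith [hr.2], by linarith [hr.1]⟩,
      by linarith [hr.1]⟩)
    (fun r hr => (sol.hasDerivAt_u_characteristic hx ht hr.1
      (hr.2.trans_le hhx)).hasDerivWithinAt)
    (fun r hr => hC (x - r, t + r) ⟨⟨by dsimp only; linarith [hr.2],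
      by dsimp only; linarith [hr.1]⟩,
      ⟨by dsimp only; linarith [hr.1], by dsimp only; linarith [hr.2]⟩⟩)
  simpa using this

theorem v_characteristic (sol : IsClosedLoopSolution f g K Dlo Dhi b₁ θ D u v Dhat) (hD : 0 < D)
    {x t h : ℝ} (h0 : 0 ≤ h) (hhx : h ≤ x) (hx : x ≤ 1) (ht : 0 ≤ t) :
    v (x - h) (t + D * h) = v x t := by
  have hDr : ∀ r, 0 ≤ r → 0 ≤ D * r := fun r hr => mul_nonneg hD.le hr
  have := abs_sub_le_mul_of_right_deriv (φ := fun h => v (x - h) (t + D * h)) (φ' := fun _ => 0)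
    (C := 0) h0
    (sol.v_comp (by fun_prop) (by fun_prop) fun r hr => ⟨⟨by linarith [hr.2], by linarith [hr.1]⟩,
      by linarith [hDr r hr.1]⟩)
    (fun r hr => by
      have h1 := sol.v_pde (x - r) ⟨by linarith [hr.2], by linarith [hr.1]⟩ (t + D * r)
        (by have := mul_pos hD hr.1; linarith)
      refine hasDerivWithinAt_Ici_shift (h1.hasDerivWithinAt.congr_of_eventuallyEq ?_ ?_)
      · filter_upwards with s
        ring_nf
      · simp)
    (fun r _ => by simp)
  simp only [sub_zero, mul_zero, zero_mul, add_zero] at this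
  linarith [abs_nonpos_iff.1 this]

/-! ### The transformed plant state -/

theorem continuousOn_w (sol : IsClosedLoopSolution f g K Dlo Dhi b₁ θ D u v Dhat) :
    ContinuousOn (fun p : ℝ × ℝ => K.w (fun y => u y p.2) p.1) (Icc 0 1 ×ˢ Ici 0) := by
  refine sol.u_cont.sub (continuousOn_paramIntegral
    (F := fun (p : ℝ × ℝ) y => K.k p.1 y * u y p.2) continuousOn_const continuousOn_fst
    (fun p hp => hp.1.1) ?_)
  refine (K.k_cont.comp_triangle (by fun_prop) (by fun_prop) ?_).mul
    (sol.u_comp (by fun_prop) (by fun_prop) ?_)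
  · rintro ⟨⟨x, t⟩, y⟩ ⟨⟨h1, h2⟩, h3, h4⟩
    exact ⟨h3, h4, h1.2⟩
  · rintro ⟨⟨x, t⟩, y⟩ ⟨⟨h1, h2⟩, h3, h4⟩
    exact ⟨⟨h3, le_trans h4 h1.2⟩, h2⟩

theorem hasDerivWithinAt_w (sol : IsClosedLoopSolution f g K Dlo Dhi b₁ θ D u v Dhat)
    (hf : ContinuousOn (fun p : ℝ × ℝ => f p.1 p.2) triangle) (hg : ContinuousOn g (Icc 0 1))
    {x t : ℝ} (hx0 : 0 < x) (hx : x ≤ 1) (ht : 0 ≤ t) :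
    HasDerivWithinAt (fun h => K.w (fun y => u y (t + h)) (x - h)) 0 (Ici 0) 0 := by
  obtain ⟨hkd, Ck, hCk, hkl⟩ := K.k_transport hf
  obtain ⟨Cu, hCu, hul⟩ := sol.exists_lipschitz_u hf hg (t + x)
  obtain ⟨Bk, hBk, hk⟩ := exists_bound_of_isCompact isCompact_triangle K.k_cont
  obtain ⟨Bu, hBu, hu⟩ := exists_bound_of_isCompact (isCompact_Icc.prod (isCompact_Icc
    (a := (0 : ℝ)) (b := t + x))) (sol.u_cont.mono (prod_mono_right Icc_subset_Ici_self))
  have hIx : ∀ {φ : ℝ → ℝ}, ContinuousOn φ (Icc 0 x) → IntervalIntegrable φ volume 0 x :=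
    fun h => by
      refine ContinuousOn.intervalIntegrable ?_
      rwa [uIcc_of_le hx0.le]
  have ck : ContinuousOn (fun y => K.k x y) (Icc 0 x) :=
    K.k_cont.comp_triangle (by fun_prop) (by fun_prop) fun y hy => ⟨hy.1, hy.2, hx⟩
  have cu : ContinuousOn (fun y => u y t) (Icc 0 x) :=
    (sol.u_slice ht).mono (Icc_subset_Icc_right hx)
  have cg : ContinuousOn g (Icc 0 x) := hg.mono (Icc_subset_Icc_right hx)
  have cf : ContinuousOn (fun y => f x y) (Icc 0 x) :=
    hf.comp_triangle (by fun_prop) (by fun_prop) fun y hy => ⟨hy.1, hy.2, hx⟩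
  have hmov := hasDerivWithinAt_integral_moving_left
    (Φ := fun h y => K.k (x - h) (y - h) * u (y - h) (t + h))
    (D := fun y => -K.kRate x y * u y t + K.k x y * uRate f g u y t)
    (a := 0) (b := x) (c := 1) (δ := x) (C := Ck * Bu + Bk * Cu) hx0 zero_le_one hx0 (by simp)
    (by positivity)
    (by simpa using! ck.fun_mul cu)
    (fun h hh => by
      refine ContinuousOn.intervalIntegrable ?_
      rw [uIcc_of_le (by linarith [hh.2])]
      refine (K.k_cont.comp_triangle (by fun_prop) (by fun_prop) ?_).mul
        (sol.u_comp (by fun_prop) (by fun_prop) ?_)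
      · exact fun y hy => ⟨by linarith [hy.1], by linarith [hy.2], by linarith [hh.1]⟩
      · exact fun y hy => ⟨⟨by linarith [hy.1], by linarith [hy.2, hh.1]⟩, by linarith [hh.1]⟩)
    (fun h hh y hy => by
      have hy1 : h < y := by linarith [hy.1]
      have e1 := hkl x y h hh.1.le hy1.le hy.2 hx
      have e2 := hul y t h hh.1.le hy1.le (hy.2.le.trans hx) ht (by linarith [hh.2])
      have e3 := hu (y - h, t + h) ⟨⟨by dsimp only; linarith, by dsimp only; linarith [hy.2, hh.1]⟩,
        ⟨by dsimp only; linarith [hh.1], by dsimp only; linarith [hh.2]⟩⟩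
      have e4 := hk (x, y) ⟨by dsimp only; linarith [hh.1], hy.2.le, hx⟩
      dsimp only at e3 e4 ⊢
      simp only [sub_zero, add_zero]
      calc |K.k (x - h) (y - h) * u (y - h) (t + h) - K.k x y * u y t|
          = |(K.k (x - h) (y - h) - K.k x y) * u (y - h) (t + h)
            + K.k x y * (u (y - h) (t + h) - u y t)| := by ring_nf
        _ ≤ |K.k (x - h) (y - h) - K.k x y| * |u (y - h) (t + h)|
            + |K.k x y| * |u (y - h) (t + h) - u y t| := by
            rw [← abs_mul, ← abs_mul]; exact abs_add_le _ _
        _ ≤ (Ck * h) * Bu + Bk * (Cu * h) := by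
            have := hh.1.le
            gcongr
        _ = (Ck * Bu + Bk * Cu) * h := by ring)
    (Eventually.of_forall fun y hy => by
      have e1 := hkd x y hy.1 hy.2 hx
      have e2 := sol.hasDerivWithinAt_u_characteristic hf hg hy.1 (hy.2.le.trans hx) ht
      simpa using! e1.fun_mul e2)
  obtain ⟨t1, t2⟩ := integral_triangle_swap (m := fun y => K.k x y)
    (G := fun s y => f s y * u y t) hx0.le (hIx ck) (by
      refine (hf.comp_triangle (by fun_prop) (by fun_prop) ?_).mul
        (sol.u_comp (by fun_prop) (by fun_prop) ?_)
      · rintro ⟨s, r⟩ ⟨h1, h2, h3⟩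
        exact ⟨h1, h2, h3.trans hx⟩
      · rintro ⟨s, r⟩ ⟨h1, h2, h3⟩
        exact ⟨⟨h1, (h2.trans h3).trans hx⟩, ht⟩)
  have cfu : ContinuousOn (fun y => ∫ r in (0 : ℝ)..y, f y r * u r t) (Icc 0 x) := by
    have h1 : ContinuousOn (fun y => uRate f g u y t) (Icc 0 x) :=
      (sol.continuousOn_uRate hf hg).comp (f := fun y => (y, t)) (by fun_prop)
        fun y hy => ⟨⟨hy.1, hy.2.trans hx⟩, ht⟩
    have := h1.sub (cg.mul (continuousOn_const (c := u 0 t)))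
    refine this.congr fun y _ => ?_
    simp [uRate]
  have hval : -(1 * (K.k (x - 0) (0 - 0) * u (0 - 0) (t + 0)))
      + ∫ y in (0 : ℝ)..x, (-K.kRate x y * u y t + K.k x y * uRate f g u y t)
      = uRate f g u x t := by
    have e : ∀ y, -K.kRate x y * u y t + K.k x y * uRate f g u y t
        = K.k x y * g y * u 0 t + K.k x y * (∫ r in (0 : ℝ)..y, f y r * u r t)
          - (∫ s in y..x, K.k x s * (f s y * u y t)) + f x y * u y t := by
      intro y
      have : ∫ s in y..x, K.k x s * (f s y * u y t)
          = (∫ s in y..x, f s y * K.k x s) * u y t := by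
        rw [← intervalIntegral.integral_mul_const]
        congr 1; ext s; ring
      rw [this, Kernels.kRate, uRate]
      ring
    simp_rw [e]
    have i1 := hIx ((ck.fun_mul cg).fun_mul (continuousOn_const (c := u 0 t)))
    have i2 := hIx (ck.fun_mul cfu)
    rw [intervalIntegral.integral_add ((i1.add i2).sub t1) (hIx (cf.fun_mul cu)),
      intervalIntegral.integral_sub (i1.add i2) t1, intervalIntegral.integral_add i1 i2, t2,
      intervalIntegral.integral_mul_const]
    simp only [sub_zero, add_zero]
    rw [K.k_bc x ⟨hx0.le, hx⟩, uRate]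
    ring
  rw [hval] at hmov
  have := (sol.hasDerivWithinAt_u_characteristic hf hg hx0 hx ht).sub hmov.2
  rw [sub_self] at this
  refine this.congr_of_eventuallyEq ?_ ?_
  · filter_upwards with h
    have h1 := intervalIntegral.integral_comp_sub_right
      (fun y => K.k (x - h) y * u y (t + h)) h (a := h) (b := x)
    rw [sub_self] at h1
    simp only [Kernels.w, Pi.sub_apply, zero_add, one_mul]
    rw [← h1]
  · simp [Kernels.w]

theorem w_characteristic (sol : IsClosedLoopSolution f g K Dlo Dhi b₁ θ D u v Dhat)
    (hf : ContinuousOn (fun p : ℝ × ℝ => f p.1 p.2) triangle) (hg : ContinuousOn g (Icc 0 1))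
    {x t h : ℝ} (h0 : 0 ≤ h) (hhx : h ≤ x) (hx : x ≤ 1) (ht : 0 ≤ t) :
    K.w (fun y => u y (t + h)) (x - h) = K.w (fun y => u y t) x := by
  have := abs_sub_le_mul_of_right_deriv (φ := fun h => K.w (fun y => u y (t + h)) (x - h))
    (φ' := fun _ => 0) (C := 0) h0
    (sol.continuousOn_w.comp (f := fun h => (x - h, t + h)) (by fun_prop) fun r hr =>
      ⟨⟨by dsimp only; linarith [hr.2], by dsimp only; linarith [hr.1]⟩,
        show 0 ≤ t + r by linarith [hr.1]⟩)
    (fun r hr => by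
      refine hasDerivWithinAt_Ici_shift ((sol.hasDerivWithinAt_w hf hg (x := x - r) (t := t + r)
        (by linarith [hr.2]) (by linarith [hr.1])
        (by linarith [hr.1])).congr_of_eventuallyEq ?_ ?_)
      · filter_upwards with s
        rw [sub_sub, add_assoc]
      · simp)
    (fun r _ => by simp)
  simp only [sub_zero, zero_mul, add_zero] at this
  linarith [abs_nonpos_iff.1 this]

end IsClosedLoopSolution

theorem hasDerivWithinAt_comp_triple {Γ : ℝ → ℝ → ℝ → ℝ} {X Y Z : ℝ → ℝ} {α β ζ t : ℝ} {s : Set ℝ}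
    (hΓ : DifferentiableAt ℝ (fun p : ℝ × ℝ × ℝ => Γ p.1 p.2.1 p.2.2) (X t, Y t, Z t))
    (hX : HasDerivWithinAt X α s t) (hY : HasDerivWithinAt Y β s t)
    (hZ : HasDerivWithinAt Z ζ s t) :
    HasDerivWithinAt (fun h => Γ (X h) (Y h) (Z h))
      (α * deriv (fun r => Γ r (Y t) (Z t)) (X t) + β * deriv (fun r => Γ (X t) r (Z t)) (Y t)
        + ζ * deriv (fun r => Γ (X t) (Y t) r) (Z t)) s t := by
  set A := fderiv ℝ (fun p : ℝ × ℝ × ℝ => Γ p.1 p.2.1 p.2.2) (X t, Y t, Z t) with hA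
  have hΓ' := hΓ.hasFDerivAt
  have h1 : deriv (fun r => Γ r (Y t) (Z t)) (X t) = A (1, 0, 0) := by
    have : HasDerivAt (fun r : ℝ => (r, Y t, Z t)) ((1 : ℝ), (0 : ℝ), (0 : ℝ)) (X t) :=
      (hasDerivAt_id _).prodMk ((hasDerivAt_const _ _).prodMk (hasDerivAt_const _ _))
    exact (hΓ'.comp_hasDerivAt (X t) this).deriv
  have h2 : deriv (fun r => Γ (X t) r (Z t)) (Y t) = A (0, 1, 0) := by
    have : HasDerivAt (fun r : ℝ => (X t, r, Z t)) ((0 : ℝ), (1 : ℝ), (0 : ℝ)) (Y t) :=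
      (hasDerivAt_const _ _).prodMk ((hasDerivAt_id _).prodMk (hasDerivAt_const _ _))
    exact (hΓ'.comp_hasDerivAt (Y t) this).deriv
  have h3 : deriv (fun r => Γ (X t) (Y t) r) (Z t) = A (0, 0, 1) := by
    have : HasDerivAt (fun r : ℝ => (X t, Y t, r)) ((0 : ℝ), (0 : ℝ), (1 : ℝ)) (Z t) :=
      (hasDerivAt_const _ _).prodMk ((hasDerivAt_const _ _).prodMk (hasDerivAt_id _))
    exact (hΓ'.comp_hasDerivAt (Z t) this).deriv
  have h4 := hΓ'.comp_hasDerivWithinAt t (hX.prodMk (hY.prodMk hZ))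
  have e : ((α, β, ζ) : ℝ × ℝ × ℝ) = α • (1, 0, 0) + β • (0, 1, 0) + ζ • (0, 0, 1) := by simp
  rw [← hA, e, map_add, map_add, map_smul, map_smul, map_smul, ← h1, ← h2, ← h3] at h4
  exact h4

theorem exists_abs_sub_le_of_hasDerivWithinAt {φ : ℝ → ℝ} {c : ℝ}
    (h : HasDerivWithinAt φ c (Ici 0) 0) :
    ∃ ε > 0, ∀ s ∈ Icc 0 ε, |φ s - φ 0| ≤ (|c| + 1) * s := by
  have h1 := ((hasDerivWithinAt_iff_tendsto_slope' (by simp)).1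
    (h.mono Ioi_subset_Ici_self)).abs
  have h2 := (h1.eventually_lt_const (lt_add_one |c|))
  obtain ⟨ε, hε, hsub⟩ := mem_nhdsGT_iff_exists_Ioc_subset.1 h2
  refine ⟨ε, hε, fun s hs => ?_⟩
  rcases hs.1.eq_or_lt with rfl | hs0
  · simp
  have h3 : |slope φ 0 s| < |c| + 1 := hsub ⟨hs0, hs.2⟩
  rw [slope_def_field, sub_zero, abs_div, abs_of_pos hs0, div_lt_iff₀ hs0] at h3
  exact h3.le

namespace IsClosedLoopSolution

variable {f : ℝ → ℝ → ℝ} {g : ℝ → ℝ} {K : Kernels f g} {Dlo Dhi b₁ θ D : ℝ}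
  {u v : ℝ → ℝ → ℝ} {Dhat : ℝ → ℝ}

/-! ### The transformed actuator state -/

theorem continuousOn_z (sol : IsClosedLoopSolution f g K Dlo Dhi b₁ θ D u v Dhat) (hDlo : 0 < Dlo)
    (hr : ∀ t ≥ 0, Dhat t ∈ Icc Dlo Dhi) :
    ContinuousOn (fun p : ℝ × ℝ => K.z (Dhat p.2) (fun y => u y p.2) (fun y => v y p.2) p.1)
      (Icc 0 1 ×ˢ Ici 0) := by
  have hd : ContinuousOn (fun p : ℝ × ℝ => Dhat p.2) (Icc (0 : ℝ) 1 ×ˢ Ici (0 : ℝ)) :=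
    sol.Dhat_cont.comp continuousOn_snd fun p hp => hp.2
  have hd' : ContinuousOn (fun q : (ℝ × ℝ) × ℝ => Dhat q.1.2)
      {q | 0 ≤ q.1.2} := sol.Dhat_cont.comp (by fun_prop) fun p hp => hp
  refine (sol.v_cont.sub (continuousOn_paramIntegral
    (F := fun (p : ℝ × ℝ) y => K.γ p.1 y (Dhat p.2) * u y p.2) continuousOn_const
    continuousOn_const (fun p hp => zero_le_one) ?_)).sub (hd.mul (continuousOn_paramIntegral
    (F := fun (p : ℝ × ℝ) y => K.q (p.1 - y) (Dhat p.2) * v y p.2) continuousOn_const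
    continuousOn_fst (fun p hp => hp.1.1) ?_))
  · refine (K.continuousOn_γ_comp (by fun_prop) (by fun_prop) (hd'.mono ?_) ?_).mul
      (sol.u_comp (by fun_prop) (by fun_prop) ?_)
    · rintro ⟨⟨x, t⟩, y⟩ ⟨⟨h1, h2⟩, h3, h4⟩
      exact h2
    · rintro ⟨⟨x, t⟩, y⟩ ⟨⟨h1, h2⟩, h3, h4⟩
      exact ⟨h1, ⟨h3, h4⟩, hDlo.trans_le (hr t h2).1⟩
    · rintro ⟨⟨x, t⟩, y⟩ ⟨⟨h1, h2⟩, h3, h4⟩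
      exact ⟨⟨h3, h4⟩, h2⟩
  · refine (K.continuousOn_γ_comp (by fun_prop) (by fun_prop) (hd'.mono ?_) ?_).mul
      (sol.v_comp (by fun_prop) (by fun_prop) ?_)
    · rintro ⟨⟨x, t⟩, y⟩ ⟨⟨h1, h2⟩, h3, h4⟩
      exact h2
    · rintro ⟨⟨x, t⟩, y⟩ ⟨⟨h1, h2⟩, h3, h4⟩
      dsimp only at *
      exact ⟨⟨by linarith, by linarith [h1.2]⟩, ⟨zero_le_one, le_rfl⟩, hDlo.trans_le (hr t h2).1⟩
    · rintro ⟨⟨x, t⟩, y⟩ ⟨⟨h1, h2⟩, h3, h4⟩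
      exact ⟨⟨h3, le_trans h4 h1.2⟩, h2⟩

theorem hasDerivWithinAt_integral_γ_u (sol : IsClosedLoopSolution f g K Dlo Dhi b₁ θ D u v Dhat)
    (hf : ContinuousOn (fun p : ℝ × ℝ => f p.1 p.2) triangle) (hg : ContinuousOn g (Icc 0 1))
    (hDlo : 0 < Dlo) (hD : 0 < D) {t : ℝ} (ht : 0 ≤ t) {d : ℝ → ℝ} {δ' : ℝ}
    (hdc : ContinuousOn d (Ici 0)) (hr : ∀ h ≥ 0, d h ∈ Icc Dlo Dhi)
    (hd' : HasDerivWithinAt d δ' (Ici 0) 0) {x : ℝ} (hx : x ∈ Ioo (0 : ℝ) 1) :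
    HasDerivWithinAt (fun h => ∫ y in (0 : ℝ)..1, K.γ (x - h) y (d h) * u y (t + D * h))
      (D * (K.q x (d 0) * u 1 t) + (D - d 0) * (∫ y in (0 : ℝ)..1, K.P₁Density (d 0) x y * u y t)
        + δ' * ∫ y in (0 : ℝ)..1, K.γd x y (d 0) * u y t) (Ici 0) 0 := by
  have hd0 : 0 < d 0 := hDlo.trans_le (hr 0 le_rfl).1
  obtain ⟨ε, hε, hdl⟩ := exists_abs_sub_le_of_hasDerivWithinAt hd'
  obtain ⟨Cγ, hCγ, hγl⟩ := K.exists_lipschitz_γ (a := Dlo) (b := Dhi) hDlo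
  obtain ⟨Bγ, hBγ, hγ⟩ := exists_bound_of_isCompact
    (isCompact_Icc.prod (isCompact_Icc.prod isCompact_Icc))
    (K.γ_lip.continuousOn.mono (fun p hp => ⟨hp.1, hp.2.1, hDlo.trans_le hp.2.2.1⟩ :
      Icc (0 : ℝ) 1 ×ˢ (Icc (0 : ℝ) 1 ×ˢ Icc Dlo Dhi) ⊆ slab))
  obtain ⟨Cu, hCu, hul⟩ := sol.exists_lipschitz_u hf hg (t + 1)
  obtain ⟨Bu, hBu, hu⟩ := exists_bound_of_isCompact (isCompact_Icc.prod (isCompact_Icc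
    (a := (0 : ℝ)) (b := t + 1))) (sol.u_cont.mono (prod_mono_right Icc_subset_Ici_self))
  obtain ⟨δ, hδ, hδε, hδx, hδD⟩ : ∃ δ > 0, δ ≤ ε ∧ δ ≤ x ∧ D * δ ≤ 1 := by
    refine ⟨min ε (min x (1 / D)), lt_min hε (lt_min hx.1 (by positivity)), min_le_left _ _,
      (min_le_right _ _).trans (min_le_left _ _), ?_⟩
    have := (min_le_right ε (min x (1 / D))).trans (min_le_right _ _)
    rw [le_div_iff₀ hD] at this
    linarith
  have hDh : ∀ h ∈ Icc 0 δ, 0 ≤ D * h ∧ D * h ≤ 1 := fun h hh =>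
    ⟨mul_nonneg hD.le hh.1, (mul_le_mul_of_nonneg_left hh.2 hD.le).trans hδD⟩
  have hxh : ∀ h ∈ Icc 0 δ, x - h ∈ Icc (0 : ℝ) 1 := fun h hh =>
    ⟨by linarith [hh.2], by linarith [hh.1, hx.2]⟩
  have hx' := Ioo_subset_Icc_self hx
  set CΔ : ℝ := 1 + D + (|δ'| + 1) with hCΔ
  have hCΔ0 : 0 ≤ CΔ := by positivity
  have key := hasDerivWithinAt_integral_transport
    (Φ := fun h y => K.γ (x - h) y (d h) * u y (t + D * h))
    (D := fun y => (-(d 0 * ∫ s in y..1, f s y * K.γ x s (d 0)) + (d 0 - D) * K.γy x y (d 0)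
      + δ' * K.γd x y (d 0)) * u y t + K.γ x y (d 0) * (D * uRate f g u y t))
    (a := 0) (b := 1) (c := D) (δ := δ) (C := Cγ * CΔ * Bu + Bγ * (Cu * D)) one_pos hD.le hδ
    (by linarith) (by positivity)
    (by
      refine (K.continuousOn_γ_comp (by fun_prop) (by fun_prop)
        (hdc.comp continuousOn_fst ?_) ?_).mul
        (sol.u_comp (by fun_prop) (by fun_prop) ?_)
      · exact fun p hp => hp.1.1
      · exact fun p hp => ⟨hxh _ hp.1, hp.2, hDlo.trans_le (hr _ hp.1.1).1⟩
      · exact fun p hp => ⟨hp.2, by linarith [(hDh _ hp.1).1]⟩)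
    (fun h hh y hy => by
      have hh' : h ∈ Icc 0 δ := ⟨hh.1.le, hh.2⟩
      have h1 := hDh h hh'
      have hy1 : y ∈ Icc (0 : ℝ) 1 := ⟨by linarith [hy.1], hy.2.le⟩
      have hy2 : y - D * h ∈ Icc (0 : ℝ) 1 := ⟨by linarith [hy.1], by linarith [hy.2]⟩
      have e1 := hγl (x - h) (hxh h hh') (y - D * h) hy2 (d h) (hr h hh.1.le) x hx' y hy1 (d 0)
        (hr 0 le_rfl)
      have e2 := hul y t (D * h) h1.1 (by linarith [hy.1]) hy.2.le ht (by linarith)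
      have e3 := hu (y - D * h, t + D * h) ⟨hy2, ⟨by dsimp only; linarith, by dsimp only; linarith⟩⟩
      have e4 := hγ (x, y, d 0) ⟨hx', hy1, hr 0 le_rfl⟩
      have e5 : |x - h - x| + |y - D * h - y| + |d h - d 0| ≤ CΔ * h := by
        have a1 : x - h - x = -h := by ring
        have a2 : y - D * h - y = -(D * h) := by ring
        rw [a1, a2, abs_neg, abs_neg, abs_of_pos hh.1, abs_of_nonneg h1.1]
        have := hdl h ⟨hh.1.le, hh.2.trans hδε⟩
        rw [hCΔ]
        linarith
      have e6 : |K.γ (x - h) (y - D * h) (d h) - K.γ x y (d 0)| ≤ Cγ * (CΔ * h) :=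
        e1.trans (mul_le_mul_of_nonneg_left e5 hCγ)
      dsimp only at e3 e4 ⊢
      simp only [sub_zero, mul_zero, add_zero]
      calc |K.γ (x - h) (y - D * h) (d h) * u (y - D * h) (t + D * h) - K.γ x y (d 0) * u y t|
          = |(K.γ (x - h) (y - D * h) (d h) - K.γ x y (d 0)) * u (y - D * h) (t + D * h)
            + K.γ x y (d 0) * (u (y - D * h) (t + D * h) - u y t)| := by ring_nf
        _ ≤ |K.γ (x - h) (y - D * h) (d h) - K.γ x y (d 0)| * |u (y - D * h) (t + D * h)|
            + |K.γ x y (d 0)| * |u (y - D * h) (t + D * h) - u y t| := by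
            rw [← abs_mul, ← abs_mul]; exact abs_add_le _ _
        _ ≤ (Cγ * (CΔ * h)) * Bu + Bγ * (Cu * (D * h)) := by
            have := hh.1.le
            gcongr
        _ = (Cγ * CΔ * Bu + Bγ * (Cu * D)) * h := by ring)
    (by
      filter_upwards [ae_ne (d 0 * x)] with y hy hy'
      have e1 := hasDerivWithinAt_comp_triple (Γ := K.γ) (X := fun h => x - h)
        (Y := fun h => y - D * h) (Z := d) (α := -1) (β := -D) (ζ := δ') (t := 0) (s := Ici 0)
        (by simpa using (K.contDiffAt_γ hx hy' hd0 hy).differentiableAt (by norm_num))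
        ((hasDerivAt_id (0 : ℝ)).const_sub x).hasDerivWithinAt
        (by simpa using! (((hasDerivAt_id (0 : ℝ)).const_mul D).const_sub y).hasDerivWithinAt) hd'
      have e2 := hasDerivWithinAt_Ici_scale hD.le
        (sol.hasDerivWithinAt_u_characteristic hf hg hy'.1 hy'.2.le ht)
      refine (e1.fun_mul e2).congr_deriv ?_
      simp only [mul_zero, sub_zero, add_zero]
      rw [K.γ_pde (d 0) hd0 x hx y hy' hy, Kernels.γy, Kernels.γd]
      ring)
  refine key.2.congr_deriv ?_
  have h01 : uIcc (0 : ℝ) 1 = Icc 0 1 := uIcc_of_le zero_le_one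
  have hI : ∀ {φ : ℝ → ℝ}, ContinuousOn φ (Icc 0 1) → IntervalIntegrable φ volume 0 1 :=
    fun h => by
      refine ContinuousOn.intervalIntegrable ?_
      rwa [h01]
  have cu := sol.u_slice ht
  have cγ : ContinuousOn (fun y => K.γ x y (d 0)) (Icc 0 1) :=
    K.continuousOn_γ_comp (by fun_prop) (by fun_prop) (by fun_prop) fun y hy => ⟨hx', hy, hd0⟩
  have iP : IntervalIntegrable (fun y => K.P₁Density (d 0) x y * u y t) volume 0 1 :=
    (K.intervalIntegrable_P₁Density hf hx' hd0).mul_continuousOn (by rwa [h01])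
  have iγd : IntervalIntegrable (fun y => K.γd x y (d 0) * u y t) volume 0 1 :=
    (K.intervalIntegrable_γd hx' hd0).mul_continuousOn (by rwa [h01])
  obtain ⟨t1, t2⟩ := integral_triangle_swap (m := fun y => K.γ x y (d 0))
    (G := fun y r => f y r * u r t) zero_le_one (hI cγ) (by
      refine hf.mul (sol.u_comp (by fun_prop) (by fun_prop) ?_)
      rintro ⟨s, r⟩ ⟨h1, h2, h3⟩
      exact ⟨⟨h1, h2.trans h3⟩, ht⟩)
  have cfu : ContinuousOn (fun y => ∫ r in (0 : ℝ)..y, f y r * u r t) (Icc 0 1) := by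
    have h1 : ContinuousOn (fun y => uRate f g u y t) (Icc 0 1) :=
      (sol.continuousOn_uRate hf hg).comp (f := fun y => (y, t)) (by fun_prop)
        fun y hy => ⟨hy, ht⟩
    have := h1.sub (hg.mul (continuousOn_const (c := u 0 t)))
    refine this.congr fun y _ => ?_
    simp [uRate]
  have i1 := hI ((hg.fun_mul cγ).fun_mul (continuousOn_const (c := D * u 0 t)))
  have i2 := (hI (cγ.fun_mul cfu)).const_mul D
  have e : ∀ y, (-(d 0 * ∫ s in y..1, f s y * K.γ x s (d 0)) + (d 0 - D) * K.γy x y (d 0)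
      + δ' * K.γd x y (d 0)) * u y t + K.γ x y (d 0) * (D * uRate f g u y t)
      = (D - d 0) * (K.P₁Density (d 0) x y * u y t) + δ' * (K.γd x y (d 0) * u y t)
        + g y * K.γ x y (d 0) * (D * u 0 t)
        + D * (K.γ x y (d 0) * ∫ r in (0 : ℝ)..y, f y r * u r t)
        - D * ∫ s in y..1, K.γ x s (d 0) * (f s y * u y t) := by
    intro y
    have : ∫ s in y..1, K.γ x s (d 0) * (f s y * u y t)
        = (∫ s in y..1, f s y * K.γ x s (d 0)) * u y t := by
      rw [← intervalIntegral.integral_mul_const]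
      congr 1; ext s; ring
    rw [this, Kernels.P₁Density, uRate]
    ring
  simp_rw [e]
  rw [intervalIntegral.integral_sub ((((iP.const_mul _).add (iγd.const_mul _)).add i1).add i2)
      (t1.const_mul D),
    intervalIntegral.integral_add (((iP.const_mul _).add (iγd.const_mul _)).add i1) i2,
    intervalIntegral.integral_add ((iP.const_mul _).add (iγd.const_mul _)) i1,
    intervalIntegral.integral_add (iP.const_mul _) (iγd.const_mul _)]
  simp only [intervalIntegral.integral_const_mul, intervalIntegral.integral_mul_const]
  rw [t2, ← K.γ_bc (d 0) hd0 x hx']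
  simp only [sub_zero, mul_zero, add_zero, Kernels.q]
  ring

theorem hasDerivWithinAt_integral_q_v (sol : IsClosedLoopSolution f g K Dlo Dhi b₁ θ D u v Dhat)
    (hDlo : 0 < Dlo) (hD : 0 < D) {t : ℝ} (ht : 0 ≤ t) {d : ℝ → ℝ} {δ' : ℝ}
    (hr : ∀ h ≥ 0, d h ∈ Icc Dlo Dhi)
    (hd' : HasDerivWithinAt d δ' (Ici 0) 0) {x : ℝ} (hx : x ∈ Ioo (0 : ℝ) 1) :
    HasDerivWithinAt (fun h => ∫ y in (0 : ℝ)..(x - h), K.q (x - h - y) (d h) * v y (t + D * h))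
      (-(K.q x (d 0) * v 0 t) + δ' * ∫ y in (0 : ℝ)..x, K.qd (x - y) (d 0) * v y t)
      (Ici 0) 0 := by
  have hd0 : 0 < d 0 := hDlo.trans_le (hr 0 le_rfl).1
  have h1m : (1 : ℝ) ∈ Icc (0 : ℝ) 1 := ⟨zero_le_one, le_rfl⟩
  obtain ⟨ε, hε, hdl⟩ := exists_abs_sub_le_of_hasDerivWithinAt hd'
  obtain ⟨Cγ, hCγ, hγl⟩ := K.exists_lipschitz_γ (a := Dlo) (b := Dhi) hDlo
  obtain ⟨Bv, hBv, hv⟩ := exists_bound_of_isCompact isCompact_Icc (sol.v_slice ht)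
  set δ := min ε x with hδdef
  have hδ : 0 < δ := lt_min hε hx.1
  have hδx : δ ≤ x := min_le_right _ _
  have hxy : ∀ y ∈ Icc 0 x, x - y ∈ Icc (0 : ℝ) 1 := fun y hy =>
    ⟨by linarith [hy.2], by linarith [hy.1, hx.2]⟩
  have key := hasDerivWithinAt_integral_moving_left
    (Φ := fun h y => K.q (x - y) (d h) * v y t)
    (D := fun y => δ' * K.qd (x - y) (d 0) * v y t)
    (a := 0) (b := x) (c := 1) (δ := δ) (C := Cγ * (|δ'| + 1) * Bv) hx.1 zero_le_one hδ
    (by linarith) (by positivity)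
    (by
      refine (K.continuousOn_γ_comp (by fun_prop) (by fun_prop) (by fun_prop) ?_).mul
        ((sol.v_slice ht).mono (Icc_subset_Icc_right hx.2.le))
      exact fun y hy => ⟨hxy y hy, h1m, hd0⟩)
    (fun h hh => by
      refine ContinuousOn.intervalIntegrable ?_
      rw [uIcc_of_le (by linarith [hh.2])]
      refine (K.continuousOn_γ_comp (by fun_prop) (by fun_prop) (by fun_prop) ?_).mul
        ((sol.v_slice ht).mono (Icc_subset_Icc (by linarith [hh.1]) hx.2.le))
      exact fun y hy => ⟨hxy y ⟨by linarith [hy.1, hh.1], hy.2⟩, h1m,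
        hDlo.trans_le (hr h hh.1).1⟩)
    (fun h hh y hy => by
      have hy' : y ∈ Icc 0 x := ⟨by linarith [hy.1, hh.1], hy.2.le⟩
      have e1 := hγl (x - y) (hxy y hy') 1 h1m (d h) (hr h hh.1.le) (x - y) (hxy y hy') 1 h1m (d 0)
        (hr 0 le_rfl)
      simp only [sub_self, abs_zero, zero_add] at e1
      have e2 := hdl h ⟨hh.1.le, hh.2.trans (min_le_left _ _)⟩
      have e3 := hv y ⟨hy'.1, hy'.2.trans hx.2.le⟩
      have e4 := e1.trans (mul_le_mul_of_nonneg_left e2 hCγ)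
      rw [← sub_mul, abs_mul]
      calc _ ≤ Cγ * ((|δ'| + 1) * h) * Bv := by
            have := hh.1.le
            gcongr
            exact e4
        _ = _ := by ring)
    (by
      filter_upwards [ae_ne (x - 1 / d 0)] with y hy hy'
      have e1 := (K.differentiableAt_γ_delay (hxy y (Ioo_subset_Icc_self hy')) h1m hd0
        (fun h => hy (by
          have : x - y = 1 / d 0 := by rw [h]; field_simp
          linarith))).hasDerivAt
      have e2 := e1.comp_hasDerivWithinAt (0 : ℝ) hd'
      refine (e2.mul_const (v y t)).congr_deriv ?_
      rw [mul_comm δ']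
      rfl)
  have hval := key.2
  simp only [one_mul, zero_add, sub_zero, mul_assoc, intervalIntegral.integral_const_mul] at hval
  refine hval.congr_of_eventuallyEq ?_ ?_
  · filter_upwards [Icc_mem_nhdsGE hδ] with h hh
    have h1 := intervalIntegral.integral_comp_sub_right
      (fun y => K.q (x - h - y) (d h) * v y (t + D * h)) h (a := h) (b := x)
    rw [sub_self] at h1
    rw [← h1]
    refine intervalIntegral.integral_congr fun y hy => ?_
    rw [uIcc_of_le (hh.2.trans hδx)] at hy
    rw [sol.v_characteristic hD hh.1 hy.1 (hy.2.trans hx.2.le) ht]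
    congr 2
    ring
  · simp

/-- The equation `D z_t = z_x - (D - D̂) P₁ - D D̂' P₂` of the transformed actuator state, along
the characteristics. -/
theorem hasDerivWithinAt_z (sol : IsClosedLoopSolution f g K Dlo Dhi b₁ θ D u v Dhat)
    (hf : ContinuousOn (fun p : ℝ × ℝ => f p.1 p.2) triangle) (hg : ContinuousOn g (Icc 0 1))
    (hDlo : 0 < Dlo) (hD : 0 < D) (hr : ∀ t ≥ 0, Dhat t ∈ Icc Dlo Dhi) {t : ℝ} (ht : 0 ≤ t)
    {δ' : ℝ} (hd' : HasDerivWithinAt Dhat δ' (Ici t) t) {x : ℝ} (hx : x ∈ Ioo (0 : ℝ) 1) :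
    HasDerivWithinAt (fun h => K.z (Dhat (t + D * h)) (fun y => u y (t + D * h))
        (fun y => v y (t + D * h)) (x - h))
      (-((D - Dhat t) * K.P₁ (Dhat t) (fun y => u y t) (fun y => v y t) x
        + D * δ' * K.P₂ (Dhat t) (fun y => u y t) (fun y => v y t) x)) (Ici 0) 0 := by
  have hDh : ∀ h ≥ 0, 0 ≤ t + D * h := fun h hh => by positivity
  have hdr : ∀ h ≥ 0, Dhat (t + D * h) ∈ Icc Dlo Dhi := fun h hh => hr _ (hDh h hh)
  have hdc : ContinuousOn (fun h => Dhat (t + D * h)) (Ici 0) :=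
    sol.Dhat_cont.comp (by fun_prop) hDh
  have hdd : HasDerivWithinAt (fun h => Dhat (t + D * h)) (D * δ') (Ici 0) 0 := by
    have h2 : HasDerivWithinAt (fun s : ℝ => t + D * s) D (Ici 0) 0 := by
      simpa using! (((hasDerivAt_id (0 : ℝ)).const_mul D).const_add t).hasDerivWithinAt
    have h3 := HasDerivWithinAt.scomp (t' := Ici t) (x := (0 : ℝ))
      (g₁ := Dhat) (h := fun s => t + D * s) (by simpa using hd') h2
      (fun s hs => by
        have : 0 ≤ D * s := mul_nonneg hD.le hs
        simpa using this)
    simpa [Function.comp_def] using h3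
  have hA := sol.hasDerivWithinAt_integral_γ_u hf hg hDlo hD ht hdc hdr hdd hx
  have hB := sol.hasDerivWithinAt_integral_q_v hDlo hD ht hdr hdd hx
  have hx' := Ioo_subset_Icc_self hx
  have hd0 : 0 < Dhat t := hDlo.trans_le (hr t ht).1
  simp only [mul_zero, add_zero] at hA hB
  have hsum := ((hA.const_sub (v x t))).sub (hdd.fun_mul hB)
  simp only [mul_zero, add_zero, sub_zero] at hsum
  have h01 : uIcc (0 : ℝ) 1 = Icc 0 1 := uIcc_of_le zero_le_one
  have h0x : uIcc (0 : ℝ) x = Icc 0 x := uIcc_of_le hx.1.le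
  have cv : ContinuousOn (fun y => v y t) (Icc 0 x) :=
    (sol.v_slice ht).mono (Icc_subset_Icc_right hx.2.le)
  have cq : ContinuousOn (fun y => K.q (x - y) (Dhat t)) (Icc 0 x) :=
    K.continuousOn_γ_comp (by fun_prop) (by fun_prop) (by fun_prop) fun y hy =>
      ⟨⟨by linarith [hy.2], by linarith [hy.1, hx.2]⟩, ⟨zero_le_one, le_rfl⟩, hd0⟩
  have iq : IntervalIntegrable (fun y => K.q (x - y) (Dhat t) * v y t) volume 0 x := by
    refine ContinuousOn.intervalIntegrable ?_
    rw [h0x]; exact cq.mul cv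
  have iqd : IntervalIntegrable (fun y => K.qd (x - y) (Dhat t) * v y t) volume 0 x :=
    (K.intervalIntegrable_qd hx' hd0).mul_continuousOn (by rwa [h0x])
  have e : ∫ y in (0 : ℝ)..x, (K.q (x - y) (Dhat t) + Dhat t * K.qd (x - y) (Dhat t)) * v y t
      = (∫ y in (0 : ℝ)..x, K.q (x - y) (Dhat t) * v y t)
        + Dhat t * ∫ y in (0 : ℝ)..x, K.qd (x - y) (Dhat t) * v y t := by
    rw [← intervalIntegral.integral_const_mul, ← intervalIntegral.integral_add iq
      (iqd.const_mul _)]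
    refine intervalIntegral.integral_congr fun y _ => ?_
    ring
  refine HasDerivWithinAt.congr_deriv (f' := _) (hsum.congr_of_eventuallyEq ?_ ?_) ?_
  · filter_upwards [Icc_mem_nhdsGE hx.1] with h hh
    simp only [Kernels.z, Pi.sub_apply]
    rw [sol.v_characteristic hD hh.1 hh.2 hx.2.le ht]
  · simp [Kernels.z]
  · rw [K.P₁_eq_P₁Plant hf hd0 (sol.u_slice ht) (sol.u_bc t ht) hx', Kernels.P₁Plant, Kernels.P₂, e,
      ← sol.u_bc t ht]
    ring

end IsClosedLoopSolution

/-! ### Bounds on the perturbation terms -/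

/-- The bound on the multiplier `m` may fail at one point `e`, and `m` need not be measurable. -/
theorem abs_integral_mul_le {α m : ℝ → ℝ} {a b B e : ℝ} (hab : a ≤ b)
    (hα : ContinuousOn α (Icc a b)) (h : ∀ y ∈ Ioo a b, y ≠ e → |m y| ≤ B) :
    |∫ y in a..b, α y * m y| ≤ B * ∫ y in a..b, |α y| := by
  rw [← intervalIntegral.integral_const_mul, ← Real.norm_eq_abs]
  refine intervalIntegral.norm_integral_le_of_norm_le hab ?_ ?_
  · filter_upwards [ae_ne e, ae_ne b] with y h1 h2 hy
    rw [norm_mul, mul_comm]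
    exact mul_le_mul_of_nonneg_right (h y ⟨hy.1, lt_of_le_of_ne hy.2 h2⟩ h1) (abs_nonneg _)
  · refine ContinuousOn.intervalIntegrable ?_
    rw [uIcc_of_le hab]
    exact continuousOn_const.mul hα.abs

theorem exists_mem_Ioo_ne {a b : ℝ} (hab : a < b) (e : ℝ) : ∃ y ∈ Ioo a b, y ≠ e := by
  by_cases h : (a + b) / 2 = e
  · exact ⟨(a + (a + b) / 2) / 2, ⟨by linarith, by linarith⟩, by rw [← h]; intro h'; linarith⟩
  · exact ⟨(a + b) / 2, ⟨by linarith, by linarith⟩, h⟩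

theorem delay_mul_sub_ne_one {d x y : ℝ} (hd : 0 < d) (h : y ≠ x - 1 / d) : d * (x - y) ≠ 1 := by
  intro h1
  refine h ?_
  have : x - y = 1 / d := by rw [← h1]; field_simp
  linarith

namespace Kernels

variable {f : ℝ → ℝ → ℝ} {g : ℝ → ℝ} {K : Kernels f g} {Dlo Dhi B₁ B₂ B₃ B₄ : ℝ}

theorem Bounds.nonneg (hB : K.Bounds Dlo Dhi B₁ B₂ B₃ B₄) (hDlo : 0 < Dlo) (hD : Dlo ≤ Dhi) :
    0 ≤ B₁ ∧ 0 ≤ B₂ ∧ 0 ≤ B₃ ∧ 0 ≤ B₄ := by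
  have hd : Dlo ∈ Icc Dlo Dhi := ⟨le_rfl, hD⟩
  have h2 : (1 / 2 : ℝ) ∈ Ioo (0 : ℝ) 1 := by constructor <;> norm_num
  obtain ⟨y, hy, hy'⟩ := exists_mem_Ioo_ne (zero_lt_one (α := ℝ)) (Dlo * (1 / 2))
  obtain ⟨s, hs, hs'⟩ := exists_mem_Ioo_ne h2.1 (1 / 2 - 1 / Dlo)
  exact ⟨(abs_nonneg _).trans (hB.b₁ _ hd _ (Ioo_subset_Icc_self h2)),
    (abs_nonneg _).trans (hB.b₂ _ hd _ h2 y hy hy'),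
    (abs_nonneg _).trans (hB.b₃ _ hd _ h2 s hs (delay_mul_sub_ne_one hDlo hs')),
    (abs_nonneg _).trans (hB.b₄ _ hd _ h2 y hy hy')⟩

theorem Bounds.abs_P₁_le (hB : K.Bounds Dlo Dhi B₁ B₂ B₃ B₄) {d : ℝ}
    (hd : d ∈ Icc Dlo Dhi) {φ ψ : ℝ → ℝ} (hφ : ContinuousOn φ (Icc 0 1)) {x : ℝ}
    (hx : x ∈ Ioo (0 : ℝ) 1) :
    |K.P₁ d φ ψ x| ≤ B₁ * |K.z d φ ψ 0| + B₂ * ∫ y in (0 : ℝ)..1, |K.w φ y| := by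
  refine (abs_add_le _ _).trans (add_le_add ?_ ?_)
  · rw [abs_mul, mul_comm]
    exact mul_le_mul_of_nonneg_right (hB.b₁ d hd x (Ioo_subset_Icc_self hx)) (abs_nonneg _)
  · exact abs_integral_mul_le zero_le_one (K.continuousOn_w hφ)
      fun y hy hne => hB.b₂ d hd x hx y hy hne

theorem Bounds.abs_P₂_le (hB : K.Bounds Dlo Dhi B₁ B₂ B₃ B₄)
    (hf : ContinuousOn (fun p : ℝ × ℝ => f p.1 p.2) triangle) (hg : ContinuousOn g (Icc 0 1))
    (hDlo : 0 < Dlo) {d : ℝ} (hd : d ∈ Icc Dlo Dhi) {φ ψ : ℝ → ℝ}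
    (hφ : ContinuousOn φ (Icc 0 1)) (hψ : ContinuousOn ψ (Icc 0 1)) {x : ℝ}
    (hx : x ∈ Ioo (0 : ℝ) 1) :
    |K.P₂ d φ ψ x| ≤ B₃ * (∫ y in (0 : ℝ)..1, |K.z d φ ψ y|)
      + B₄ * ∫ y in (0 : ℝ)..1, |K.w φ y| := by
  have hd0 : 0 < d := hDlo.trans_le hd.1
  have hz := K.continuousOn_z hφ hψ hd0
  rw [K.P₂_eq hf hg hd0 hφ hψ (Ioo_subset_Icc_self hx)]
  refine (abs_add_le _ _).trans (add_le_add ?_ ?_)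
  · refine (abs_integral_mul_le hx.1.le (hz.mono (Icc_subset_Icc_right hx.2.le))
      fun y hy hne => hB.b₃ d hd x hx y hy (delay_mul_sub_ne_one hd0 hne)).trans ?_
    refine mul_le_mul_of_nonneg_left ?_ (hB.nonneg hDlo (hd.1.trans hd.2)).2.2.1
    refine intervalIntegral.integral_mono_interval le_rfl hx.1.le hx.2.le
      (Eventually.of_forall fun y => abs_nonneg _) (ContinuousOn.intervalIntegrable ?_)
    rw [uIcc_of_le zero_le_one]
    exact hz.abs
  · exact abs_integral_mul_le zero_le_one (K.continuousOn_w hφ)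
      fun y hy hne => hB.b₄ d hd x hx y hy hne

end Kernels

/-! ### The delay estimate -/

/-- The update direction `τ(t)` along the trajectory `(u, v, Dhat)`. -/
noncomputable def Kernels.direction {f : ℝ → ℝ → ℝ} {g : ℝ → ℝ} (K : Kernels f g) (b₁ : ℝ)
    (u v : ℝ → ℝ → ℝ) (Dhat : ℝ → ℝ) (t : ℝ) : ℝ :=
  K.τ b₁ (Dhat t) (fun y => u y t) (fun y => v y t)

theorem abs_proj_le (Dlo Dhi d τ : ℝ) : |proj Dlo Dhi d τ| ≤ |τ| := by
  unfold proj
  split_ifs <;> simp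

theorem proj_nonneg {Dlo Dhi d : ℝ} (h : d < Dlo) (τ : ℝ) :
    0 ≤ proj Dlo Dhi d τ := by
  unfold proj
  split_ifs with h1 h2
  · exact le_rfl
  · exact le_rfl
  · by_contra hτ
    exact h1 ⟨h.le, not_le.1 hτ⟩

theorem proj_nonpos {Dlo Dhi d : ℝ} (h : Dhi < d) (τ : ℝ) :
    proj Dlo Dhi d τ ≤ 0 := by
  unfold proj
  split_ifs with h1 h2
  · exact le_rfl
  · exact le_rfl
  · by_contra hτ
    exact h2 ⟨h.le, not_le.1 hτ⟩

/-- The projection does not impair the update: the estimation error `D - d` and the removed part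
of the update direction never have the same sign. -/
theorem mul_sub_proj_nonpos {Dlo Dhi D d τ : ℝ} (hD : D ∈ Icc Dlo Dhi) :
    (D - d) * (τ - proj Dlo Dhi d τ) ≤ 0 := by
  unfold proj
  split_ifs with h1 h2
  · nlinarith [hD.1, h1.1, h1.2]
  · nlinarith [hD.2, h2.1, h2.2]
  · simp

/-- A continuous function which does not decrease while below `a` stays above `a`. -/
theorem le_of_no_decrease_below {φ : ℝ → ℝ} {a t : ℝ} (ht : 0 ≤ t)
    (hφ : ContinuousOn φ (Icc 0 t)) (h0 : a ≤ φ 0)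
    (h : ∀ s ∈ Icc 0 t, (∀ r ∈ Ioc s t, φ r < a) → φ s ≤ φ t) : a ≤ φ t := by
  have hc : IsCompact {s ∈ Icc 0 t | a ≤ φ s} := by
    refine isCompact_Icc.of_isClosed_subset ?_ fun s hs => hs.1
    exact isClosed_Icc.isClosed_le continuousOn_const hφ
  obtain ⟨s, hs, hmax⟩ := hc.exists_isGreatest ⟨0, ⟨le_rfl, ht⟩, h0⟩
  refine hs.2.trans (h s hs.1 fun r hr => ?_)
  by_contra hra
  exact absurd (hmax ⟨⟨hs.1.1.trans hr.1.le, hr.2⟩, not_lt.1 hra⟩) (not_le.2 hr.1)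

namespace IsClosedLoopSolution

variable {f : ℝ → ℝ → ℝ} {g : ℝ → ℝ} {K : Kernels f g} {Dlo Dhi b₁ θ D : ℝ}
  {u v : ℝ → ℝ → ℝ} {Dhat : ℝ → ℝ}

theorem intervalIntegrable_update (sol : IsClosedLoopSolution f g K Dlo Dhi b₁ θ D u v Dhat)
    {s t : ℝ} (hs : 0 ≤ s) (ht : 0 ≤ t) :
    IntervalIntegrable (fun r => θ * proj Dlo Dhi (Dhat r) (K.direction b₁ u v Dhat r))
      volume s t :=
  ((sol.Dhat_int s hs).symm.trans (sol.Dhat_int t ht)).const_mul θ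

theorem Dhat_sub (sol : IsClosedLoopSolution f g K Dlo Dhi b₁ θ D u v Dhat)
    {s t : ℝ} (hs : 0 ≤ s) (ht : 0 ≤ t) :
    Dhat t - Dhat s = ∫ r in s..t, θ * proj Dlo Dhi (Dhat r) (K.direction b₁ u v Dhat r) := by
  rw [sol.Dhat_law t ht, sol.Dhat_law s hs, ← intervalIntegral.integral_interval_sub_left
    (sol.intervalIntegrable_update le_rfl ht) (sol.intervalIntegrable_update le_rfl hs)]
  simp only [Kernels.direction]
  ring

/-- The projection keeps the delay estimate in the known interval. -/
theorem Dhat_mem (sol : IsClosedLoopSolution f g K Dlo Dhi b₁ θ D u v Dhat) (hθ : 0 ≤ θ)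
    (t : ℝ) (ht : 0 ≤ t) : Dhat t ∈ Icc Dlo Dhi := by
  have hc : ContinuousOn Dhat (Icc 0 t) := sol.Dhat_cont.mono fun s hs => hs.1
  constructor
  · refine le_of_no_decrease_below ht hc sol.Dhat_init.1 fun s hs h => ?_
    rw [← sub_nonneg, sol.Dhat_sub hs.1 ht, intervalIntegral.integral_of_le hs.2]
    exact setIntegral_nonneg measurableSet_Ioc fun r hr =>
      mul_nonneg hθ (proj_nonneg (h r hr) _)
  · have h1 : -Dhi ≤ -Dhat t := by
      refine le_of_no_decrease_below (φ := fun s => -Dhat s) ht hc.neg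
        (neg_le_neg sol.Dhat_init.2) fun s hs h => ?_
      rw [neg_le_neg_iff, ← sub_nonpos, sol.Dhat_sub hs.1 ht, intervalIntegral.integral_of_le hs.2]
      exact setIntegral_nonpos measurableSet_Ioc fun r hr =>
        mul_nonpos_of_nonneg_of_nonpos hθ (proj_nonpos (neg_lt_neg_iff.1 (h r hr)) _)
    exact neg_le_neg_iff.1 h1

end IsClosedLoopSolution

/-! ### Continuity of the update direction -/

theorem ae_mem_Ioo {a b : ℝ} (hab : a ≤ b) : ∀ᵐ y : ℝ, y ∈ uIoc a b → y ∈ Ioo a b := by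
  filter_upwards [ae_ne b] with y hy hy'
  rw [uIoc_of_le hab] at hy'
  exact ⟨hy'.1, lt_of_le_of_ne hy'.2 hy⟩

/-- A bounded function on `(0, 1)`, depending continuously on `t ≥ 0`: its integral is continuous
in `t`. -/
theorem continuousOn_integral_of_bounded {F : ℝ → ℝ → ℝ}
    (hF : ContinuousOn (fun p : ℝ × ℝ => F p.1 p.2) (Ioo 0 1 ×ˢ Ici 0))
    (hb : ∀ T ≥ 0, ∃ C, ∀ x ∈ Ioo (0 : ℝ) 1, ∀ t ∈ Icc 0 T, |F x t| ≤ C) :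
    (∀ t ≥ 0, IntervalIntegrable (fun x => F x t) volume 0 1) ∧
      ContinuousOn (fun t => ∫ x in (0 : ℝ)..1, F x t) (Ici 0) := by
  have hm : ∀ t ≥ 0, AEStronglyMeasurable (fun x => F x t)
      (volume.restrict (uIoc (0 : ℝ) 1)) := by
    intro t ht
    rw [uIoc_of_le zero_le_one, ← restrict_Ioo_eq_restrict_Ioc]
    refine ContinuousOn.aestronglyMeasurable ?_ measurableSet_Ioo
    exact hF.comp (f := fun x => (x, t)) (by fun_prop) fun x hx => ⟨hx, ht⟩
  constructor
  · intro t ht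
    obtain ⟨C, hC⟩ := hb t ht
    refine (intervalIntegrable_const (c := C) (μ := volume)).mono_fun (hm t ht) ?_
    rw [EventuallyLE, ae_restrict_iff' measurableSet_uIoc]
    filter_upwards [ae_mem_Ioo zero_le_one] with x hx hx'
    exact (hC x (hx hx') t ⟨ht, le_rfl⟩).trans (le_abs_self C)
  · intro t ht
    obtain ⟨C, hC⟩ := hb (t + 1) (by linarith [mem_Ici.1 ht])
    refine intervalIntegral.continuousWithinAt_of_dominated_interval (bound := fun _ => C) ?_ ?_
      intervalIntegrable_const ?_
    · filter_upwards [self_mem_nhdsWithin] with s hs using hm s hs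
    · filter_upwards [self_mem_nhdsWithin, mem_nhdsWithin_of_mem_nhds (Iic_mem_nhds (lt_add_one t))]
        with s hs hs'
      filter_upwards [ae_mem_Ioo zero_le_one] with x hx hx'
      exact hC x (hx hx') s ⟨hs, hs'⟩
    · filter_upwards [ae_mem_Ioo zero_le_one] with x hx hx'
      exact hF.comp (f := fun s => (x, s)) (by fun_prop) (fun s hs => ⟨hx hx', hs⟩) t ht

namespace Kernels

variable {f : ℝ → ℝ → ℝ} {g : ℝ → ℝ} (K : Kernels f g)

theorem continuousAt_γy {x y d : ℝ} (hx : x ∈ Ioo (0 : ℝ) 1) (hy : y ∈ Ioo (0 : ℝ) 1) (hd : 0 < d)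
    (hxy : y ≠ d * x) : ContinuousAt (fun p : ℝ × ℝ × ℝ => K.γy p.1 p.2.1 p.2.2) (x, y, d) := by
  have hC := K.contDiffAt_γ hx hy hd hxy
  have h1 := hC.continuousAt_fderiv one_ne_zero
  have h2 : ContinuousAt (fun p => fderiv ℝ (fun p : ℝ × ℝ × ℝ => K.γ p.1 p.2.1 p.2.2) p (0, 1, 0))
    (x, y, d) := h1.clm_apply continuousAt_const
  refine h2.congr ?_
  filter_upwards [hC.eventually (by simp)] with p hp
  have h3 : HasDerivAt (fun s => (p.1, s, p.2.2)) ((0 : ℝ), (1 : ℝ), (0 : ℝ)) p.2.1 :=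
    (hasDerivAt_const _ _).prodMk ((hasDerivAt_id _).prodMk (hasDerivAt_const _ _))
  have h4 := HasFDerivAt.comp_hasDerivAt (x := p.2.1) (f := fun s => (p.1, s, p.2.2))
    (l := fun p : ℝ × ℝ × ℝ => K.γ p.1 p.2.1 p.2.2) (hp.differentiableAt one_ne_zero).hasFDerivAt h3
  exact h4.deriv.symm

end Kernels

namespace IsClosedLoopSolution

variable {f : ℝ → ℝ → ℝ} {g : ℝ → ℝ} {K : Kernels f g} {Dlo Dhi b₁ θ D : ℝ}
  {u v : ℝ → ℝ → ℝ} {Dhat : ℝ → ℝ}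

theorem continuousOn_integral_γy_u (sol : IsClosedLoopSolution f g K Dlo Dhi b₁ θ D u v Dhat)
    (hDlo : 0 < Dlo) (hr : ∀ t ≥ 0, Dhat t ∈ Icc Dlo Dhi) :
    ContinuousOn (fun p : ℝ × ℝ => ∫ y in (0 : ℝ)..1, K.γy p.1 y (Dhat p.2) * u y p.2)
      (Ioo 0 1 ×ˢ Ici 0) := by
  rintro ⟨x, t⟩ ⟨hx, ht⟩
  obtain ⟨Cγ, hCγ, hγ⟩ := K.exists_abs_γy_le (a := Dlo) (b := Dhi) hDlo
  obtain ⟨Bu, hBu, hu⟩ := exists_bound_of_isCompact (isCompact_Icc.prod (isCompact_Icc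
    (a := (0 : ℝ)) (b := t + 1))) (sol.u_cont.mono (prod_mono_right Icc_subset_Ici_self))
  have hd0 : ∀ s ≥ 0, 0 < Dhat s := fun s hs => hDlo.trans_le (hr s hs).1
  have h01 : uIcc (0 : ℝ) 1 = Icc 0 1 := uIcc_of_le zero_le_one
  have hnear : ∀ᶠ p : ℝ × ℝ in 𝓝[Ioo 0 1 ×ˢ Ici 0] (x, t), p.2 ≤ t + 1 :=
    mem_nhdsWithin_of_mem_nhds (continuous_snd.continuousAt.preimage_mem_nhds
      (Iic_mem_nhds (lt_add_one t)))
  refine intervalIntegral.continuousWithinAt_of_dominated_interval (bound := fun _ => Cγ * Bu) ?_ ?_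
    intervalIntegrable_const ?_
  · filter_upwards [self_mem_nhdsWithin] with p hp
    refine (intervalIntegrable_iff.1 ((K.intervalIntegrable_γy (Ioo_subset_Icc_self hp.1)
      (hd0 _ hp.2)).mul_continuousOn ?_)).aestronglyMeasurable
    rw [h01]
    exact sol.u_slice hp.2
  · filter_upwards [self_mem_nhdsWithin, hnear] with p hp hp'
    filter_upwards [ae_mem_Ioo zero_le_one] with y hy hy'
    rw [norm_mul]
    exact mul_le_mul (hγ _ (Ioo_subset_Icc_self hp.1) y (hy hy') _ (hr _ hp.2))
      (hu (y, p.2) ⟨Ioo_subset_Icc_self (hy hy'), hp.2, hp'⟩) (norm_nonneg _) hCγ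
  · filter_upwards [ae_mem_Ioo zero_le_one, ae_ne (Dhat t * x)] with y hy hne hy'
    have h1 : ContinuousWithinAt (fun p : ℝ × ℝ => (p.1, y, Dhat p.2)) (Ioo 0 1 ×ˢ Ici 0) (x, t) :=
      continuousWithinAt_fst.prodMk (continuousWithinAt_const.prodMk
        ((sol.Dhat_cont.comp continuousOn_snd fun p hp => hp.2) (x, t) ⟨hx, ht⟩))
    have h2 := (K.continuousAt_γy hx (hy hy') (hd0 t ht) hne).comp_continuousWithinAt
      (f := fun p : ℝ × ℝ => (p.1, y, Dhat p.2)) h1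
    exact h2.mul ((sol.u_comp (S := Ioo (0 : ℝ) 1 ×ˢ Ici (0 : ℝ)) (by fun_prop) (by fun_prop)
      fun p hp => ⟨Ioo_subset_Icc_self (hy hy'), hp.2⟩) (x, t) ⟨hx, ht⟩)

theorem continuousOn_integral_f_γ_u (sol : IsClosedLoopSolution f g K Dlo Dhi b₁ θ D u v Dhat)
    (hf : ContinuousOn (fun p : ℝ × ℝ => f p.1 p.2) triangle)
    (hDlo : 0 < Dlo) (hr : ∀ t ≥ 0, Dhat t ∈ Icc Dlo Dhi) :
    ContinuousOn (fun p : ℝ × ℝ => ∫ y in (0 : ℝ)..1,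
      (∫ s in y..1, f s y * K.γ p.1 s (Dhat p.2)) * u y p.2) (Icc 0 1 ×ˢ Ici 0) := by
  refine continuousOn_paramIntegral (F := fun (p : ℝ × ℝ) y =>
    (∫ s in y..1, f s y * K.γ p.1 s (Dhat p.2)) * u y p.2) continuousOn_const continuousOn_const
    (fun _ _ => zero_le_one) ?_
  refine (continuousOn_paramIntegral (F := fun (p : (ℝ × ℝ) × ℝ) s =>
    f s p.2 * K.γ p.1.1 s (Dhat p.1.2)) continuousOn_snd continuousOn_const
    (fun p hp => hp.2.2) ?_).mul (sol.u_comp (by fun_prop) (by fun_prop) ?_)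
  · refine (hf.comp_triangle (by fun_prop) (by fun_prop) ?_).mul
      (K.continuousOn_γ_comp (by fun_prop) (by fun_prop)
        (sol.Dhat_cont.comp (by fun_prop) ?_) ?_)
    · rintro ⟨⟨⟨x, t⟩, y⟩, s⟩ ⟨⟨⟨h1, h2⟩, h3⟩, h4⟩
      exact ⟨h3.1, h4.1, h4.2⟩
    · rintro ⟨⟨⟨x, t⟩, y⟩, s⟩ ⟨⟨⟨h1, h2⟩, h3⟩, h4⟩
      exact h2
    · rintro ⟨⟨⟨x, t⟩, y⟩, s⟩ ⟨⟨⟨h1, h2⟩, h3⟩, h4⟩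
      exact ⟨h1, ⟨h3.1.trans h4.1, h4.2⟩, hDlo.trans_le (hr t h2).1⟩
  · rintro ⟨⟨x, t⟩, y⟩ ⟨⟨h1, h2⟩, h3⟩
    exact ⟨h3, h2⟩

/-- In the form `P₁Plant`, the perturbation contains the derivative `γ_y`, which may jump across
`y = d x`; the integral is continuous all the same. -/
theorem continuousOn_P₁ (sol : IsClosedLoopSolution f g K Dlo Dhi b₁ θ D u v Dhat)
    (hf : ContinuousOn (fun p : ℝ × ℝ => f p.1 p.2) triangle)
    (hDlo : 0 < Dlo) (hr : ∀ t ≥ 0, Dhat t ∈ Icc Dlo Dhi) :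
    ContinuousOn (fun p : ℝ × ℝ => K.P₁ (Dhat p.2) (fun y => u y p.2) (fun y => v y p.2) p.1)
      (Ioo 0 1 ×ˢ Ici 0) := by
  have hsub : Ioo (0 : ℝ) 1 ×ˢ Ici (0 : ℝ) ⊆ Icc 0 1 ×ˢ Ici 0 := prod_mono_left Ioo_subset_Icc_self
  have h1m : (1 : ℝ) ∈ Icc (0 : ℝ) 1 := ⟨zero_le_one, le_rfl⟩
  have hq : ContinuousOn (fun p : ℝ × ℝ => K.q p.1 (Dhat p.2) * u 1 p.2) (Ioo 0 1 ×ˢ Ici 0) :=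
    (K.continuousOn_γ_comp continuousOn_fst continuousOn_const
      (sol.Dhat_cont.comp continuousOn_snd fun p hp => hp.2) fun p hp =>
        ⟨Ioo_subset_Icc_self hp.1, h1m, hDlo.trans_le (hr _ hp.2).1⟩).mul
      (sol.u_comp continuousOn_const continuousOn_snd fun p hp => ⟨h1m, hp.2⟩)
  refine (hq.add ((sol.continuousOn_integral_γy_u hDlo hr).neg.add
    ((sol.continuousOn_integral_f_γ_u hf hDlo hr).mono hsub))).congr ?_
  rintro ⟨x, t⟩ ⟨hx, ht⟩
  have hx' := Ioo_subset_Icc_self hx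
  have hd0 := hDlo.trans_le (hr t ht).1
  have h01 : uIcc (0 : ℝ) 1 = Icc 0 1 := uIcc_of_le zero_le_one
  dsimp only [Pi.add_apply, Pi.neg_apply]
  rw [K.P₁_eq_P₁Plant hf hd0 (sol.u_slice ht) (sol.u_bc t ht) hx', Kernels.P₁Plant,
    ← intervalIntegral.integral_neg, ← intervalIntegral.integral_add]
  · congr 1
    refine intervalIntegral.integral_congr fun y _ => ?_
    simp only [Kernels.P₁Density]
    ring
  · refine ((K.intervalIntegrable_γy hx' hd0).mul_continuousOn ?_).neg
    rw [h01]; exact sol.u_slice ht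
  · refine ContinuousOn.intervalIntegrable ?_
    rw [h01]
    exact (K.continuousOn_integral_f_γ hf hx' hd0).mul (sol.u_slice ht)

end IsClosedLoopSolution

/-! ### The projected update law -/

/-- Although the right-hand side of the projected update law is discontinuous, the estimate has
the expected right derivative at every time: where the projection is active, the estimate stays at
the end point of its interval. -/
theorem hasDerivWithinAt_of_projected_law {Dlo Dhi θ : ℝ} {d τ : ℝ → ℝ} (hθ : 0 ≤ θ)
    (hτ : ContinuousOn τ (Ici 0)) (hd : ContinuousOn d (Ici 0))
    (hr : ∀ t ≥ 0, d t ∈ Icc Dlo Dhi)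
    (hint : ∀ s ≥ 0, ∀ t ≥ 0,
      IntervalIntegrable (fun r => θ * proj Dlo Dhi (d r) (τ r)) volume s t)
    (hlaw : ∀ s ≥ 0, ∀ t ≥ 0, d t - d s = ∫ r in s..t, θ * proj Dlo Dhi (d r) (τ r))
    {t : ℝ} (ht : 0 ≤ t) :
    HasDerivWithinAt d (θ * proj Dlo Dhi (d t) (τ t)) (Ici t) t := by
  have hsub : Ici t ⊆ Ici 0 := Ici_subset_Ici.2 ht
  have hτt : ContinuousWithinAt τ (Ici t) t := (hτ t ht).mono hsub
  have hdt : ContinuousWithinAt d (Ici t) t := (hd t ht).mono hsub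
  by_cases h1 : d t ≤ Dlo ∧ τ t < 0
  · have h0 : proj Dlo Dhi (d t) (τ t) = 0 := by rw [proj, if_pos h1]
    obtain ⟨e, he, hsub⟩ := mem_nhdsGE_iff_exists_Ico_subset.1 (hτt.eventually_lt_const h1.2)
    rw [h0, mul_zero]
    refine (hasDerivWithinAt_const t (Ici t) (d t)).congr_of_eventuallyEq ?_ rfl
    filter_upwards [Ico_mem_nhdsGE he] with s hs
    refine le_antisymm ?_ (h1.1.trans (hr s (ht.trans hs.1)).1)
    rw [← sub_nonpos, hlaw t ht s (ht.trans hs.1), intervalIntegral.integral_of_le hs.1]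
    refine setIntegral_nonpos measurableSet_Ioc fun r hr' => ?_
    have : τ r < 0 := hsub ⟨hr'.1.le, hr'.2.trans_lt hs.2⟩
    refine mul_nonpos_of_nonneg_of_nonpos hθ ?_
    unfold proj
    split_ifs <;> linarith
  by_cases h2 : Dhi ≤ d t ∧ 0 < τ t
  · have h0 : proj Dlo Dhi (d t) (τ t) = 0 := by rw [proj, if_neg h1, if_pos h2]
    obtain ⟨e, he, hsub⟩ := mem_nhdsGE_iff_exists_Ico_subset.1 (hτt.eventually_const_lt h2.2)
    rw [h0, mul_zero]
    refine (hasDerivWithinAt_const t (Ici t) (d t)).congr_of_eventuallyEq ?_ rfl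
    filter_upwards [Ico_mem_nhdsGE he] with s hs
    refine le_antisymm ((hr s (ht.trans hs.1)).2.trans h2.1) ?_
    rw [← sub_nonneg, hlaw t ht s (ht.trans hs.1), intervalIntegral.integral_of_le hs.1]
    refine setIntegral_nonneg measurableSet_Ioc fun r hr' => ?_
    have : 0 < τ r := hsub ⟨hr'.1.le, hr'.2.trans_lt hs.2⟩
    refine mul_nonneg hθ ?_
    unfold proj
    split_ifs <;> linarith
  have h0 : proj Dlo Dhi (d t) (τ t) = τ t := by rw [proj, if_neg h1, if_neg h2]
  have hcont : ContinuousWithinAt (fun r => proj Dlo Dhi (d r) (τ r)) (Ici t) t := by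
    rcases lt_trichotomy (τ t) 0 with h | h | h
    · have hlo : Dlo < d t := by
        by_contra hh
        exact h1 ⟨not_lt.1 hh, h⟩
      refine hτt.congr_of_eventuallyEq ?_ h0
      filter_upwards [hτt.eventually_lt_const h, hdt.eventually_const_lt hlo] with r h3 h4
      rw [proj, if_neg fun hh => absurd hh.1 (not_le.2 h4), if_neg fun hh => absurd hh.2 h3.not_gt]
    · rw [ContinuousWithinAt, h0, h]
      refine squeeze_zero_norm (fun r => abs_proj_le _ _ _ _) ?_
      have := hτt.abs
      rwa [ContinuousWithinAt, h, abs_zero] at this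
    · have hhi : d t < Dhi := by
        by_contra hh
        exact h2 ⟨not_lt.1 hh, h⟩
      refine hτt.congr_of_eventuallyEq ?_ h0
      filter_upwards [hτt.eventually_const_lt h, hdt.eventually_lt_const hhi] with r h3 h4
      rw [proj, if_neg fun hh => absurd hh.2 h3.not_gt, if_neg fun hh => absurd hh.1 (not_le.2 h4)]
  have hmeas : StronglyMeasurableAtFilter (fun r => θ * proj Dlo Dhi (d r) (τ r)) (𝓝[>] t) :=
    ⟨Ioc t (t + 1), Ioc_mem_nhdsGT (lt_add_one t),
      (hint t ht (t + 1) (by linarith)).1.aestronglyMeasurable⟩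
  have h3 := intervalIntegral.integral_hasDerivWithinAt_right (hint t ht t ht) (s := Ici t) hmeas
    ((continuousWithinAt_const.mul hcont).mono Ioi_subset_Ici_self)
  refine (h3.const_add (d t)).congr_of_eventuallyEq ?_ (by simp)
  filter_upwards [self_mem_nhdsWithin] with s hs
  rw [← hlaw t ht s (ht.trans hs)]
  ring

/-! ### The target system -/

/-- The weighted energy of the state `(W, Z)` at time `t`. -/
noncomputable def targetEnergy (b₁ : ℝ) (W Z : ℝ → ℝ → ℝ) (t : ℝ) : ℝ :=
  1 / 2 * (∫ x in (0 : ℝ)..1, (1 + x) * W x t ^ 2)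
    + b₁ / 2 * ∫ x in (0 : ℝ)..1, (1 + x) * Z x t ^ 2

/-- The normalized update direction, in terms of the state `(W, Z)` and the perturbation `P`. -/
noncomputable def targetDirection (b₁ : ℝ) (W Z P : ℝ → ℝ → ℝ) (t : ℝ) : ℝ :=
  -b₁ * (∫ x in (0 : ℝ)..1, (1 + x) * Z x t * P x t) / (1 + targetEnergy b₁ W Z t)

/-- The closed loop in backstepping coordinates: `W_t = W_x`, `W(1, t) = Z(0, t)`,
`D Z_t = Z_x - (D - d) P - D d' Q`, `Z(1, t) = 0`, where the perturbations `P` and `Q` are bounded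
by the state and `d` follows the projected update law. The spatial variable comes first, and the
equations are required along characteristics, with right derivatives. -/
structure IsTargetSolution (Dlo Dhi b₁ θ D B₁ B₂ B₃ B₄ : ℝ) (W Z P Q : ℝ → ℝ → ℝ)
    (d : ℝ → ℝ) : Prop where
  W_cont : ContinuousOn (fun p : ℝ × ℝ => W p.1 p.2) (Icc 0 1 ×ˢ Ici 0)
  Z_cont : ContinuousOn (fun p : ℝ × ℝ => Z p.1 p.2) (Icc 0 1 ×ˢ Ici 0)
  P_cont : ContinuousOn (fun p : ℝ × ℝ => P p.1 p.2) (Ioo 0 1 ×ˢ Ici 0)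
  d_cont : ContinuousOn d (Ici 0)
  d_mem : ∀ t ≥ 0, d t ∈ Icc Dlo Dhi
  W_transport : ∀ x t h, 0 ≤ h → h ≤ x → x ≤ 1 → 0 ≤ t → W (x - h) (t + h) = W x t
  W_inflow : ∀ t ≥ 0, W 1 t = Z 0 t
  Z_inflow : ∀ t ≥ 0, Z 1 t = 0
  P_le : ∀ t ≥ 0, ∀ x ∈ Ioo (0 : ℝ) 1,
    |P x t| ≤ B₁ * |Z 0 t| + B₂ * ∫ y in (0 : ℝ)..1, |W y t|
  Q_le : ∀ t ≥ 0, ∀ x ∈ Ioo (0 : ℝ) 1,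
    |Q x t| ≤ B₃ * (∫ y in (0 : ℝ)..1, |Z y t|) + B₄ * ∫ y in (0 : ℝ)..1, |W y t|
  d_deriv : ∀ t ≥ 0,
    HasDerivWithinAt d (θ * proj Dlo Dhi (d t) (targetDirection b₁ W Z P t)) (Ici t) t
  Z_deriv : ∀ t ≥ 0, ∀ x ∈ Ioo (0 : ℝ) 1,
    HasDerivWithinAt (fun h => Z (x - h) (t + D * h)) (-((D - d t) * P x t
      + D * (θ * proj Dlo Dhi (d t) (targetDirection b₁ W Z P t)) * Q x t)) (Ici 0) 0

theorem continuousOn_integral_slice {F : ℝ → ℝ → ℝ}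
    (hF : ContinuousOn (fun p : ℝ × ℝ => F p.1 p.2) (Icc 0 1 ×ˢ Ici 0)) :
    ContinuousOn (fun t => ∫ x in (0 : ℝ)..1, F x t) (Ici 0) :=
  continuousOn_paramIntegral (F := fun t x => F x t) continuousOn_const continuousOn_const
    (fun _ _ => zero_le_one) (hF.comp (f := fun q : ℝ × ℝ => (q.2, q.1)) (by fun_prop)
      fun q hq => ⟨hq.2, hq.1⟩)

theorem continuousOn_slice {F : ℝ → ℝ → ℝ}
    (hF : ContinuousOn (fun p : ℝ × ℝ => F p.1 p.2) (Icc 0 1 ×ˢ Ici 0)) {t : ℝ} (ht : 0 ≤ t) :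
    ContinuousOn (fun x => F x t) (Icc 0 1) :=
  hF.comp (f := fun x => (x, t)) (by fun_prop) fun _ hx => ⟨hx, ht⟩

theorem continuousOn_targetEnergy (b₁ : ℝ) {W Z : ℝ → ℝ → ℝ}
    (hW : ContinuousOn (fun p : ℝ × ℝ => W p.1 p.2) (Icc 0 1 ×ˢ Ici 0))
    (hZ : ContinuousOn (fun p : ℝ × ℝ => Z p.1 p.2) (Icc 0 1 ×ˢ Ici 0)) :
    ContinuousOn (targetEnergy b₁ W Z) (Ici 0) :=
  (continuousOn_const.mul (continuousOn_integral_slice (F := fun x t => (1 + x) * W x t ^ 2)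
    (ContinuousOn.mul (by fun_prop) (hW.pow 2)))).add
  (continuousOn_const.mul (continuousOn_integral_slice (F := fun x t => (1 + x) * Z x t ^ 2)
    (ContinuousOn.mul (by fun_prop) (hZ.pow 2))))

theorem integral_weight_sq_nonneg (φ : ℝ → ℝ) : 0 ≤ ∫ x in (0 : ℝ)..1, (1 + x) * φ x ^ 2 :=
  intervalIntegral.integral_nonneg zero_le_one fun x hx =>
    mul_nonneg (by linarith [hx.1]) (sq_nonneg _)

theorem targetEnergy_nonneg {b₁ : ℝ} (hb : 0 ≤ b₁) (W Z : ℝ → ℝ → ℝ) (t : ℝ) :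
    0 ≤ targetEnergy b₁ W Z t :=
  add_nonneg (mul_nonneg (by norm_num) (integral_weight_sq_nonneg fun x => W x t))
    (mul_nonneg (by linarith) (integral_weight_sq_nonneg fun x => Z x t))

theorem exists_bound_of_P_le {W Z P : ℝ → ℝ → ℝ} {B₁ B₂ : ℝ}
    (hW : ContinuousOn (fun p : ℝ × ℝ => W p.1 p.2) (Icc 0 1 ×ˢ Ici 0))
    (hZ : ContinuousOn (fun p : ℝ × ℝ => Z p.1 p.2) (Icc 0 1 ×ˢ Ici 0))
    (hP : ∀ t ≥ 0, ∀ x ∈ Ioo (0 : ℝ) 1,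
      |P x t| ≤ B₁ * |Z 0 t| + B₂ * ∫ y in (0 : ℝ)..1, |W y t|) (T : ℝ) :
    ∃ C, 0 ≤ C ∧ ∀ x ∈ Ioo (0 : ℝ) 1, ∀ t ∈ Icc 0 T, |P x t| ≤ C := by
  have hc : ContinuousOn (fun t => B₁ * |Z 0 t| + B₂ * ∫ y in (0 : ℝ)..1, |W y t|) (Ici 0) :=
    (continuousOn_const.mul (hZ.comp (f := fun t => ((0 : ℝ), t)) (by fun_prop)
      fun t ht => ⟨⟨le_rfl, zero_le_one⟩, ht⟩).abs).add
    (continuousOn_const.mul (continuousOn_integral_slice (F := fun x t => |W x t|) hW.abs))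
  obtain ⟨C, hC, h⟩ := exists_bound_of_isCompact (isCompact_Icc (a := (0 : ℝ)) (b := T))
    (hc.mono Icc_subset_Ici_self)
  exact ⟨C, hC, fun x hx t ht => (hP t ht.1 x hx).trans ((le_abs_self _).trans (h t ht))⟩

theorem continuousOn_integral_Z_P {W Z P : ℝ → ℝ → ℝ} {B₁ B₂ : ℝ}
    (hW : ContinuousOn (fun p : ℝ × ℝ => W p.1 p.2) (Icc 0 1 ×ˢ Ici 0))
    (hZ : ContinuousOn (fun p : ℝ × ℝ => Z p.1 p.2) (Icc 0 1 ×ˢ Ici 0))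
    (hPc : ContinuousOn (fun p : ℝ × ℝ => P p.1 p.2) (Ioo 0 1 ×ˢ Ici 0))
    (hP : ∀ t ≥ 0, ∀ x ∈ Ioo (0 : ℝ) 1,
      |P x t| ≤ B₁ * |Z 0 t| + B₂ * ∫ y in (0 : ℝ)..1, |W y t|) :
    (∀ t ≥ 0, IntervalIntegrable (fun x => (1 + x) * Z x t * P x t) volume 0 1) ∧
      ContinuousOn (fun t => ∫ x in (0 : ℝ)..1, (1 + x) * Z x t * P x t) (Ici 0) := by
  refine continuousOn_integral_of_bounded (F := fun x t => (1 + x) * Z x t * P x t) ?_ ?_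
  · exact (ContinuousOn.mul (by fun_prop)
      (hZ.mono (prod_mono_left Ioo_subset_Icc_self))).mul hPc
  · intro T hT
    obtain ⟨C, hC, h⟩ := exists_bound_of_P_le hW hZ hP T
    obtain ⟨C', hC', h'⟩ := exists_bound_of_isCompact (isCompact_Icc.prod (isCompact_Icc
      (a := (0 : ℝ)) (b := T))) (hZ.mono (prod_mono_right Icc_subset_Ici_self))
    refine ⟨2 * C' * C, fun x hx t ht => ?_⟩
    rw [abs_mul, abs_mul]
    have h1 : |1 + x| ≤ 2 := by rw [abs_of_nonneg] <;> linarith [hx.1, hx.2]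
    exact mul_le_mul (mul_le_mul h1 (h' (x, t) ⟨Ioo_subset_Icc_self hx, ht⟩) (abs_nonneg _)
      zero_le_two) (h x hx t ht) (abs_nonneg _) (by positivity)

theorem continuousOn_targetDirection {b₁ : ℝ} (hb : 0 ≤ b₁) {W Z P : ℝ → ℝ → ℝ} {B₁ B₂ : ℝ}
    (hW : ContinuousOn (fun p : ℝ × ℝ => W p.1 p.2) (Icc 0 1 ×ˢ Ici 0))
    (hZ : ContinuousOn (fun p : ℝ × ℝ => Z p.1 p.2) (Icc 0 1 ×ˢ Ici 0))
    (hPc : ContinuousOn (fun p : ℝ × ℝ => P p.1 p.2) (Ioo 0 1 ×ˢ Ici 0))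
    (hP : ∀ t ≥ 0, ∀ x ∈ Ioo (0 : ℝ) 1,
      |P x t| ≤ B₁ * |Z 0 t| + B₂ * ∫ y in (0 : ℝ)..1, |W y t|) :
    ContinuousOn (targetDirection b₁ W Z P) (Ici 0) :=
  (continuousOn_const.mul (continuousOn_integral_Z_P hW hZ hPc hP).2).div
    (continuousOn_const.add (continuousOn_targetEnergy b₁ hW hZ))
    fun t _ => by linarith [targetEnergy_nonneg hb W Z t]

namespace IsClosedLoopSolution

variable {f : ℝ → ℝ → ℝ} {g : ℝ → ℝ} {K : Kernels f g} {Dlo Dhi b₁ θ D B₁ B₂ B₃ B₄ : ℝ}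
  {u v : ℝ → ℝ → ℝ} {Dhat : ℝ → ℝ}

/-- The backstepping transformation turns the closed loop into the target system. -/
theorem isTargetSolution (sol : IsClosedLoopSolution f g K Dlo Dhi b₁ θ D u v Dhat)
    (hf : ContinuousOn (fun p : ℝ × ℝ => f p.1 p.2) triangle) (hg : ContinuousOn g (Icc 0 1))
    (hDlo : 0 < Dlo) (hB : K.Bounds Dlo Dhi B₁ B₂ B₃ B₄) (hb : 0 ≤ b₁) (hθ : 0 ≤ θ)
    (hD : 0 < D) :
    IsTargetSolution Dlo Dhi b₁ θ D B₁ B₂ B₃ B₄ (fun x t => K.w (fun y => u y t) x)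
      (fun x t => K.z (Dhat t) (fun y => u y t) (fun y => v y t) x)
      (fun x t => K.P₁ (Dhat t) (fun y => u y t) (fun y => v y t) x)
      (fun x t => K.P₂ (Dhat t) (fun y => u y t) (fun y => v y t) x) Dhat := by
  have hr := sol.Dhat_mem hθ
  have hd0 : ∀ t ≥ 0, 0 < Dhat t := fun t ht => hDlo.trans_le (hr t ht).1
  have hW := sol.continuousOn_w
  have hZ := sol.continuousOn_z hDlo hr
  have hPc := sol.continuousOn_P₁ hf hDlo hr
  have hP : ∀ t ≥ 0, ∀ x ∈ Ioo (0 : ℝ) 1,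
      |K.P₁ (Dhat t) (fun y => u y t) (fun y => v y t) x|
        ≤ B₁ * |K.z (Dhat t) (fun y => u y t) (fun y => v y t) 0|
          + B₂ * ∫ y in (0 : ℝ)..1, |K.w (fun y => u y t) y| := fun t ht x hx =>
    hB.abs_P₁_le (hr t ht) (sol.u_slice ht) hx
  have hτ := continuousOn_targetDirection (b₁ := b₁) hb (W := fun x t => K.w (fun y => u y t) x)
    (Z := fun x t => K.z (Dhat t) (fun y => u y t) (fun y => v y t) x)
    (P := fun x t => K.P₁ (Dhat t) (fun y => u y t) (fun y => v y t) x) hW hZ hPc hP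
  have hd' : ∀ t ≥ 0, HasDerivWithinAt Dhat
      (θ * proj Dlo Dhi (Dhat t) (K.direction b₁ u v Dhat t)) (Ici t) t := fun t ht =>
    hasDerivWithinAt_of_projected_law hθ hτ sol.Dhat_cont hr
      (fun s hs t ht => sol.intervalIntegrable_update hs ht)
      (fun s hs t ht => sol.Dhat_sub hs ht) ht
  exact
    { W_cont := hW
      Z_cont := hZ
      P_cont := hPc
      d_cont := sol.Dhat_cont
      d_mem := hr
      W_transport := fun x t h h0 hhx hx ht => sol.w_characteristic hf hg h0 hhx hx ht
      W_inflow := fun t ht => (K.z_zero_eq_w_one (hd0 t ht) (sol.u_bc t ht)).symm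
      Z_inflow := fun t ht => by
        simp only [Kernels.z]
        rw [sol.v_bc t ht, Kernels.control]
        ring
      P_le := hP
      Q_le := fun t ht x hx =>
        hB.abs_P₂_le hf hg hDlo (hr t ht) (sol.u_slice ht) (sol.v_slice ht) hx
      d_deriv := hd'
      Z_deriv := fun t ht x hx => sol.hasDerivWithinAt_z hf hg hDlo hD hr ht (hd' t ht) hx }

end IsClosedLoopSolution

/-! ### Auxiliary inequalities -/

/-- The Cauchy-Schwarz inequality with a weight. -/
theorem sq_integral_weight_mul_le {ω φ : ℝ → ℝ} {a b : ℝ} (hab : a ≤ b)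
    (hω : ContinuousOn ω (Icc a b)) (hφ : ContinuousOn φ (Icc a b)) (h0 : ∀ x ∈ Icc a b, 0 ≤ ω x)
    (hpos : 0 < ∫ x in a..b, ω x) :
    (∫ x in a..b, ω x * φ x) ^ 2 ≤ (∫ x in a..b, ω x) * ∫ x in a..b, ω x * φ x ^ 2 := by
  have hi : ∀ {m : ℝ → ℝ}, ContinuousOn m (Icc a b) → IntervalIntegrable m volume a b :=
    fun h => ContinuousOn.intervalIntegrable (by rwa [uIcc_of_le hab])
  set I := ∫ x in a..b, ω x
  set J := ∫ x in a..b, ω x * φ x with hJ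
  have h1 : 0 ≤ ∫ x in a..b, ω x * (φ x - J / I) ^ 2 :=
    intervalIntegral.integral_nonneg hab fun x hx => mul_nonneg (h0 x hx) (sq_nonneg _)
  have h2 : ∫ x in a..b, ω x * (φ x - J / I) ^ 2
      = (∫ x in a..b, ω x * φ x ^ 2) - 2 * (J / I) * J + (J / I) ^ 2 * I := by
    rw [hJ, ← intervalIntegral.integral_const_mul, ← intervalIntegral.integral_const_mul,
      ← intervalIntegral.integral_sub, ← intervalIntegral.integral_add]
    · refine intervalIntegral.integral_congr fun x _ => ?_
      ring
    · exact hi ((hω.mul (hφ.pow 2)).sub (continuousOn_const.mul (hω.mul hφ)))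
    · exact hi (continuousOn_const.mul hω)
    · exact hi (hω.mul (hφ.pow 2))
    · exact hi (continuousOn_const.mul (hω.mul hφ))
  rw [h2] at h1
  have h3 : (J / I) * I = J := div_mul_cancel₀ _ hpos.ne'
  have h4 : J ^ 2 = (J / I) * J * I := by rw [mul_right_comm, h3, sq]
  have h5 : (J / I) ^ 2 * I = (J / I) * J := by rw [sq, mul_assoc, h3]
  rw [h5] at h1
  rw [h4, mul_comm I]
  exact mul_le_mul_of_nonneg_right (by linarith) hpos.le

theorem sq_integral_abs_le {φ : ℝ → ℝ} {a b : ℝ} (hab : a < b) (hφ : ContinuousOn φ (Icc a b)) :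
    (∫ x in a..b, |φ x|) ^ 2 ≤ (b - a) * ∫ x in a..b, φ x ^ 2 := by
  have := sq_integral_weight_mul_le (ω := fun _ => 1) hab.le continuousOn_const hφ.abs
    (fun _ _ => zero_le_one) (by simpa using hab)
  simpa using this

theorem sq_integral_weight_abs_le {φ : ℝ → ℝ} (hφ : ContinuousOn φ (Icc 0 1)) :
    (∫ x in (0 : ℝ)..1, (1 + x) * |φ x|) ^ 2 ≤ 3 / 2 * ∫ x in (0 : ℝ)..1, (1 + x) * φ x ^ 2 := by
  have h1 : ∫ x in (0 : ℝ)..1, (1 + x) = 3 / 2 := by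
    rw [intervalIntegral.integral_add (by simp) (by simp)]
    norm_num
  have := sq_integral_weight_mul_le (ω := fun x => 1 + x) zero_le_one (by fun_prop) hφ.abs
    (fun x hx => by linarith [hx.1]) (by rw [h1]; norm_num)
  simpa [h1] using this

/-- A weighted integral against a perturbation with a pointwise bound. -/
theorem abs_integral_weight_mul_le {φ m : ℝ → ℝ} {B : ℝ} (hφ : ContinuousOn φ (Icc 0 1))
    (h : ∀ x ∈ Ioo (0 : ℝ) 1, |m x| ≤ B) :
    |∫ x in (0 : ℝ)..1, (1 + x) * φ x * m x| ≤ B * ∫ x in (0 : ℝ)..1, (1 + x) * |φ x| := by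
  refine (abs_integral_mul_le (α := fun x => (1 + x) * φ x) (e := 0) zero_le_one
    (ContinuousOn.mul (by fun_prop) hφ) fun x hx _ => h x hx).trans_eq ?_
  congr 1
  refine intervalIntegral.integral_congr fun x hx => ?_
  rw [uIcc_of_le zero_le_one] at hx
  rw [abs_mul, abs_of_nonneg (by linarith [hx.1] : (0 : ℝ) ≤ 1 + x)]

/-- The gain condition lets the dissipation absorb the perturbation caused by the adaptation. The
numbers `z, a, e` stand for `|Z(0)|` and the norms of `W` and `Z`. -/
theorem adaptation_error_le {D b θ κ m L z a e P Q : ℝ} (hm : 0 < m) (hmD : m ≤ D)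
    (hb : 2 * D + m ≤ b) (hκ : 0 ≤ κ) (hθ : 0 ≤ θ) (hgain : θ * (2 * b ^ 2 * L ^ 2) ≤ κ * m)
    (hz : 0 ≤ z) (ha : 0 ≤ a) (he : 0 ≤ e) (hL : 0 ≤ L) (hQ : 0 ≤ Q)
    (hPL : P ≤ L * max z a) (hQL : Q ≤ L * max (e / 2) a) :
    3 * b * D * θ * (P * Q) ≤ κ * (m / 2 * z ^ 2 + D / 2 * a ^ 2 + b / 2 * e ^ 2) := by
  have hD : 0 < D := hm.trans_le hmD
  have hb0 : 0 < b := by linarith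
  set X := max z a
  set Y := max (e / 2) a
  have hX : 0 ≤ X := hz.trans (le_max_left _ _)
  have hY : 0 ≤ Y := ha.trans (le_max_right _ _)
  -- the remainder is at most `κ c X Y`, and `c` is small against the coefficients `m, D, b`
  set c := 3 * D * m / (2 * b) with hc
  have hc0 : 0 ≤ c := by positivity
  have hc1 : c ≤ D / 2 := by
    rw [hc, div_le_iff₀ (by positivity)]
    nlinarith
  have hc2 : c ≤ 3 * m / 4 := by
    rw [hc, div_le_iff₀ (by positivity)]
    nlinarith
  have h1 : 3 * b * D * θ * (P * Q) ≤ 3 * b * D * θ * ((L * X) * (L * Y)) :=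
    mul_le_mul_of_nonneg_left (mul_le_mul hPL hQL hQ (by positivity)) (by positivity)
  have h2 : 3 * b * D * θ * ((L * X) * (L * Y))
      = 3 * D / (2 * b) * (X * Y) * (θ * (2 * b ^ 2 * L ^ 2)) := by
    field_simp
  have h3 : 3 * D / (2 * b) * (X * Y) * (θ * (2 * b ^ 2 * L ^ 2))
      ≤ 3 * D / (2 * b) * (X * Y) * (κ * m) :=
    mul_le_mul_of_nonneg_left hgain (by positivity)
  have h4 : 3 * D / (2 * b) * (X * Y) * (κ * m) = κ * (c * (X * Y)) := by
    rw [hc]; ring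
  have h5 : c * (X * Y) ≤ m / 2 * z ^ 2 + D / 2 * a ^ 2 + b / 2 * e ^ 2 := by
    have hcc : c * c ≤ 3 * m / 4 * (D / 2) := mul_le_mul hc2 hc1 hc0 (by positivity)
    have ez : 0 ≤ m / 2 * z ^ 2 := by positivity
    have ea : 0 ≤ D / 2 * a ^ 2 := by positivity
    have ee : 0 ≤ b / 2 * e ^ 2 := by positivity
    have hae : c * (a * (e / 2)) ≤ D / 2 * a ^ 2 + b / 2 * e ^ 2 := by
      have : c * (a * (e / 2)) ≤ D / 2 * (a * (e / 2)) :=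
        mul_le_mul_of_nonneg_right hc1 (by positivity)
      nlinarith [sq_nonneg (a - e), mul_nonneg ha he, mul_nonneg hD.le (sq_nonneg (a - e)),
        mul_nonneg hD.le (mul_nonneg ha he), mul_nonneg (by linarith : 0 ≤ b - D) (sq_nonneg e)]
    have hze : c * (z * (e / 2)) ≤ m / 2 * z ^ 2 + b / 2 * e ^ 2 := by
      have : c * (z * (e / 2)) ≤ 3 * m / 4 * (z * (e / 2)) :=
        mul_le_mul_of_nonneg_right hc2 (by positivity)
      nlinarith [mul_nonneg hm.le (sq_nonneg (z - e)), mul_nonneg hm.le (mul_nonneg hz he),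
        mul_nonneg (by linarith : 0 ≤ b - m) (sq_nonneg e)]
    have hza : c * (z * a) ≤ m / 2 * z ^ 2 + D / 2 * a ^ 2 := by
      have : c * (z * a) ≤ 3 * m / 4 * (z * a) := mul_le_mul_of_nonneg_right hc2 (by positivity)
      nlinarith [mul_nonneg hm.le (sq_nonneg (z - a)), mul_nonneg hm.le (mul_nonneg hz ha),
        mul_nonneg (by linarith : 0 ≤ D - m) (sq_nonneg a)]
    have haa : c * (a * a) ≤ D / 2 * a ^ 2 := by
      rw [sq]; exact mul_le_mul_of_nonneg_right hc1 (by positivity)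
    rcases max_choice z a with hx | hx <;> rcases max_choice (e / 2) a with hy | hy
    all_goals
      simp only [X, Y, hx, hy]
      linarith
  calc _ ≤ _ := h1
    _ = _ := h2
    _ ≤ _ := h3
    _ = _ := h4
    _ ≤ _ := mul_le_mul_of_nonneg_left h5 hκ

/-! ### The energy of the target system -/

/-- The derivative `D Z_t - Z_x` of the second state of the target system. -/
noncomputable def targetRate (Dlo Dhi b₁ θ D : ℝ) (W Z P Q : ℝ → ℝ → ℝ) (d : ℝ → ℝ)
    (x t : ℝ) : ℝ :=
  -((D - d t) * P x t
    + D * (θ * proj Dlo Dhi (d t) (targetDirection b₁ W Z P t)) * Q x t)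

namespace IsTargetSolution

variable {Dlo Dhi b₁ θ D B₁ B₂ B₃ B₄ : ℝ} {W Z P Q : ℝ → ℝ → ℝ} {d : ℝ → ℝ}

/-- The equation for `Z` at a later point of a characteristic that starts at `x`; for `s > 0` the
starting point may be the boundary point `x = 1`. -/
theorem Z_deriv_characteristic (sol : IsTargetSolution Dlo Dhi b₁ θ D B₁ B₂ B₃ B₄ W Z P Q d)
    (hD : 0 < D) {x t s : ℝ} (hs : 0 ≤ s) (hx0 : s < x) (hx : x - s < 1) (ht : 0 ≤ t) :
    HasDerivWithinAt (fun s => Z (x - s) (t + D * s))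
      (targetRate Dlo Dhi b₁ θ D W Z P Q d (x - s) (t + D * s)) (Ici s) s := by
  have h := sol.Z_deriv (t + D * s) (by positivity) (x - s) ⟨by linarith, hx⟩
  refine hasDerivWithinAt_Ici_shift (h.congr_of_eventuallyEq ?_ ?_)
  · filter_upwards with r
    rw [sub_sub, mul_add, add_assoc]
  · simp

theorem abs_direction_le (sol : IsTargetSolution Dlo Dhi b₁ θ D B₁ B₂ B₃ B₄ W Z P Q d)
    (hb : 0 ≤ b₁) {t C : ℝ} (ht : 0 ≤ t) (hP : ∀ x ∈ Ioo (0 : ℝ) 1, |P x t| ≤ C) :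
    |targetDirection b₁ W Z P t|
      ≤ b₁ * (C * ∫ x in (0 : ℝ)..1, (1 + x) * |Z x t|) / (1 + targetEnergy b₁ W Z t) := by
  have hN : 0 < 1 + targetEnergy b₁ W Z t := by linarith [targetEnergy_nonneg hb W Z t]
  rw [targetDirection, abs_div, abs_of_pos hN, abs_mul, abs_neg, abs_of_nonneg hb]
  exact div_le_div_of_nonneg_right (mul_le_mul_of_nonneg_left
    (abs_integral_weight_mul_le (continuousOn_slice sol.Z_cont ht) hP) hb) hN.le

theorem exists_bound_rate (sol : IsTargetSolution Dlo Dhi b₁ θ D B₁ B₂ B₃ B₄ W Z P Q d)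
    (hb : 0 ≤ b₁) (T : ℝ) : ∃ C, 0 ≤ C ∧ ∀ x ∈ Ioo (0 : ℝ) 1, ∀ t ∈ Icc 0 T,
      |targetRate Dlo Dhi b₁ θ D W Z P Q d x t| ≤ C := by
  obtain ⟨CP, hCP, hP⟩ := exists_bound_of_P_le sol.W_cont sol.Z_cont sol.P_le T
  have hI : IsCompact (Icc 0 T) := isCompact_Icc
  have hQc : ContinuousOn (fun t => B₃ * (∫ y in (0 : ℝ)..1, |Z y t|)
      + B₄ * ∫ y in (0 : ℝ)..1, |W y t|) (Ici 0) :=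
    (continuousOn_const.mul (continuousOn_integral_slice (F := fun x t => |Z x t|)
      sol.Z_cont.abs)).add
    (continuousOn_const.mul (continuousOn_integral_slice (F := fun x t => |W x t|) sol.W_cont.abs))
  obtain ⟨CQ, hCQ, hQ⟩ := exists_bound_of_isCompact hI (hQc.mono Icc_subset_Ici_self)
  obtain ⟨Cτ, hCτ, hτ⟩ := exists_bound_of_isCompact hI ((continuousOn_targetDirection hb sol.W_cont
    sol.Z_cont sol.P_cont sol.P_le).mono Icc_subset_Ici_self)
  obtain ⟨Cd, hCd, hd⟩ := exists_bound_of_isCompact hI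
    ((continuousOn_const (c := D)).sub (sol.d_cont.mono Icc_subset_Ici_self))
  refine ⟨Cd * CP + |D| * (|θ| * Cτ) * CQ, by positivity, fun x hx t ht => ?_⟩
  rw [targetRate, abs_neg]
  refine (abs_add_le _ _).trans (add_le_add ?_ ?_)
  · rw [abs_mul]
    exact mul_le_mul (hd t ht) (hP x hx t ht) (abs_nonneg _) hCd
  · rw [abs_mul, abs_mul, abs_mul]
    have h1 := (abs_proj_le Dlo Dhi (d t) (targetDirection b₁ W Z P t)).trans (hτ t ht)
    have h2 := (sol.Q_le t ht.1 x hx).trans ((le_abs_self _).trans (hQ t ht))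
    gcongr

/-- The weighted energy of `Z`, differentiated along the flow. -/
theorem hasDerivWithinAt_integral_Z_sq
    (sol : IsTargetSolution Dlo Dhi b₁ θ D B₁ B₂ B₃ B₄ W Z P Q d)
    (hb : 0 ≤ b₁) (hD : 0 < D) {t : ℝ} (ht : 0 ≤ t) :
    IntervalIntegrable (fun x => (1 + x) * Z x t * targetRate Dlo Dhi b₁ θ D W Z P Q d x t)
      volume 0 1 ∧
    HasDerivWithinAt (fun h => ∫ x in (0 : ℝ)..1, (1 + x) * Z x (t + D * h) ^ 2)
      (-Z 0 t ^ 2 - (∫ x in (0 : ℝ)..1, Z x t ^ 2) + 2 * ∫ x in (0 : ℝ)..1,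
        (1 + x) * Z x t * targetRate Dlo Dhi b₁ θ D W Z P Q d x t) (Ici 0) 0 := by
  set G := targetRate Dlo Dhi b₁ θ D W Z P Q d with hG
  obtain ⟨CG, hCG, hGb⟩ := sol.exists_bound_rate hb (t + D)
  obtain ⟨CZ, hCZ, hZb⟩ := exists_bound_of_isCompact (isCompact_Icc.prod (isCompact_Icc
    (a := (0 : ℝ)) (b := t + D))) (sol.Z_cont.mono (prod_mono_right Icc_subset_Ici_self))
  have hflow : ∀ h ∈ Icc (0 : ℝ) 1, t + D * h ∈ Icc 0 (t + D) := fun h hh =>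
    ⟨by nlinarith [hh.1], by nlinarith [hh.2]⟩
  have hcont : ContinuousOn (fun q : ℝ × ℝ => (1 + q.2) * Z q.2 (t + D * q.1) ^ 2)
      (Icc 0 1 ×ˢ Icc 0 1) := by
    refine ContinuousOn.mul (by fun_prop) (ContinuousOn.pow (sol.Z_cont.comp
      (f := fun q : ℝ × ℝ => (q.2, t + D * q.1)) (by fun_prop) ?_) 2)
    rintro ⟨h, x⟩ ⟨h1, h2⟩
    exact ⟨h2, (hflow h h1).1⟩
  have hder : ∀ s x, 0 ≤ s → s < x → x - s < 1 →
      HasDerivWithinAt (fun s => (1 + (x - s)) * Z (x - s) (t + D * s) ^ 2)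
        (-Z (x - s) (t + D * s) ^ 2
          + (1 + (x - s)) * (2 * Z (x - s) (t + D * s) * G (x - s) (t + D * s))) (Ici s) s := by
    intro s x hs hsx hx
    have h1 := sol.Z_deriv_characteristic hD hs hsx hx ht
    have h2 : HasDerivWithinAt (fun s : ℝ => 1 + (x - s)) (-1) (Ici s) s :=
      (((hasDerivAt_id s).const_sub x).const_add 1).hasDerivWithinAt
    refine (h2.fun_mul (h1.fun_pow 2)).congr_deriv ?_
    simp only [hG]
    push_cast
    ring
  have key := hasDerivWithinAt_integral_transport
    (Φ := fun h x => (1 + x) * Z x (t + D * h) ^ 2)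
    (D := fun x => -Z x t ^ 2 + 2 * ((1 + x) * Z x t * G x t)) (a := 0) (b := 1) (c := 1)
    (δ := 1) (C := CZ ^ 2 + 2 * (2 * CZ * CG)) zero_lt_one zero_le_one zero_lt_one (by norm_num)
    (by positivity) hcont ?_ ?_
  · have hZ2 : IntervalIntegrable (fun x => Z x t ^ 2) volume 0 1 := by
      refine ContinuousOn.intervalIntegrable ?_
      rw [uIcc_of_le zero_le_one]
      exact (continuousOn_slice sol.Z_cont ht).pow 2
    have hi : IntervalIntegrable (fun x => (1 + x) * Z x t * G x t) volume 0 1 := by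
      refine ((key.1.add hZ2).const_mul (1 / 2)).congr fun x _ => ?_
      simp
    have hZn : IntervalIntegrable (fun x => -Z x t ^ 2) volume 0 1 := hZ2.neg
    refine ⟨hi, key.2.congr_deriv ?_⟩
    rw [intervalIntegral.integral_add hZn (hi.const_mul 2), intervalIntegral.integral_neg,
      intervalIntegral.integral_const_mul]
    simp only [mul_zero, add_zero, sol.Z_inflow t ht]
    ring
  · intro h hh y hy
    simp only [one_mul, zero_add] at hy ⊢
    have h3 := abs_sub_le_mul_of_right_deriv (a := 0) (b := h)
      (φ := fun s => (1 + (y - s)) * Z (y - s) (t + D * s) ^ 2)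
      (φ' := fun s => -Z (y - s) (t + D * s) ^ 2
          + (1 + (y - s)) * (2 * Z (y - s) (t + D * s) * G (y - s) (t + D * s)))
      (C := CZ ^ 2 + 2 * (2 * CZ * CG)) hh.1.le ?_ ?_ ?_
    · simpa using h3
    · refine hcont.comp (f := fun s => (s, y - s)) (by fun_prop) fun s hs => ?_
      exact ⟨⟨hs.1, hs.2.trans hh.2⟩, ⟨by linarith [hs.2, hy.1], by linarith [hs.1, hy.2]⟩⟩
    · intro s hs
      exact hder s y hs.1.le (hs.2.trans hy.1) (by linarith [hs.1, hy.2])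
    · intro s hs
      have hy' : y - s ∈ Ioo (0 : ℝ) 1 := ⟨by linarith [hs.2, hy.1], by linarith [hs.1, hy.2]⟩
      have hs' := hflow s ⟨hs.1.le, hs.2.le.trans hh.2⟩
      have e1 := hZb (y - s, t + D * s) ⟨Ioo_subset_Icc_self hy', hs'⟩
      have e2 := hGb (y - s) hy' (t + D * s) hs'
      have e3 : |1 + (y - s)| ≤ 2 := by rw [abs_of_nonneg] <;> linarith [hy'.1, hy'.2]
      refine (abs_add_le _ _).trans (add_le_add ?_ ?_)
      · rw [abs_neg, abs_pow]
        exact pow_le_pow_left₀ (abs_nonneg _) e1 2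
      · rw [abs_mul, abs_mul, abs_mul, abs_two]
        dsimp only at e1
        gcongr
  · refine Eventually.of_forall fun y hy => ?_
    have h3 := hder 0 y le_rfl hy.1 (by linarith [hy.2])
    simp only [one_mul]
    refine h3.congr_deriv ?_
    simp only [sub_zero, mul_zero, add_zero]
    ring

/-- The weighted energy of `W`, differentiated along the flow. -/
theorem hasDerivWithinAt_integral_W_sq
    (sol : IsTargetSolution Dlo Dhi b₁ θ D B₁ B₂ B₃ B₄ W Z P Q d) {t : ℝ} (ht : 0 ≤ t) :
    HasDerivWithinAt (fun h => ∫ x in (0 : ℝ)..1, (1 + x) * W x (t + h) ^ 2)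
      (2 * Z 0 t ^ 2 - W 0 t ^ 2 - ∫ x in (0 : ℝ)..1, W x t ^ 2) (Ici 0) 0 := by
  obtain ⟨CW, hCW, hWb⟩ := exists_bound_of_isCompact isCompact_Icc
    (continuousOn_slice sol.W_cont ht)
  have hW : ∀ x h, 0 ≤ h → h ≤ x → x ≤ 1 → W (x - h) (t + h) = W x t := fun x h h0 hhx hx =>
    sol.W_transport x t h h0 hhx hx ht
  have key := hasDerivWithinAt_integral_transport
    (Φ := fun h x => (1 + x) * W x (t + h) ^ 2)
    (D := fun x => -W x t ^ 2) (a := 0) (b := 1) (c := 1)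
    (δ := 1) (C := CW ^ 2) zero_lt_one zero_le_one zero_lt_one (by norm_num)
    (by positivity) ?_ ?_ ?_
  · refine key.2.congr_deriv ?_
    rw [intervalIntegral.integral_neg]
    simp only [add_zero, sol.W_inflow t ht]
    ring
  · refine ContinuousOn.mul (by fun_prop) (ContinuousOn.pow (sol.W_cont.comp
      (f := fun q : ℝ × ℝ => (q.2, t + q.1)) (by fun_prop) ?_) 2)
    rintro ⟨h, x⟩ ⟨h1, h2⟩
    exact ⟨h2, add_nonneg ht h1.1⟩
  · intro h hh y hy
    simp only [one_mul, zero_add, add_zero] at hy ⊢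
    rw [hW y h hh.1.le hy.1.le hy.2.le]
    have e : (1 + (y - h)) * W y t ^ 2 - (1 + y) * W y t ^ 2 = -(W y t ^ 2 * h) := by ring
    rw [e, abs_neg, abs_mul, abs_of_pos hh.1, abs_pow]
    exact mul_le_mul_of_nonneg_right (pow_le_pow_left₀ (abs_nonneg _)
      (hWb y ⟨hh.1.le.trans hy.1.le, hy.2.le⟩) 2) hh.1.le
  · refine Eventually.of_forall fun y hy => ?_
    have h2 : HasDerivWithinAt (fun s : ℝ => (1 + (y - s)) * W y t ^ 2) (-1 * W y t ^ 2)
        (Ici 0) 0 :=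
      ((((hasDerivAt_id (0 : ℝ)).const_sub y).const_add 1).mul_const _).hasDerivWithinAt
    rw [neg_one_mul] at h2
    simp only [one_mul]
    refine h2.congr_of_eventuallyEq ?_ (by simp)
    filter_upwards [Icc_mem_nhdsGE hy.1] with s hs
    rw [hW y s hs.1 hs.2 hy.2.le]

theorem hasDerivWithinAt_targetEnergy
    (sol : IsTargetSolution Dlo Dhi b₁ θ D B₁ B₂ B₃ B₄ W Z P Q d)
    (hb : 0 ≤ b₁) (hD : 0 < D) {t : ℝ} (ht : 0 ≤ t) :
    HasDerivWithinAt (targetEnergy b₁ W Z)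
      (1 / 2 * (2 * Z 0 t ^ 2 - W 0 t ^ 2 - ∫ x in (0 : ℝ)..1, W x t ^ 2)
        + b₁ / 2 * (D⁻¹ * (-Z 0 t ^ 2 - (∫ x in (0 : ℝ)..1, Z x t ^ 2) + 2 * ∫ x in (0 : ℝ)..1,
          (1 + x) * Z x t * targetRate Dlo Dhi b₁ θ D W Z P Q d x t))) (Ici t) t := by
  have h1 := hasDerivWithinAt_Ici_scale (inv_nonneg.2 hD.le)
    (sol.hasDerivWithinAt_integral_Z_sq hb hD ht).2
  have h2 := sol.hasDerivWithinAt_integral_W_sq ht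
  refine hasDerivWithinAt_Ici_shift (((h2.const_mul (1 / 2)).add (h1.const_mul
    (b₁ / 2))).congr_of_eventuallyEq ?_ ?_)
  · filter_upwards with s
    simp only [targetEnergy, Pi.add_apply]
    rw [mul_inv_cancel_left₀ hD.ne']
  · simp [targetEnergy]

end IsTargetSolution

/-! ### The Lyapunov function -/

/-- The Lyapunov function of the target system. -/
noncomputable def lyapunov (b₁ θ D : ℝ) (W Z : ℝ → ℝ → ℝ) (d : ℝ → ℝ) (t : ℝ) : ℝ :=
  D * Real.log (1 + targetEnergy b₁ W Z t) + (D - d t) ^ 2 / (2 * θ)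

/-- The quantities that are dissipated by the target system. -/
noncomputable def dissipation (W Z : ℝ → ℝ → ℝ) (t : ℝ) : ℝ :=
  Z 0 t ^ 2 + (∫ x in (0 : ℝ)..1, W x t ^ 2) + ∫ x in (0 : ℝ)..1, Z x t ^ 2

theorem integral_sq_nonneg (φ : ℝ → ℝ) : 0 ≤ ∫ x in (0 : ℝ)..1, φ x ^ 2 :=
  intervalIntegral.integral_nonneg zero_le_one fun _ _ => sq_nonneg _

theorem dissipation_nonneg (W Z : ℝ → ℝ → ℝ) (t : ℝ) : 0 ≤ dissipation W Z t :=
  add_nonneg (add_nonneg (sq_nonneg _) (integral_sq_nonneg fun x => W x t))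
    (integral_sq_nonneg fun x => Z x t)

theorem integral_abs_le_sqrt {φ : ℝ → ℝ} (hφ : ContinuousOn φ (Icc 0 1)) :
    ∫ x in (0 : ℝ)..1, |φ x| ≤ √(∫ x in (0 : ℝ)..1, φ x ^ 2) := by
  refine Real.le_sqrt_of_sq_le ?_
  simpa using sq_integral_abs_le zero_lt_one hφ

theorem integral_abs_nonneg (φ : ℝ → ℝ) : 0 ≤ ∫ x in (0 : ℝ)..1, |φ x| :=
  intervalIntegral.integral_nonneg zero_le_one fun _ _ => abs_nonneg _

namespace IsTargetSolution

variable {Dlo Dhi b₁ θ D B₁ B₂ B₃ B₄ : ℝ} {W Z P Q : ℝ → ℝ → ℝ} {d : ℝ → ℝ}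

/-- The mixed term of the energy balance splits into a part matched by the update law and a part
due to the variation of the delay estimate, which is of second order in the perturbations. -/
theorem exists_mixed_term_eq (sol : IsTargetSolution Dlo Dhi b₁ θ D B₁ B₂ B₃ B₄ W Z P Q d)
    (hb : 0 ≤ b₁) (hθ : 0 ≤ θ) (hD : 0 < D) (hB₁ : 0 ≤ B₁) (hB₂ : 0 ≤ B₂) (hB₃ : 0 ≤ B₃)
    (hB₄ : 0 ≤ B₄) {t : ℝ} (ht : 0 ≤ t) :
    ∃ E, b₁ * (∫ x in (0 : ℝ)..1, (1 + x) * Z x t * targetRate Dlo Dhi b₁ θ D W Z P Q d x t)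
        = (D - d t) * targetDirection b₁ W Z P t * (1 + targetEnergy b₁ W Z t) - b₁ * D * E ∧
      |E| ≤ 3 * θ * ((B₁ * |Z 0 t| + B₂ * ∫ y in (0 : ℝ)..1, |W y t|) *
        (B₃ * (∫ y in (0 : ℝ)..1, |Z y t|) + B₄ * ∫ y in (0 : ℝ)..1, |W y t|)) := by
  set τ := targetDirection b₁ W Z P t with hτ
  set N := targetEnergy b₁ W Z t with hN
  set G := targetRate Dlo Dhi b₁ θ D W Z P Q d with hG
  set p := proj Dlo Dhi (d t) τ with hp
  set Pm := B₁ * |Z 0 t| + B₂ * ∫ y in (0 : ℝ)..1, |W y t| with hPm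
  set Qm := B₃ * (∫ y in (0 : ℝ)..1, |Z y t|) + B₄ * ∫ y in (0 : ℝ)..1, |W y t| with hQm
  set J := ∫ x in (0 : ℝ)..1, (1 + x) * |Z x t| with hJ
  have hN0 : 0 < 1 + N := by linarith [targetEnergy_nonneg hb W Z t]
  have hPm0 : 0 ≤ Pm := add_nonneg (mul_nonneg hB₁ (abs_nonneg _))
    (mul_nonneg hB₂ (integral_abs_nonneg fun y => W y t))
  have hQm0 : 0 ≤ Qm := add_nonneg (mul_nonneg hB₃ (integral_abs_nonneg fun y => Z y t))
    (mul_nonneg hB₄ (integral_abs_nonneg fun y => W y t))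
  have hJ0 : 0 ≤ J := intervalIntegral.integral_nonneg zero_le_one fun x hx =>
    mul_nonneg (by linarith [hx.1]) (abs_nonneg _)
  have iP := (continuousOn_integral_Z_P sol.W_cont sol.Z_cont sol.P_cont sol.P_le).1 t ht
  have iG := (sol.hasDerivWithinAt_integral_Z_sq hb hD ht).1
  have iE : IntervalIntegrable (fun x => (1 + x) * Z x t * (θ * p * Q x t)) volume 0 1 := by
    refine ((iG.neg.sub (iP.const_mul (D - d t))).const_mul D⁻¹).congr fun x _ => ?_
    simp only [targetRate, Pi.neg_apply]
    field_simp
    ring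
  refine ⟨∫ x in (0 : ℝ)..1, (1 + x) * Z x t * (θ * p * Q x t), ?_, ?_⟩
  · have h1 : ∫ x in (0 : ℝ)..1, (1 + x) * Z x t * G x t
        = -(D - d t) * (∫ x in (0 : ℝ)..1, (1 + x) * Z x t * P x t)
          - D * ∫ x in (0 : ℝ)..1, (1 + x) * Z x t * (θ * p * Q x t) := by
      rw [← intervalIntegral.integral_const_mul, ← intervalIntegral.integral_const_mul,
        ← intervalIntegral.integral_sub (iP.const_mul _) (iE.const_mul _)]
      refine intervalIntegral.integral_congr fun x _ => ?_
      simp only [hG, targetRate]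
      ring
    have h2 : τ * (1 + N) = -b₁ * ∫ x in (0 : ℝ)..1, (1 + x) * Z x t * P x t := by
      rw [hτ, targetDirection, div_mul_cancel₀ _ hN0.ne']
    rw [h1, mul_assoc (D - d t), h2]
    ring
  · have h3 : |τ| * J ≤ 3 * Pm := by
      have h4 : |τ| ≤ b₁ * (Pm * J) / (1 + N) := sol.abs_direction_le hb ht (sol.P_le t ht)
      have h5 : J ^ 2 ≤ 3 / 2 * ∫ x in (0 : ℝ)..1, (1 + x) * Z x t ^ 2 :=
        sq_integral_weight_abs_le (continuousOn_slice sol.Z_cont ht)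
      have h6 : b₁ * J ^ 2 ≤ 3 * (1 + N) := by
        have := integral_weight_sq_nonneg fun x => W x t
        have := mul_le_mul_of_nonneg_left h5 hb
        rw [hN, targetEnergy]
        linarith
      calc |τ| * J ≤ b₁ * (Pm * J) / (1 + N) * J := mul_le_mul_of_nonneg_right h4 hJ0
        _ = Pm * (b₁ * J ^ 2) / (1 + N) := by ring
        _ ≤ Pm * (3 * (1 + N)) / (1 + N) :=
          div_le_div_of_nonneg_right (mul_le_mul_of_nonneg_left h6 hPm0) hN0.le
        _ = 3 * Pm := by field_simp
    have h7 : |∫ x in (0 : ℝ)..1, (1 + x) * Z x t * (θ * p * Q x t)| ≤ θ * |τ| * Qm * J := by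
      refine abs_integral_weight_mul_le (continuousOn_slice sol.Z_cont ht) fun x hx => ?_
      rw [abs_mul, abs_mul, abs_of_nonneg hθ]
      have h8 := abs_proj_le Dlo Dhi (d t) τ
      have h9 := sol.Q_le t ht x hx
      gcongr
    calc _ ≤ θ * |τ| * Qm * J := h7
      _ = θ * Qm * (|τ| * J) := by ring
      _ ≤ θ * Qm * (3 * Pm) := mul_le_mul_of_nonneg_left h3 (mul_nonneg hθ hQm0)
      _ = _ := by ring

/-- The Lyapunov function decreases along the target system. The logarithm normalizes the energy
so that the mixed term is cancelled exactly by the update law, up to the effect of the projection,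
which has the right sign, and up to a remainder that the gain condition makes harmless. -/
theorem exists_hasDerivWithinAt_lyapunov
    (sol : IsTargetSolution Dlo Dhi b₁ θ D B₁ B₂ B₃ B₄ W Z P Q d) {m κ L : ℝ} (hm : 0 < m)
    (hmD : m ≤ D) (hb : 2 * D + m ≤ b₁) (hκ : 0 ≤ κ) (hκ' : κ ≤ 1) (hθ : 0 < θ)
    (hgain : θ * (2 * b₁ ^ 2 * L ^ 2) ≤ κ * m) (hD : D ∈ Icc Dlo Dhi)
    (hB₁ : 0 ≤ B₁) (hB₂ : 0 ≤ B₂) (hB₃ : 0 ≤ B₃) (hB₄ : 0 ≤ B₄) (hL₁ : B₁ + B₂ ≤ L)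
    (hL₂ : 2 * B₃ + B₄ ≤ L) {t : ℝ} (ht : 0 ≤ t) :
    ∃ V', HasDerivWithinAt (lyapunov b₁ θ D W Z d) V' (Ici t) t ∧
      V' ≤ -((1 - κ) * (m / 2) * dissipation W Z t / (1 + targetEnergy b₁ W Z t)) := by
  have hD0 : 0 < D := hm.trans_le hmD
  have hb0 : 0 < b₁ := by linarith
  obtain ⟨E, hE, hEb⟩ := sol.exists_mixed_term_eq hb0.le hθ.le hD0 hB₁ hB₂ hB₃ hB₄ ht
  have hN' := sol.hasDerivWithinAt_targetEnergy hb0.le hD0 ht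
  have hd' := sol.d_deriv t ht
  set τ := targetDirection b₁ W Z P t
  set p := proj Dlo Dhi (d t) τ
  set IG := ∫ x in (0 : ℝ)..1, (1 + x) * Z x t * targetRate Dlo Dhi b₁ θ D W Z P Q d x t
  set A := ∫ x in (0 : ℝ)..1, W x t ^ 2 with hA
  set S := ∫ x in (0 : ℝ)..1, Z x t ^ 2 with hS
  have hN0 : 0 < 1 + targetEnergy b₁ W Z t := by linarith [targetEnergy_nonneg hb0.le W Z t]
  have hA0 : 0 ≤ A := integral_sq_nonneg fun x => W x t
  have hS0 : 0 ≤ S := integral_sq_nonneg fun x => Z x t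
  have h1 := ((hN'.const_add 1).log hN0.ne').const_mul D
  have h2 := ((hd'.const_sub D).fun_pow 2).div_const (2 * θ)
  refine ⟨_, h1.add h2, ?_⟩
  -- `D N' / (1 + N)`, with the mixed term replaced, and the derivative of the estimation error
  have hV : D * ((1 / 2 * (2 * Z 0 t ^ 2 - W 0 t ^ 2 - A)
      + b₁ / 2 * (D⁻¹ * (-Z 0 t ^ 2 - S + 2 * IG))) / (1 + targetEnergy b₁ W Z t))
      + (2 : ℕ) * (D - d t) ^ (2 - 1) * (-(θ * p)) / (2 * θ)
      = (-((b₁ / 2 - D) * Z 0 t ^ 2) - D / 2 * W 0 t ^ 2 - D / 2 * A - b₁ / 2 * S - b₁ * D * E)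
        / (1 + targetEnergy b₁ W Z t) + (D - d t) * (τ - p) := by
    have e1 : (2 : ℕ) * (D - d t) ^ (2 - 1) * (-(θ * p)) / (2 * θ) = -((D - d t) * p) := by
      push_cast
      field_simp
    have e2 : D * ((1 / 2 * (2 * Z 0 t ^ 2 - W 0 t ^ 2 - A)
      + b₁ / 2 * (D⁻¹ * (-Z 0 t ^ 2 - S + 2 * IG))) / (1 + targetEnergy b₁ W Z t))
      = (-((b₁ / 2 - D) * Z 0 t ^ 2) - D / 2 * W 0 t ^ 2 - D / 2 * A - b₁ / 2 * S + b₁ * IG)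
        / (1 + targetEnergy b₁ W Z t) := by
      field_simp
      ring
    rw [e1, e2, hE]
    field_simp
    ring
  rw [hV]
  have h3 : (D - d t) * (τ - p) ≤ 0 := mul_sub_proj_nonpos hD
  have hW1 : ∫ y in (0 : ℝ)..1, |W y t| ≤ √A :=
    integral_abs_le_sqrt (continuousOn_slice sol.W_cont ht)
  have hZ1 : ∫ y in (0 : ℝ)..1, |Z y t| ≤ √S :=
    integral_abs_le_sqrt (continuousOn_slice sol.Z_cont ht)
  have hL : 0 ≤ L := by linarith
  have herr := adaptation_error_le (z := |Z 0 t|) (a := √A) (e := √S)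
    (P := B₁ * |Z 0 t| + B₂ * ∫ y in (0 : ℝ)..1, |W y t|)
    (Q := B₃ * (∫ y in (0 : ℝ)..1, |Z y t|) + B₄ * ∫ y in (0 : ℝ)..1, |W y t|)
    hm hmD hb hκ hθ.le hgain (abs_nonneg _) (Real.sqrt_nonneg _) (Real.sqrt_nonneg _) hL
    (add_nonneg (mul_nonneg hB₃ (integral_abs_nonneg fun y => Z y t))
      (mul_nonneg hB₄ (integral_abs_nonneg fun y => W y t))) ?_ ?_
  · rw [sq_abs, Real.sq_sqrt hA0, Real.sq_sqrt hS0] at herr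
    have h4 : -(b₁ * D * E) ≤ κ * (m / 2 * Z 0 t ^ 2 + D / 2 * A + b₁ / 2 * S) := by
      refine le_trans ?_ herr
      have := mul_le_mul_of_nonneg_left hEb (mul_nonneg hb0.le hD0.le)
      have := mul_le_mul_of_nonneg_left (neg_le_abs E) (mul_nonneg hb0.le hD0.le)
      linarith
    have h5 : -((b₁ / 2 - D) * Z 0 t ^ 2) - D / 2 * W 0 t ^ 2 - D / 2 * A - b₁ / 2 * S - b₁ * D * E
        ≤ -((1 - κ) * (m / 2) * dissipation W Z t) := by
      have e1 : m / 2 * Z 0 t ^ 2 ≤ (b₁ / 2 - D) * Z 0 t ^ 2 :=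
        mul_le_mul_of_nonneg_right (by linarith) (sq_nonneg _)
      have e2 : 0 ≤ D / 2 * W 0 t ^ 2 := by positivity
      have e3 : m / 2 * A ≤ D / 2 * A := mul_le_mul_of_nonneg_right (by linarith) hA0
      have e4 : m / 2 * S ≤ b₁ / 2 * S := mul_le_mul_of_nonneg_right (by linarith) hS0
      have e5 : (1 - κ) * (m / 2 * Z 0 t ^ 2 + m / 2 * A + m / 2 * S)
          ≤ (1 - κ) * (m / 2 * Z 0 t ^ 2 + D / 2 * A + b₁ / 2 * S) :=
        mul_le_mul_of_nonneg_left (by linarith) (by linarith)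
      have e6 : (1 - κ) * (m / 2) * dissipation W Z t
          = (1 - κ) * (m / 2 * Z 0 t ^ 2 + m / 2 * A + m / 2 * S) := by
        rw [dissipation]; ring
      linarith
    have h6 := div_le_div_of_nonneg_right h5 hN0.le
    rw [neg_div] at h6
    linarith
  · have e1 := mul_le_mul_of_nonneg_left (le_max_left |Z 0 t| (√A)) hB₁
    have e2 := mul_le_mul_of_nonneg_left (hW1.trans (le_max_right |Z 0 t| (√A))) hB₂
    have e3 := mul_le_mul_of_nonneg_right hL₁ ((abs_nonneg (Z 0 t)).trans (le_max_left _ (√A)))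
    linarith
  · have e1 := mul_le_mul_of_nonneg_left (le_max_left (√S / 2) (√A)) hB₃
    have e2 := mul_le_mul_of_nonneg_left (hW1.trans (le_max_right (√S / 2) (√A))) hB₄
    have e3 := mul_le_mul_of_nonneg_right hL₂
      ((Real.sqrt_nonneg A).trans (le_max_right (√S / 2) (√A)))
    have e4 := mul_le_mul_of_nonneg_left hZ1 hB₃
    linarith

theorem continuousOn_dissipation (sol : IsTargetSolution Dlo Dhi b₁ θ D B₁ B₂ B₃ B₄ W Z P Q d) :
    ContinuousOn (dissipation W Z) (Ici 0) :=
  (((sol.Z_cont.comp (f := fun t => ((0 : ℝ), t)) (by fun_prop)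
    fun t ht => ⟨⟨le_rfl, zero_le_one⟩, ht⟩).pow 2).add
    (continuousOn_integral_slice (F := fun x t => W x t ^ 2) (sol.W_cont.pow 2))).add
    (continuousOn_integral_slice (F := fun x t => Z x t ^ 2) (sol.Z_cont.pow 2))

theorem continuousOn_lyapunov (sol : IsTargetSolution Dlo Dhi b₁ θ D B₁ B₂ B₃ B₄ W Z P Q d)
    (hb : 0 ≤ b₁) : ContinuousOn (lyapunov b₁ θ D W Z d) (Ici 0) :=
  (continuousOn_const.mul ((continuousOn_const.add (continuousOn_targetEnergy b₁ sol.W_cont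
    sol.Z_cont)).log fun t _ =>
      (by linarith [targetEnergy_nonneg hb W Z t] : 0 < 1 + targetEnergy b₁ W Z t).ne')).add
    (((continuousOn_const.sub sol.d_cont).pow 2).div_const _)

end IsTargetSolution

/-- The integrated form of a differential inequality `V' ≤ -S`, for right derivatives. -/
theorem add_integral_le_of_right_deriv {V S : ℝ → ℝ} (hV : ContinuousOn V (Ici 0))
    (hS : ContinuousOn S (Ici 0))
    (h : ∀ t ≥ 0, ∃ V', HasDerivWithinAt V V' (Ici t) t ∧ V' ≤ -S t) {T : ℝ} (hT : 0 ≤ T) :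
    V T + ∫ t in (0 : ℝ)..T, S t ≤ V 0 := by
  have hi : ∀ t ≥ 0, IntervalIntegrable S volume 0 t := fun t ht => by
    refine ContinuousOn.intervalIntegrable ?_
    rw [uIcc_of_le ht]
    exact hS.mono fun s hs => hs.1
  have hi' : ∀ t ≥ 0, HasDerivWithinAt (fun t => ∫ s in (0 : ℝ)..t, S s) (S t) (Ici t) t :=
    fun t ht => by
      refine intervalIntegral.integral_hasDerivWithinAt_right (hi t ht) (s := Ici t) (t := Ioi t)
        ⟨Ioc t (t + 1), Ioc_mem_nhdsGT (lt_add_one t), ?_⟩ ?_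
      · refine ContinuousOn.aestronglyMeasurable (hS.mono fun s hs => ?_) measurableSet_Ioc
        exact ht.trans hs.1.le
      · exact (hS t ht).mono fun s hs => ht.trans (le_of_lt hs)
  have hc : ContinuousOn (fun t => ∫ s in (0 : ℝ)..t, S s) (Icc 0 T) := by
    have := intervalIntegral.continuousOn_primitive_interval' (hi T hT) left_mem_uIcc
    rwa [uIcc_of_le hT] at this
  choose! V' hV' hle using h
  have key := image_le_of_deriv_right_le_deriv_boundary (f := V) (f' := V')
    (B := fun t => V 0 - ∫ s in (0 : ℝ)..t, S s) (B' := fun t => -S t) (a := 0) (b := T)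
    (hV.mono fun s hs => hs.1) (fun t ht => hV' t ht.1) (by simp) (continuousOn_const.sub hc)
    (fun t ht => (hi' t ht.1).const_sub _) (fun t ht => hle t ht.1) ⟨hT, le_rfl⟩
  linarith

/-! ### Decay of the target system -/

theorem integral_weight_sq_bounds {φ : ℝ → ℝ} (hφ : ContinuousOn φ (Icc 0 1)) :
    (∫ x in (0 : ℝ)..1, φ x ^ 2) ≤ (∫ x in (0 : ℝ)..1, (1 + x) * φ x ^ 2) ∧
      (∫ x in (0 : ℝ)..1, (1 + x) * φ x ^ 2) ≤ 2 * ∫ x in (0 : ℝ)..1, φ x ^ 2 := by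
  have hi : ∀ {m : ℝ → ℝ}, ContinuousOn m (Icc 0 1) → IntervalIntegrable m volume 0 1 :=
    fun h => ContinuousOn.intervalIntegrable (by rwa [uIcc_of_le zero_le_one])
  have h1 := hi (hφ.pow 2)
  have h2 := hi (ContinuousOn.mul (f := fun x : ℝ => 1 + x) (by fun_prop) (hφ.pow 2))
  rw [← intervalIntegral.integral_const_mul]
  constructor
  · refine intervalIntegral.integral_mono_on zero_le_one h1 h2 fun x hx => ?_
    nlinarith [hx.1, sq_nonneg (φ x)]
  · refine intervalIntegral.integral_mono_on zero_le_one h2 (h1.const_mul 2) fun x hx => ?_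
    nlinarith [hx.2, sq_nonneg (φ x)]

/-- If the integrals `∫_0^T S` of a nonnegative function are bounded, then the integrals over late
time intervals are uniformly small. -/
theorem exists_tail_bound {S : ℝ → ℝ} {M : ℝ} (hS : ContinuousOn S (Ici 0))
    (h0 : ∀ t ≥ 0, 0 ≤ S t) (hM : ∀ T ≥ 0, ∫ t in (0 : ℝ)..T, S t ≤ M) {ε : ℝ} (hε : 0 < ε) :
    ∃ T ≥ 0, ∀ s t, T ≤ s → s ≤ t → ∫ r in s..t, S r ≤ ε := by
  have hi : ∀ s ≥ 0, ∀ t ≥ 0, IntervalIntegrable S volume s t := fun s hs t ht =>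
    (hS.mono fun r hr => (le_inf hs ht).trans hr.1).intervalIntegrable
  have hne : ((fun T => ∫ t in (0 : ℝ)..T, S t) '' Ici 0).Nonempty := ⟨_, 0, mem_Ici.2 le_rfl, rfl⟩
  have hbdd : BddAbove ((fun T => ∫ t in (0 : ℝ)..T, S t) '' Ici 0) := by
    refine ⟨M, ?_⟩
    rintro _ ⟨T, hT, rfl⟩
    exact hM T hT
  obtain ⟨_, ⟨T, hT, rfl⟩, hlt⟩ := exists_lt_of_lt_csSup hne (sub_lt_self _ hε)
  refine ⟨T, hT, fun s t hTs hst => ?_⟩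
  have hs : 0 ≤ s := le_trans hT hTs
  have ht : 0 ≤ t := hs.trans hst
  have h1 := le_csSup hbdd ⟨t, ht, rfl⟩
  have h2 := intervalIntegral.integral_add_adjacent_intervals (hi 0 le_rfl T hT) (hi T hT s hs)
  have h3 := intervalIntegral.integral_add_adjacent_intervals (hi 0 le_rfl s hs) (hi s hs t ht)
  have h4 : 0 ≤ ∫ r in T..s, S r := intervalIntegral.integral_nonneg hTs fun r hr =>
    h0 r (le_trans hT hr.1)
  dsimp only at h1 hlt
  linarith

namespace IsTargetSolution

variable {Dlo Dhi b₁ θ D B₁ B₂ B₃ B₄ : ℝ} {W Z P Q : ℝ → ℝ → ℝ} {d : ℝ → ℝ}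

/-- As long as the energy is bounded, the rate of change of `Z` along characteristics is controlled
by quantities that are dissipated. -/
theorem exists_abs_rate_le (sol : IsTargetSolution Dlo Dhi b₁ θ D B₁ B₂ B₃ B₄ W Z P Q d)
    (hb : 0 < b₁) (hθ : 0 ≤ θ) (hDlo : 0 < Dlo) (hD : D ∈ Icc Dlo Dhi) (hB₁ : 0 ≤ B₁)
    (hB₂ : 0 ≤ B₂) (hB₃ : 0 ≤ B₃) (hB₄ : 0 ≤ B₄) {M : ℝ}
    (hM : ∀ t ≥ 0, targetEnergy b₁ W Z t ≤ M) :
    ∃ C, 0 ≤ C ∧ ∀ t ≥ 0, ∀ x ∈ Ioo (0 : ℝ) 1, |targetRate Dlo Dhi b₁ θ D W Z P Q d x t|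
      ≤ C * (|Z 0 t| + ∫ y in (0 : ℝ)..1, |W y t|) := by
  have hD0 : 0 < D := hDlo.trans_le hD.1
  set CQ := B₃ * √(2 * M / b₁) + B₄ * √(2 * M) with hCQ
  have hCQ0 : 0 ≤ CQ := by positivity
  refine ⟨Dhi * (B₁ + B₂) + D * (θ * (b₁ * ((B₁ + B₂) * √(3 * M / b₁)))) * CQ, ?_, ?_⟩
  · have : 0 ≤ Dhi := hD0.le.trans hD.2
    positivity
  intro t ht x hx
  set ζ := |Z 0 t| + ∫ y in (0 : ℝ)..1, |W y t| with hζ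
  have hWn : 0 ≤ ∫ y in (0 : ℝ)..1, |W y t| := integral_abs_nonneg fun y => W y t
  have hζ0 : 0 ≤ ζ := add_nonneg (abs_nonneg _) hWn
  have hP : ∀ x ∈ Ioo (0 : ℝ) 1, |P x t| ≤ (B₁ + B₂) * ζ := fun x hx => by
    have := mul_nonneg hB₁ hWn
    have := mul_nonneg hB₂ (abs_nonneg (Z 0 t))
    have := sol.P_le t ht x hx
    rw [hζ]
    linarith
  have hN : 0 ≤ targetEnergy b₁ W Z t := targetEnergy_nonneg hb.le W Z t
  have hWc := continuousOn_slice sol.W_cont ht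
  have hZc := continuousOn_slice sol.Z_cont ht
  have hEW := integral_weight_sq_nonneg fun x => W x t
  have hEZ := integral_weight_sq_nonneg fun x => Z x t
  have hW2 := (integral_weight_sq_bounds hWc).1
  have hZ2 := (integral_weight_sq_bounds hZc).1
  have hMt := hM t ht
  rw [targetEnergy] at hMt
  have hbZ := mul_nonneg hb.le hEZ
  have hEZM : ∫ x in (0 : ℝ)..1, (1 + x) * Z x t ^ 2 ≤ 2 * M / b₁ := by
    rw [le_div_iff₀ hb]
    linarith
  have hQ : |Q x t| ≤ CQ := by
    refine (sol.Q_le t ht x hx).trans (add_le_add (mul_le_mul_of_nonneg_left ?_ hB₃)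
      (mul_le_mul_of_nonneg_left ?_ hB₄))
    · exact (integral_abs_le_sqrt hZc).trans (Real.sqrt_le_sqrt (hZ2.trans hEZM))
    · exact (integral_abs_le_sqrt hWc).trans (Real.sqrt_le_sqrt (by linarith))
  have hτ : |targetDirection b₁ W Z P t| ≤ b₁ * ((B₁ + B₂) * √(3 * M / b₁)) * ζ := by
    have hJ : ∫ x in (0 : ℝ)..1, (1 + x) * |Z x t| ≤ √(3 * M / b₁) := by
      refine Real.le_sqrt_of_sq_le ((sq_integral_weight_abs_le hZc).trans ?_)
      calc _ ≤ 3 / 2 * (2 * M / b₁) := mul_le_mul_of_nonneg_left hEZM (by norm_num)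
        _ = _ := by ring
    have hJ0 : 0 ≤ ∫ x in (0 : ℝ)..1, (1 + x) * |Z x t| :=
      intervalIntegral.integral_nonneg zero_le_one fun x hx =>
        mul_nonneg (by linarith [hx.1]) (abs_nonneg _)
    calc _ ≤ _ := sol.abs_direction_le hb.le ht hP
      _ ≤ b₁ * ((B₁ + B₂) * ζ * ∫ x in (0 : ℝ)..1, (1 + x) * |Z x t|) :=
        div_le_self (by positivity) (by linarith)
      _ ≤ b₁ * ((B₁ + B₂) * ζ * √(3 * M / b₁)) := by gcongr
      _ = _ := by ring
  rw [targetRate, abs_neg, add_mul]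
  refine (abs_add_le _ _).trans (add_le_add ?_ ?_)
  · have hdt := sol.d_mem t ht
    have : |D - d t| ≤ Dhi := by
      rw [abs_le]
      constructor <;> linarith [hdt.1, hdt.2, hD.1, hD.2]
    rw [abs_mul, mul_assoc]
    exact mul_le_mul this (hP x hx) (abs_nonneg _) ((abs_nonneg _).trans this)
  · have h1 := (abs_proj_le Dlo Dhi (d t) (targetDirection b₁ W Z P t)).trans hτ
    rw [abs_mul, abs_mul, abs_mul, abs_of_pos hD0, abs_of_nonneg hθ]
    calc _ ≤ D * (θ * (b₁ * ((B₁ + B₂) * √(3 * M / b₁)) * ζ)) * CQ := by gcongr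
      _ = _ := by ring

/-- The value of `Z` is an integral, over the transit time, of dissipated quantities. -/
theorem sq_Z_le (sol : IsTargetSolution Dlo Dhi b₁ θ D B₁ B₂ B₃ B₄ W Z P Q d)
    (hD : 0 < D) {C : ℝ} (hC : 0 ≤ C)
    (hG : ∀ t ≥ 0, ∀ x ∈ Ioo (0 : ℝ) 1, |targetRate Dlo Dhi b₁ θ D W Z P Q d x t|
      ≤ C * (|Z 0 t| + ∫ y in (0 : ℝ)..1, |W y t|)) {t h : ℝ} (ht : 0 ≤ t) (h0 : 0 ≤ h)
    (h1 : h ≤ 1) :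
    Z (1 - h) (t + D * h) ^ 2 ≤ 2 * C ^ 2 / D * ∫ s in t..(t + D), dissipation W Z s := by
  set ζ := fun t => |Z 0 t| + ∫ y in (0 : ℝ)..1, |W y t| with hζ
  have hζc : ContinuousOn ζ (Ici 0) :=
    (sol.Z_cont.comp (f := fun t => ((0 : ℝ), t)) (by fun_prop)
      fun t ht => ⟨⟨le_rfl, zero_le_one⟩, ht⟩).abs.add
    (continuousOn_integral_slice (F := fun x t => |W x t|) sol.W_cont.abs)
  have hζ0 : ∀ t, 0 ≤ ζ t := fun t => add_nonneg (abs_nonneg _) (integral_abs_nonneg fun y => W y t)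
  have hζS : ∀ t ≥ 0, ζ t ^ 2 ≤ 2 * dissipation W Z t := fun t ht => by
    have e1 := sq_integral_abs_le zero_lt_one (continuousOn_slice sol.W_cont ht)
    have e2 := integral_sq_nonneg fun x => Z x t
    have e3 : |Z 0 t| ^ 2 = Z 0 t ^ 2 := sq_abs _
    simp only [hζ, dissipation]
    nlinarith [sq_nonneg (|Z 0 t| - ∫ y in (0 : ℝ)..1, |W y t|)]
  have hflow : ∀ s ∈ Icc (0 : ℝ) 1, 0 ≤ t + D * s := fun s hs => by have := hs.1; positivity
  have hcomp : ContinuousOn (fun s => ζ (t + D * s)) (Icc 0 1) := hζc.comp (by fun_prop) hflow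
  have hint : IntervalIntegrable (fun s => ζ (t + D * s)) volume 0 1 := by
    refine ContinuousOn.intervalIntegrable ?_
    rwa [uIcc_of_le zero_le_one]
  have hint' : ∀ s ∈ Icc (0 : ℝ) 1, IntervalIntegrable (fun s => ζ (t + D * s)) volume 0 s :=
    fun s hs => hint.mono_set (by
      rw [uIcc_of_le hs.1, uIcc_of_le zero_le_one]; exact Icc_subset_Icc_right hs.2)
  have hprim : ContinuousOn (fun s => C * ∫ r in (0 : ℝ)..s, ζ (t + D * r)) (Icc 0 1) := by
    have := intervalIntegral.continuousOn_primitive_interval' hint left_mem_uIcc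
    rw [uIcc_of_le zero_le_one] at this
    exact continuousOn_const.mul this
  have hZ := abs_sub_le_of_right_deriv (φ := fun s => Z (1 - s) (t + D * s))
    (φ' := fun s => targetRate Dlo Dhi b₁ θ D W Z P Q d (1 - s) (t + D * s))
    (B := fun s => C * ∫ r in (0 : ℝ)..s, ζ (t + D * r)) (B' := fun s => C * ζ (t + D * s)) h0
    ?_ ?_ (hprim.mono (Icc_subset_Icc_right h1)) ?_ ?_
  · simp only [sub_zero, mul_zero, add_zero, intervalIntegral.integral_same,
      sol.Z_inflow t ht] at hZ
    have h2 : ∫ r in (0 : ℝ)..h, ζ (t + D * r) ≤ ∫ r in (0 : ℝ)..1, ζ (t + D * r) :=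
      intervalIntegral.integral_mono_interval le_rfl h0 h1
        (Eventually.of_forall fun r => hζ0 _) hint
    have h3 : |Z (1 - h) (t + D * h)| ≤ C * ∫ r in (0 : ℝ)..1, ζ (t + D * r) :=
      hZ.trans (mul_le_mul_of_nonneg_left h2 hC)
    have h4 := sq_integral_abs_le zero_lt_one hcomp
    have h5 : ∫ r in (0 : ℝ)..1, |ζ (t + D * r)| = ∫ r in (0 : ℝ)..1, ζ (t + D * r) :=
      intervalIntegral.integral_congr fun r _ => abs_of_nonneg (hζ0 _)
    have h6 : ∫ r in (0 : ℝ)..1, ζ (t + D * r) ^ 2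
        ≤ ∫ r in (0 : ℝ)..1, 2 * dissipation W Z (t + D * r) := by
      have i1 : ContinuousOn (fun r => 2 * dissipation W Z (t + D * r)) (Icc 0 1) :=
        continuousOn_const.mul (sol.continuousOn_dissipation.comp (by fun_prop) hflow)
      refine intervalIntegral.integral_mono_on zero_le_one ?_ ?_ fun r hr => hζS _ (hflow r hr)
      · refine ContinuousOn.intervalIntegrable ?_
        rw [uIcc_of_le zero_le_one]
        exact hcomp.pow 2
      · refine ContinuousOn.intervalIntegrable ?_
        rwa [uIcc_of_le zero_le_one]
    have h7 : ∫ r in (0 : ℝ)..1, 2 * dissipation W Z (t + D * r)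
        = 2 * (D⁻¹ * ∫ s in t..(t + D), dissipation W Z s) := by
      rw [intervalIntegral.integral_const_mul,
        intervalIntegral.integral_comp_add_mul (fun s => dissipation W Z s) hD.ne' t]
      simp
    rw [h5, sub_zero, one_mul] at h4
    calc Z (1 - h) (t + D * h) ^ 2 = |Z (1 - h) (t + D * h)| ^ 2 := (sq_abs _).symm
      _ ≤ (C * ∫ r in (0 : ℝ)..1, ζ (t + D * r)) ^ 2 := pow_le_pow_left₀ (abs_nonneg _) h3 2
      _ = C ^ 2 * (∫ r in (0 : ℝ)..1, ζ (t + D * r)) ^ 2 := by ring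
      _ ≤ C ^ 2 * (2 * (D⁻¹ * ∫ s in t..(t + D), dissipation W Z s)) :=
        mul_le_mul_of_nonneg_left (h4.trans (h6.trans_eq h7)) (sq_nonneg _)
      _ = _ := by ring
  · refine sol.Z_cont.comp (f := fun s => (1 - s, t + D * s)) (by fun_prop) fun s hs => ?_
    exact ⟨⟨by linarith [hs.2], by linarith [hs.1]⟩, hflow s ⟨hs.1, hs.2.trans h1⟩⟩
  · intro s hs
    exact sol.Z_deriv_characteristic hD hs.1.le (hs.2.trans_le h1) (by linarith [hs.1]) ht
  · intro s hs
    have hs1 : s < 1 := hs.2.trans_le h1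
    have h2 := intervalIntegral.integral_hasDerivWithinAt_right
      (hint' s ⟨hs.1.le, hs1.le⟩) (s := Ici s) (t := Ioi s)
      ⟨Ioc s 1, Ioc_mem_nhdsGT hs1, (hcomp.mono fun r hr =>
        ⟨hs.1.le.trans hr.1.le, hr.2⟩).aestronglyMeasurable measurableSet_Ioc⟩
      ((hcomp.continuousAt (Icc_mem_nhds hs.1 hs1)).continuousWithinAt)
    exact h2.const_mul C
  · intro s hs
    exact hG _ (hflow s ⟨hs.1.le, hs.2.le.trans h1⟩) _
      ⟨by linarith [hs.2], by linarith [hs.1]⟩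

/-- If the dissipated quantities are integrable in time, then the state of the target system
converges to zero uniformly in space. -/
theorem eventually_abs_le (sol : IsTargetSolution Dlo Dhi b₁ θ D B₁ B₂ B₃ B₄ W Z P Q d)
    (hb : 0 < b₁) (hθ : 0 ≤ θ) (hDlo : 0 < Dlo) (hD : D ∈ Icc Dlo Dhi) (hB₁ : 0 ≤ B₁)
    (hB₂ : 0 ≤ B₂) (hB₃ : 0 ≤ B₃) (hB₄ : 0 ≤ B₄) {M M' : ℝ}
    (hM : ∀ t ≥ 0, targetEnergy b₁ W Z t ≤ M)
    (hM' : ∀ T ≥ 0, ∫ t in (0 : ℝ)..T, dissipation W Z t ≤ M') {ε : ℝ} (hε : 0 < ε) :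
    ∀ᶠ t in atTop, ∀ x ∈ Icc (0 : ℝ) 1, |W x t| ≤ ε ∧ |Z x t| ≤ ε := by
  have hD0 : 0 < D := hDlo.trans_le hD.1
  obtain ⟨C, hC, hG⟩ := sol.exists_abs_rate_le hb hθ hDlo hD hB₁ hB₂ hB₃ hB₄ hM
  set c := 2 * C ^ 2 / D with hc
  have hc0 : 0 ≤ c := by positivity
  obtain ⟨T, hT, htail⟩ := exists_tail_bound sol.continuousOn_dissipation
    (fun t _ => dissipation_nonneg W Z t) hM' (div_pos (pow_pos hε 2) (by linarith : 0 < c + 1))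
  have hZ : ∀ t ≥ T + D, ∀ x ∈ Icc (0 : ℝ) 1, |Z x t| ≤ ε := by
    intro t ht x hx
    have hDx : 0 ≤ D * x := mul_nonneg hD0.le hx.1
    have h1 : T ≤ t - D * (1 - x) := by linarith
    have h2 := sol.sq_Z_le hD0 hC hG (t := t - D * (1 - x)) (h := 1 - x) (by linarith)
      (by linarith [hx.2]) (by linarith [hx.1])
    rw [sub_sub_cancel, sub_add_cancel] at h2
    refine abs_le_of_sq_le_sq (h2.trans ?_) hε.le
    calc _ ≤ c * (ε ^ 2 / (c + 1)) :=
          mul_le_mul_of_nonneg_left (htail _ _ h1 (by linarith)) hc0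
      _ ≤ ε ^ 2 := by
          rw [mul_div_assoc', div_le_iff₀ (by linarith)]
          nlinarith [sq_nonneg ε]
  filter_upwards [eventually_ge_atTop (T + D + 1)] with t ht x hx
  refine ⟨?_, hZ t (by linarith) x hx⟩
  have h1 := sol.W_transport 1 (t - (1 - x)) (1 - x) (by linarith [hx.2]) (by linarith [hx.1])
    le_rfl (by linarith [hx.1])
  rw [sub_sub_cancel, sub_add_cancel, sol.W_inflow _ (by linarith [hx.1])] at h1
  rw [h1]
  exact hZ _ (by linarith [hx.1]) 0 ⟨le_rfl, zero_le_one⟩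

end IsTargetSolution

/-! ### Equivalence of norms and conclusion -/

theorem abs_integral_kernel_le {κ φ : ℝ → ℝ} {C x : ℝ} (hx : x ∈ Icc (0 : ℝ) 1)
    (hφ : ContinuousOn φ (Icc 0 1)) (hC : 0 ≤ C) (h : ∀ y ∈ Ioo 0 x, |κ y| ≤ C) :
    |∫ y in (0 : ℝ)..x, κ y * φ y| ≤ C * ∫ y in (0 : ℝ)..1, |φ y| := by
  simp only [mul_comm (κ _)]
  refine (abs_integral_mul_le (e := 0) hx.1 (hφ.mono (Icc_subset_Icc_right hx.2))
    fun y hy _ => h y hy).trans (mul_le_mul_of_nonneg_left ?_ hC)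
  refine intervalIntegral.integral_mono_interval le_rfl hx.1 hx.2
    (Eventually.of_forall fun y => abs_nonneg _) (ContinuousOn.intervalIntegrable ?_)
  rw [uIcc_of_le zero_le_one]
  exact hφ.abs

theorem integral_sq_le_of_abs_le {φ ψ : ℝ → ℝ} {r : ℝ} (hφ : ContinuousOn φ (Icc 0 1))
    (hψ : ContinuousOn ψ (Icc 0 1)) (h : ∀ x ∈ Icc (0 : ℝ) 1, |φ x| ≤ |ψ x| + r) :
    ∫ x in (0 : ℝ)..1, φ x ^ 2 ≤ 2 * (∫ x in (0 : ℝ)..1, ψ x ^ 2) + 2 * r ^ 2 := by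
  have hi : ∀ {m : ℝ → ℝ}, ContinuousOn m (Icc 0 1) → IntervalIntegrable m volume 0 1 :=
    fun h => ContinuousOn.intervalIntegrable (by rwa [uIcc_of_le zero_le_one])
  have h2 : IntervalIntegrable (fun x => 2 * ψ x ^ 2) volume 0 1 :=
    hi (continuousOn_const.mul (hψ.pow 2))
  calc ∫ x in (0 : ℝ)..1, φ x ^ 2 ≤ ∫ x in (0 : ℝ)..1, (2 * ψ x ^ 2 + 2 * r ^ 2) := by
        refine intervalIntegral.integral_mono_on zero_le_one (hi (hφ.pow 2))
          (h2.add intervalIntegrable_const) fun x hx => ?_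
        have h1 := pow_le_pow_left₀ (abs_nonneg _) (h x hx) 2
        rw [sq_abs] at h1
        nlinarith [sq_nonneg (|ψ x| - r), sq_abs (ψ x)]
    _ = _ := by
        rw [intervalIntegral.integral_add h2 intervalIntegrable_const,
          intervalIntegral.integral_const_mul]
        simp

/-- A pair of pointwise estimates, of the form satisfied by the backstepping transformation and by
its inverse, bounds the `L²` norms. -/
theorem integral_sq_add_le {φ ψ φ' ψ' : ℝ → ℝ} {C : ℝ} (hφ : ContinuousOn φ (Icc 0 1))
    (hψ : ContinuousOn ψ (Icc 0 1)) (hφ' : ContinuousOn φ' (Icc 0 1))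
    (hψ' : ContinuousOn ψ' (Icc 0 1))
    (h : ∀ x ∈ Icc (0 : ℝ) 1,
      |φ x| ≤ |φ' x| + C * ((∫ y in (0 : ℝ)..1, |φ' y|) + ∫ y in (0 : ℝ)..1, |ψ' y|))
    (h' : ∀ x ∈ Icc (0 : ℝ) 1,
      |ψ x| ≤ |ψ' x| + C * ((∫ y in (0 : ℝ)..1, |φ' y|) + ∫ y in (0 : ℝ)..1, |ψ' y|)) :
    (∫ x in (0 : ℝ)..1, φ x ^ 2) + (∫ x in (0 : ℝ)..1, ψ x ^ 2)
      ≤ (2 + 8 * C ^ 2) * ((∫ x in (0 : ℝ)..1, φ' x ^ 2) + ∫ x in (0 : ℝ)..1, ψ' x ^ 2) := by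
  have h1 := integral_sq_le_of_abs_le hφ hφ' h
  have h2 := integral_sq_le_of_abs_le hψ hψ' h'
  have h3 := sq_integral_abs_le zero_lt_one hφ'
  have h4 := sq_integral_abs_le zero_lt_one hψ'
  set a := ∫ y in (0 : ℝ)..1, |φ' y|
  set b := ∫ y in (0 : ℝ)..1, |ψ' y|
  have h5 : (C * (a + b)) ^ 2
      ≤ 2 * C ^ 2 * ((∫ x in (0 : ℝ)..1, φ' x ^ 2) + ∫ x in (0 : ℝ)..1, ψ' x ^ 2) := by
    have : (a + b) ^ 2 ≤ 2 * ((∫ x in (0 : ℝ)..1, φ' x ^ 2) + ∫ x in (0 : ℝ)..1, ψ' x ^ 2) := by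
      nlinarith [sq_nonneg (a - b)]
    nlinarith [mul_le_mul_of_nonneg_left this (sq_nonneg C)]
  linarith

/-- The transformation and its inverse are bounded, uniformly over the delay estimates. -/
theorem Kernels.exists_transform_bound {f : ℝ → ℝ → ℝ} {g : ℝ → ℝ} (K : Kernels f g)
    (hf : ContinuousOn (fun p : ℝ × ℝ => f p.1 p.2) triangle) (hg : ContinuousOn g (Icc 0 1))
    {Dlo Dhi : ℝ} (hDlo : 0 < Dlo) :
    ∃ C, 0 ≤ C ∧ ∀ d ∈ Icc Dlo Dhi, ∀ φ ψ : ℝ → ℝ, ContinuousOn φ (Icc 0 1) →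
      ContinuousOn ψ (Icc 0 1) → ∀ x ∈ Icc (0 : ℝ) 1,
      (|K.w φ x| ≤ |φ x| + C * ((∫ y in (0 : ℝ)..1, |φ y|) + ∫ y in (0 : ℝ)..1, |ψ y|) ∧
        |K.z d φ ψ x| ≤ |ψ x| + C * ((∫ y in (0 : ℝ)..1, |φ y|) + ∫ y in (0 : ℝ)..1, |ψ y|)) ∧
      |φ x| ≤ |K.w φ x| + C * ((∫ y in (0 : ℝ)..1, |K.w φ y|)
        + ∫ y in (0 : ℝ)..1, |K.z d φ ψ y|) ∧
      |ψ x| ≤ |K.z d φ ψ x| + C * ((∫ y in (0 : ℝ)..1, |K.w φ y|)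
        + ∫ y in (0 : ℝ)..1, |K.z d φ ψ y|) := by
  have hbox : Icc (0 : ℝ) 1 ×ˢ (Icc (0 : ℝ) 1 ×ˢ Icc Dlo Dhi) ⊆ slab :=
    fun p hp => ⟨hp.1, hp.2.1, hDlo.trans_le hp.2.2.1⟩
  have hboxc : IsCompact (Icc (0 : ℝ) 1 ×ˢ (Icc (0 : ℝ) 1 ×ˢ Icc Dlo Dhi)) :=
    isCompact_Icc.prod (isCompact_Icc.prod isCompact_Icc)
  obtain ⟨Ck, hCk, hk⟩ := exists_bound_of_isCompact isCompact_triangle K.k_cont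
  obtain ⟨Cl, hCl, hl⟩ := exists_bound_of_isCompact isCompact_triangle K.l_cont
  obtain ⟨Cγ, hCγ, hγ⟩ := exists_bound_of_isCompact hboxc (K.γ_lip.continuousOn.mono hbox)
  obtain ⟨Cη, hCη, hη⟩ := exists_bound_of_isCompact hboxc (K.η_cont.mono hbox)
  set C := Ck + Cl + (1 + |Dhi|) * Cγ + (1 + |Dhi|) * Cη with hC
  have hγ' : 0 ≤ |Dhi| * Cγ := by positivity
  have hη' : 0 ≤ |Dhi| * Cη := by positivity
  have hC0 : 0 ≤ C := by positivity
  have h1m : (1 : ℝ) ∈ Icc (0 : ℝ) 1 := ⟨zero_le_one, le_rfl⟩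
  refine ⟨C, hC0, fun d hd φ ψ hφ hψ x hx => ?_⟩
  have hd0 : 0 < d := hDlo.trans_le hd.1
  have hdabs : |d| ≤ |Dhi| := abs_le_abs_of_nonneg hd0.le hd.2
  have hw := K.continuousOn_w hφ
  have hz := K.continuousOn_z hφ hψ hd0
  have htri : ∀ y ∈ Ioo 0 x, (x, y) ∈ triangle := fun y hy => ⟨hy.1.le, hy.2.le, hx.2⟩
  have hsub : ∀ y ∈ Ioo 0 x, x - y ∈ Icc (0 : ℝ) 1 := fun y hy =>
    ⟨by linarith [hy.2], by linarith [hy.1, hx.2]⟩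
  have n1 := integral_abs_nonneg φ
  have n2 := integral_abs_nonneg ψ
  have n3 := integral_abs_nonneg (K.w φ)
  have n4 := integral_abs_nonneg (K.z d φ ψ)
  have b1 := abs_integral_kernel_le (κ := fun y => K.k x y) hx hφ hCk fun y hy => hk _ (htri y hy)
  have b2 := abs_integral_kernel_le (κ := fun y => K.l x y) hx hw hCl fun y hy => hl _ (htri y hy)
  have b3 := abs_integral_kernel_le (κ := fun y => K.γ x y d) h1m hφ hCγ fun y hy =>
    hγ (x, y, d) ⟨hx, Ioo_subset_Icc_self hy, hd⟩
  have b4 := abs_integral_kernel_le (κ := fun y => K.q (x - y) d) hx hψ hCγ fun y hy =>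
    hγ (x - y, 1, d) ⟨hsub y hy, h1m, hd⟩
  have b5 := abs_integral_kernel_le (κ := fun y => K.η x y d) h1m hw hCη fun y hy =>
    hη (x, y, d) ⟨hx, Ioo_subset_Icc_self hy, hd⟩
  have b6 := abs_integral_kernel_le (κ := fun y => K.p (x - y) d) hx hz hCη fun y hy =>
    hη (x - y, 1, d) ⟨hsub y hy, h1m, hd⟩
  refine ⟨⟨?_, ?_⟩, ?_, ?_⟩
  · have h1 : Ck * (∫ y in (0 : ℝ)..1, |φ y|)
        ≤ C * ((∫ y in (0 : ℝ)..1, |φ y|) + ∫ y in (0 : ℝ)..1, |ψ y|) :=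
      mul_le_mul (by linarith) (by linarith) n1 hC0
    have h2 := abs_sub (φ x) (∫ y in (0 : ℝ)..x, K.k x y * φ y)
    rw [Kernels.w]
    linarith
  · have h1 : Cγ * (∫ y in (0 : ℝ)..1, |φ y|) ≤ C * ∫ y in (0 : ℝ)..1, |φ y| :=
      mul_le_mul_of_nonneg_right (by linarith) n1
    have h2 : |d * ∫ y in (0 : ℝ)..x, K.q (x - y) d * ψ y| ≤ C * ∫ y in (0 : ℝ)..1, |ψ y| := by
      rw [abs_mul]
      calc _ ≤ |Dhi| * (Cγ * ∫ y in (0 : ℝ)..1, |ψ y|) :=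
            mul_le_mul hdabs b4 (abs_nonneg _) (abs_nonneg _)
        _ = |Dhi| * Cγ * ∫ y in (0 : ℝ)..1, |ψ y| := by ring
        _ ≤ _ := mul_le_mul_of_nonneg_right (by linarith) n2
    have h3 := abs_sub (ψ x - ∫ y in (0 : ℝ)..1, K.γ x y d * φ y)
      (d * ∫ y in (0 : ℝ)..x, K.q (x - y) d * ψ y)
    have h4 := abs_sub (ψ x) (∫ y in (0 : ℝ)..1, K.γ x y d * φ y)
    rw [Kernels.z]
    linarith
  · have h1 : Cl * (∫ y in (0 : ℝ)..1, |K.w φ y|)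
        ≤ C * ((∫ y in (0 : ℝ)..1, |K.w φ y|) + ∫ y in (0 : ℝ)..1, |K.z d φ ψ y|) :=
      mul_le_mul (by linarith) (by linarith) n3 hC0
    have h2 := congrArg abs (K.eq_w_add hf hφ hx)
    have h3 := abs_add_le (K.w φ x) (∫ y in (0 : ℝ)..x, K.l x y * K.w φ y)
    linarith
  · have h1 : Cη * (∫ y in (0 : ℝ)..1, |K.w φ y|) ≤ C * ∫ y in (0 : ℝ)..1, |K.w φ y| :=
      mul_le_mul_of_nonneg_right (by linarith) n3
    have h2 : |d * ∫ y in (0 : ℝ)..x, K.p (x - y) d * K.z d φ ψ y|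
        ≤ C * ∫ y in (0 : ℝ)..1, |K.z d φ ψ y| := by
      rw [abs_mul]
      calc _ ≤ |Dhi| * (Cη * ∫ y in (0 : ℝ)..1, |K.z d φ ψ y|) :=
            mul_le_mul hdabs b6 (abs_nonneg _) (abs_nonneg _)
        _ = |Dhi| * Cη * ∫ y in (0 : ℝ)..1, |K.z d φ ψ y| := by ring
        _ ≤ _ := mul_le_mul_of_nonneg_right (by linarith) n4
    have h3 := congrArg abs (K.eq_z_add hf hg hd0 hφ hψ hx)
    have h4 := abs_add_le (K.z d φ ψ x + ∫ y in (0 : ℝ)..1, K.η x y d * K.w φ y)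
      (d * ∫ y in (0 : ℝ)..x, K.p (x - y) d * K.z d φ ψ y)
    have h5 := abs_add_le (K.z d φ ψ x) (∫ y in (0 : ℝ)..1, K.η x y d * K.w φ y)
    linarith

namespace IsTargetSolution

variable {Dlo Dhi b₁ θ D B₁ B₂ B₃ B₄ : ℝ} {W Z P Q : ℝ → ℝ → ℝ} {d : ℝ → ℝ}

/-- Stability of the target system, and convergence of its state. -/
theorem stability (sol : IsTargetSolution Dlo Dhi b₁ θ D B₁ B₂ B₃ B₄ W Z P Q d) {L : ℝ}
    (hDlo : 0 < Dlo) (hD : D ∈ Icc Dlo Dhi) (hb : 2 * Dhi < b₁) (hθ : 0 < θ)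
    (hgain : θ * (2 * b₁ ^ 2 * L ^ 2) < min Dlo (b₁ - 2 * Dhi) * min 1 b₁)
    (hB₁ : 0 ≤ B₁) (hB₂ : 0 ≤ B₂) (hB₃ : 0 ≤ B₃) (hB₄ : 0 ≤ B₄) (hL₁ : B₁ + B₂ ≤ L)
    (hL₂ : 2 * B₃ + B₄ ≤ L) :
    (∀ t ≥ 0, targetEnergy b₁ W Z t ≤ Real.exp (lyapunov b₁ θ D W Z d 0 / D) - 1 ∧
      (D - d t) ^ 2 ≤ 2 * θ * lyapunov b₁ θ D W Z d 0) ∧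
    ∀ ε > 0, ∀ᶠ t in atTop, ∀ x ∈ Icc (0 : ℝ) 1, |W x t| ≤ ε ∧ |Z x t| ≤ ε := by
  have hD0 : 0 < D := hDlo.trans_le hD.1
  have hb0 : 0 < b₁ := by linarith [hD.2]
  set m := min Dlo (b₁ - 2 * Dhi) with hmdef
  have hm : 0 < m := lt_min hDlo (by linarith)
  have hmD : m ≤ D := (min_le_left _ _).trans hD.1
  have hbm : 2 * D + m ≤ b₁ := by
    have : m ≤ b₁ - 2 * Dhi := min_le_right _ _
    linarith [hD.2]
  -- the gain condition is strict, hence leaves a fraction `1 - κ` of the dissipation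
  set κ := θ * (2 * b₁ ^ 2 * L ^ 2) / m with hκdef
  have hκ0 : 0 ≤ κ := by positivity
  have hκ1 : κ < 1 := by
    rw [hκdef, div_lt_one hm]
    exact hgain.trans_le (mul_le_of_le_one_right hm.le (min_le_left _ _))
  have hgain' : θ * (2 * b₁ ^ 2 * L ^ 2) ≤ κ * m := (div_mul_cancel₀ _ hm.ne').ge
  set V := lyapunov b₁ θ D W Z d with hV
  set c := (1 - κ) * (m / 2) with hc
  have hc0 : 0 < c := mul_pos (by linarith) (by linarith)
  have hN0 : ∀ t, 0 < 1 + targetEnergy b₁ W Z t := fun t => by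
    linarith [targetEnergy_nonneg hb0.le W Z t]
  have hNc := continuousOn_targetEnergy b₁ sol.W_cont sol.Z_cont
  have hdiss : ∀ T ≥ 0, V T + ∫ t in (0 : ℝ)..T,
      c * dissipation W Z t / (1 + targetEnergy b₁ W Z t) ≤ V 0 := fun T hT =>
    add_integral_le_of_right_deriv (sol.continuousOn_lyapunov hb0.le)
      ((continuousOn_const.mul sol.continuousOn_dissipation).div (continuousOn_const.add hNc)
        fun t _ => (hN0 t).ne')
      (fun t ht => sol.exists_hasDerivWithinAt_lyapunov hm hmD hbm hκ0 hκ1.le hθ hgain' hD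
        hB₁ hB₂ hB₃ hB₄ hL₁ hL₂ ht) hT
  have hlog : ∀ t, 0 ≤ D * Real.log (1 + targetEnergy b₁ W Z t) := fun t =>
    mul_nonneg hD0.le (Real.log_nonneg (by linarith [targetEnergy_nonneg hb0.le W Z t]))
  have hest : ∀ t, 0 ≤ (D - d t) ^ 2 / (2 * θ) := fun t => by positivity
  have hVT : ∀ t ≥ 0, V t ≤ V 0 := fun t ht => by
    have h1 := hdiss t ht
    have h2 : 0 ≤ ∫ t in (0 : ℝ)..t, c * dissipation W Z t / (1 + targetEnergy b₁ W Z t) :=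
      intervalIntegral.integral_nonneg ht fun s _ =>
        div_nonneg (mul_nonneg hc0.le (dissipation_nonneg W Z s)) (hN0 s).le
    linarith
  have hN : ∀ t ≥ 0, targetEnergy b₁ W Z t ≤ Real.exp (V 0 / D) - 1 := fun t ht => by
    have h1 : D * Real.log (1 + targetEnergy b₁ W Z t) ≤ V 0 := by
      have := hVT t ht
      rw [hV, lyapunov] at this
      linarith [hest t]
    have h2 : Real.log (1 + targetEnergy b₁ W Z t) ≤ V 0 / D := by
      rwa [le_div_iff₀ hD0, mul_comm]
    linarith [(Real.log_le_iff_le_exp (hN0 t)).1 h2]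
  refine ⟨fun t ht => ⟨hN t ht, ?_⟩, fun ε hε => ?_⟩
  · have h1 : (D - d t) ^ 2 / (2 * θ) ≤ V 0 := by
      have := hVT t ht
      rw [hV, lyapunov] at this
      linarith [hlog t]
    rwa [div_le_iff₀ (by positivity), mul_comm] at h1
  · set M := Real.exp (V 0 / D) with hM
    have hM0 : 0 < M := Real.exp_pos _
    refine sol.eventually_abs_le hb0 hθ.le hDlo hD hB₁ hB₂ hB₃ hB₄ hN (M' := M * V 0 / c)
      (fun T hT => ?_) hε
    have h1 := hdiss T hT
    have h2 : 0 ≤ V T := add_nonneg (hlog T) (hest T)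
    have hSc : ContinuousOn (dissipation W Z) (Icc 0 T) :=
      sol.continuousOn_dissipation.mono fun s hs => hs.1
    have h3 : c / M * ∫ t in (0 : ℝ)..T, dissipation W Z t
        ≤ ∫ t in (0 : ℝ)..T, c * dissipation W Z t / (1 + targetEnergy b₁ W Z t) := by
      rw [← intervalIntegral.integral_const_mul]
      refine intervalIntegral.integral_mono_on hT ?_ ?_ fun t ht => ?_
      · refine ContinuousOn.intervalIntegrable ?_
        rw [uIcc_of_le hT]
        exact continuousOn_const.mul hSc
      · refine ContinuousOn.intervalIntegrable ?_
        rw [uIcc_of_le hT]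
        exact (continuousOn_const.mul hSc).div (continuousOn_const.add
          (hNc.mono fun s hs => hs.1)) fun t _ => (hN0 t).ne'
      · rw [div_mul_eq_mul_div]
        exact div_le_div_of_nonneg_left (mul_nonneg hc0.le (dissipation_nonneg W Z t)) (hN0 t)
          (by linarith [hN t ht.1])
    have h4 : c / M * ∫ t in (0 : ℝ)..T, dissipation W Z t ≤ V 0 := by linarith
    rw [div_mul_eq_mul_div, div_le_iff₀ hM0] at h4
    rw [le_div_iff₀ hc0]
    linarith

end IsTargetSolution

theorem targetEnergy_bounds {b₁ t : ℝ} {W Z : ℝ → ℝ → ℝ} (hb : 0 < b₁)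
    (hW : ContinuousOn (fun x => W x t) (Icc 0 1)) (hZ : ContinuousOn (fun x => Z x t) (Icc 0 1)) :
    min 1 b₁ * ((∫ x in (0 : ℝ)..1, W x t ^ 2) + ∫ x in (0 : ℝ)..1, Z x t ^ 2)
        ≤ 2 * targetEnergy b₁ W Z t ∧
      targetEnergy b₁ W Z t
        ≤ (1 + b₁) * ((∫ x in (0 : ℝ)..1, W x t ^ 2) + ∫ x in (0 : ℝ)..1, Z x t ^ 2) := by
  have h1 := integral_weight_sq_bounds hW
  have h2 := integral_weight_sq_bounds hZ
  have n1 := integral_sq_nonneg fun x => W x t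
  have n2 := integral_sq_nonneg fun x => Z x t
  have e1 := mul_le_mul_of_nonneg_left h2.1 hb.le
  have e2 := mul_le_mul_of_nonneg_left h2.2 hb.le
  have e3 := mul_le_mul_of_nonneg_right (min_le_left 1 b₁) n1
  have e4 := mul_le_mul_of_nonneg_right (min_le_right 1 b₁) n2
  have e5 := mul_nonneg hb.le n1
  rw [targetEnergy]
  constructor <;> linarith

namespace IsClosedLoopSolution

variable {f : ℝ → ℝ → ℝ} {g : ℝ → ℝ} {K : Kernels f g} {Dlo Dhi b₁ θ D : ℝ}
  {u v : ℝ → ℝ → ℝ} {Dhat : ℝ → ℝ}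

/-- Convergence of the transformed state carries over to the original state. -/
theorem eventually_abs_lt (sol : IsClosedLoopSolution f g K Dlo Dhi b₁ θ D u v Dhat)
    (hDlo : 0 < Dlo) (hr : ∀ t ≥ 0, Dhat t ∈ Icc Dlo Dhi) {C : ℝ} (hC : 0 ≤ C)
    (htr : ∀ d ∈ Icc Dlo Dhi, ∀ φ ψ : ℝ → ℝ, ContinuousOn φ (Icc 0 1) →
      ContinuousOn ψ (Icc 0 1) → ∀ x ∈ Icc (0 : ℝ) 1,
      |φ x| ≤ |K.w φ x| + C * ((∫ y in (0 : ℝ)..1, |K.w φ y|)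
        + ∫ y in (0 : ℝ)..1, |K.z d φ ψ y|) ∧
      |ψ x| ≤ |K.z d φ ψ x| + C * ((∫ y in (0 : ℝ)..1, |K.w φ y|)
        + ∫ y in (0 : ℝ)..1, |K.z d φ ψ y|))
    (hconv : ∀ ε > 0, ∀ᶠ t in atTop, ∀ x ∈ Icc (0 : ℝ) 1,
      |K.w (fun y => u y t) x| ≤ ε ∧
        |K.z (Dhat t) (fun y => u y t) (fun y => v y t) x| ≤ ε) {ε : ℝ} (hε : 0 < ε) :
    ∀ᶠ t in atTop, ∀ x ∈ Icc (0 : ℝ) 1, |u x t| < ε ∧ |v x t| < ε := by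
  filter_upwards [hconv (ε / (2 * (1 + 2 * C))) (by positivity), eventually_ge_atTop 0]
    with t ht ht0 x hx
  have h1 := htr (Dhat t) (hr t ht0) _ _ (sol.u_slice ht0) (sol.v_slice ht0) x hx
  set r := ε / (2 * (1 + 2 * C)) with hrdef
  have hint : ∀ {φ : ℝ → ℝ}, ContinuousOn φ (Icc 0 1) → (∀ x ∈ Icc (0 : ℝ) 1, |φ x| ≤ r) →
      ∫ y in (0 : ℝ)..1, |φ y| ≤ r := fun {φ} hφ h => by
    have h2 := intervalIntegral.integral_mono_on (μ := volume) zero_le_one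
      (g := fun _ => r) (f := fun y => |φ y|)
      (ContinuousOn.intervalIntegrable (by rw [uIcc_of_le zero_le_one]; exact hφ.abs))
      intervalIntegrable_const h
    simpa using h2
  have h2 := hint (K.continuousOn_w (sol.u_slice ht0)) fun x hx => (ht x hx).1
  have h3 := hint (K.continuousOn_z (sol.u_slice ht0) (sol.v_slice ht0)
    (hDlo.trans_le (hr t ht0).1)) fun x hx => (ht x hx).2
  have h4 := mul_le_mul_of_nonneg_left (add_le_add h2 h3) hC
  have h5 : r * (1 + 2 * C) = ε / 2 := by rw [hrdef]; field_simp
  constructor <;> linarith [ht x hx]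

end IsClosedLoopSolution

end DelayPIDE

theorem theorem1 (f : ℝ → ℝ → ℝ) (g : ℝ → ℝ)
    (hf : ContinuousOn (fun p : ℝ × ℝ => f p.1 p.2) DelayPIDE.triangle)
    (hg : ContinuousOn g (Set.Icc 0 1))
    (K : DelayPIDE.Kernels f g)
    (Dlo Dhi : ℝ) (hDlo : 0 < Dlo) (hD : Dlo ≤ Dhi)
    (B₁ B₂ B₃ B₄ L : ℝ) (hB : K.Bounds Dlo Dhi B₁ B₂ B₃ B₄)
    (hL : L = max (B₁ + B₂) (2 * B₃ + B₄))
    (b₁ : ℝ) (hb₁ : 2 * Dhi < b₁)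
    (θ : ℝ) (hθ : 0 < θ)
    (hθ' : θ * (2 * b₁ ^ 2 * L ^ 2) < min Dlo (b₁ - 2 * Dhi) * min 1 b₁) :
    ∃ R ρ : ℝ, 0 < R ∧ 0 < ρ ∧
      ∀ D ∈ Set.Icc Dlo Dhi, ∀ (u v : ℝ → ℝ → ℝ) (Dhat : ℝ → ℝ),
        DelayPIDE.IsClosedLoopSolution f g K Dlo Dhi b₁ θ D u v Dhat →
          (∀ t ≥ 0, DelayPIDE.Psi D u v Dhat t
            ≤ R * (Real.exp (ρ * DelayPIDE.Psi D u v Dhat 0) - 1)) ∧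
          TendstoUniformlyOn (fun t x => u x t) (fun _ => 0) Filter.atTop (Set.Icc 0 1) ∧
          TendstoUniformlyOn (fun t x => v x t) (fun _ => 0) Filter.atTop (Set.Icc 0 1) := by
  obtain ⟨hB₁, hB₂, hB₃, hB₄⟩ := hB.nonneg hDlo hD
  obtain ⟨C, hC, htr⟩ := K.exists_transform_bound (Dhi := Dhi) hf hg hDlo
  have hDhi : 0 < Dhi := hDlo.trans_le hD
  have hb0 : 0 < b₁ := by linarith
  have hμ : 0 < min 1 b₁ := lt_min one_pos hb0
  set A := 2 + 8 * C ^ 2 with hA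
  have hA0 : 0 < A := by positivity
  set C₃ := Dhi * ((1 + b₁) * A) + 1 / (2 * θ) with hC₃
  have hC₃0 : 0 < C₃ := by positivity
  refine ⟨A * (2 / min 1 b₁) + 2 * θ * Dlo, C₃ / Dlo, by positivity, by positivity, ?_⟩
  intro D hDm u v Dhat sol
  have hD0 : 0 < D := hDlo.trans_le hDm.1
  have hr := sol.Dhat_mem hθ.le
  have tsol := sol.isTargetSolution hf hg hDlo hB hb0.le hθ.le hD0
  obtain ⟨hstab, hconv⟩ := tsol.stability hDlo hDm hb₁ hθ hθ' hB₁ hB₂ hB₃ hB₄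
    (hL ▸ le_max_left _ _) (hL ▸ le_max_right _ _)
  have hlt := fun ε (hε : (0 : ℝ) < ε) => sol.eventually_abs_lt hDlo hr hC
    (fun d hd φ ψ hφ hψ x hx => (htr d hd φ ψ hφ hψ x hx).2) hconv hε
  refine ⟨fun t ht => ?_, ?_, ?_⟩
  · set W : ℝ → ℝ → ℝ := fun x t => K.w (fun y => u y t) x
    set Z : ℝ → ℝ → ℝ := fun x t => K.z (Dhat t) (fun y => u y t) (fun y => v y t) x
    set V := DelayPIDE.lyapunov b₁ θ D W Z Dhat 0 with hV
    set Ψ := DelayPIDE.Psi D u v Dhat 0 with hΨ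
    have hWc : ∀ t ≥ 0, ContinuousOn (fun x => W x t) (Icc 0 1) := fun t ht =>
      K.continuousOn_w (sol.u_slice ht)
    have hZc : ∀ t ≥ 0, ContinuousOn (fun x => Z x t) (Icc 0 1) := fun t ht =>
      K.continuousOn_z (sol.u_slice ht) (sol.v_slice ht) (hDlo.trans_le (hr t ht).1)
    -- the Lyapunov function is initially bounded by `Ψ`, with a constant independent of `D`
    have hV0 : V ≤ C₃ * Ψ := by
      have h1 := DelayPIDE.integral_sq_add_le (hWc 0 le_rfl) (hZc 0 le_rfl) (sol.u_slice le_rfl)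
        (sol.v_slice le_rfl)
        (fun x hx => (htr _ (hr 0 le_rfl) _ _ (sol.u_slice le_rfl) (sol.v_slice le_rfl) x hx).1.1)
        (fun x hx => (htr _ (hr 0 le_rfl) _ _ (sol.u_slice le_rfl) (sol.v_slice le_rfl) x hx).1.2)
      have h2 := (DelayPIDE.targetEnergy_bounds hb0 (hWc 0 le_rfl) (hZc 0 le_rfl)).2
      have h3 : DelayPIDE.targetEnergy b₁ W Z 0 ≤ (1 + b₁) * A
          * ((∫ x in (0 : ℝ)..1, u x 0 ^ 2) + ∫ x in (0 : ℝ)..1, v x 0 ^ 2) := by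
        rw [mul_assoc]
        exact h2.trans (mul_le_mul_of_nonneg_left h1 (by linarith))
      have hN0 := DelayPIDE.targetEnergy_nonneg hb0.le W Z 0
      have h4 : D * Real.log (1 + DelayPIDE.targetEnergy b₁ W Z 0)
          ≤ Dhi * DelayPIDE.targetEnergy b₁ W Z 0 :=
        mul_le_mul hDm.2 (by
          linarith [Real.log_le_sub_one_of_pos (by linarith : 0 < 1
            + DelayPIDE.targetEnergy b₁ W Z 0)]) (Real.log_nonneg (by linarith)) hDhi.le
      have h5 := mul_le_mul_of_nonneg_left h3 hDhi.le
      have n1 := DelayPIDE.integral_sq_nonneg fun x => u x 0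
      have n2 := DelayPIDE.integral_sq_nonneg fun x => v x 0
      have n3 := sq_nonneg (D - Dhat 0)
      have n4 : 0 ≤ 1 / (2 * θ)
          * ((∫ x in (0 : ℝ)..1, u x 0 ^ 2) + ∫ x in (0 : ℝ)..1, v x 0 ^ 2) := by positivity
      have n5 : 0 ≤ Dhi * ((1 + b₁) * A) * (D - Dhat 0) ^ 2 := by positivity
      have h6 : (D - Dhat 0) ^ 2 / (2 * θ) = 1 / (2 * θ) * (D - Dhat 0) ^ 2 := by ring
      rw [hV, DelayPIDE.lyapunov, hΨ, DelayPIDE.Psi, h6, hC₃]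
      linarith
    have hV1 : V / D ≤ C₃ / Dlo * Ψ := by
      have h1 : 0 ≤ Ψ := add_nonneg (add_nonneg (DelayPIDE.integral_sq_nonneg fun x => u x 0)
        (DelayPIDE.integral_sq_nonneg fun x => v x 0)) (sq_nonneg _)
      calc V / D ≤ C₃ * Ψ / D := div_le_div_of_nonneg_right hV0 hD0.le
        _ ≤ C₃ * Ψ / Dlo := div_le_div_of_nonneg_left (by positivity) hDlo hDm.1
        _ = _ := by ring
    obtain ⟨hN, hd⟩ := hstab t ht
    have h1 : (∫ x in (0 : ℝ)..1, u x t ^ 2) + (∫ x in (0 : ℝ)..1, v x t ^ 2)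
        ≤ A * ((∫ x in (0 : ℝ)..1, W x t ^ 2) + ∫ x in (0 : ℝ)..1, Z x t ^ 2) :=
      DelayPIDE.integral_sq_add_le (sol.u_slice ht) (sol.v_slice ht) (hWc t ht) (hZc t ht)
        (fun x hx => (htr _ (hr t ht) _ _ (sol.u_slice ht) (sol.v_slice ht) x hx).2.1)
        (fun x hx => (htr _ (hr t ht) _ _ (sol.u_slice ht) (sol.v_slice ht) x hx).2.2)
    have h2 : (∫ x in (0 : ℝ)..1, W x t ^ 2) + (∫ x in (0 : ℝ)..1, Z x t ^ 2)
        ≤ 2 / min 1 b₁ * (Real.exp (C₃ / Dlo * Ψ) - 1) := by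
      rw [div_mul_eq_mul_div, le_div_iff₀ hμ, mul_comm]
      refine (DelayPIDE.targetEnergy_bounds hb0 (hWc t ht) (hZc t ht)).1.trans ?_
      have := Real.exp_le_exp.2 hV1
      linarith
    have h3 : (D - Dhat t) ^ 2 ≤ 2 * θ * Dlo * (Real.exp (C₃ / Dlo * Ψ) - 1) := by
      refine hd.trans ?_
      have h4 := Real.add_one_le_exp (C₃ / Dlo * Ψ)
      have h5 : C₃ * Ψ = Dlo * (C₃ / Dlo * Ψ) := by field_simp
      rw [mul_assoc (2 * θ)]
      refine mul_le_mul_of_nonneg_left (hV0.trans ?_) (by linarith)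
      rw [h5]
      exact mul_le_mul_of_nonneg_left (by linarith) hDlo.le
    have h6 := h1.trans (mul_le_mul_of_nonneg_left h2 hA0.le)
    rw [DelayPIDE.Psi]
    linarith
  · rw [Metric.tendstoUniformlyOn_iff]
    intro ε hε
    filter_upwards [hlt ε hε] with t ht x hx
    simpa [Real.dist_eq] using (ht x hx).1
  · rw [Metric.tendstoUniformlyOn_iff]
    intro ε hε
    filter_upwards [hlt ε hε] with t ht x hx
    simpa [Real.dist_eq] using (ht x hx).2
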